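/- Let $K\subset\mathbb R^3$ be a regular convex cone, i.e. a closed convex cone with non-empty interior that contains no line. Let $k\ge 5$ be an integer and suppose that $\partial K\setminus\{0\}$ is a surface of class $C^k$ which is everywhere positively curved, i.e. whose second fundamental form (taken with the sign for which it is non-negative on the boundary of a convex body) is positive on every tangent vector not parallel to the generating ray. Let $\gamma\subset\mathbb{RP}^2$ be the projective image of $\partial K\setminus\{0\}$. A $2\pi$-periodic parametrization of $\gamma$ is a $2\pi$-periodic map $c:\mathbb R\to\mathbb{RP}^2$ with image $\gamma$, injective on $[0,2\pi)$, with nowhere vanishing tangent vector; a lift of $c$ is a map $y:\mathbb R\to\mathbb R^3\setminus\{0\}$ such that $c(t)$ is the class of $y(t)$ for all $t$. Then there is a real number $a$ with the following properties. 1. There exist a $2\pi$-periodic parametrization of $\gamma$ of class $C^{k-1}$, a $2\pi$-periodic lift $y:\mathbb R\to\partial K$ of it of class $C^{k-2}$, and a $2\pi$-periodic function $\beta$ of class $C^{k-5}$ with $$y'''(t)+2a\,y'(t)+\beta(t)\,y(t)=0\qquad(t\in\mathbb R).$$ 2. The number $a$ is uniquely determined by $K$: if some $2\pi$-periodic parametrization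 of $\gamma$ of class $C^{k-1}$ has a $2\pi$-periodic lift of class $C^{k-2}$ solving $y'''+2a'y'+\beta y=0$ with a constant $a'$ and a $2\pi$-periodic function $\beta$ of class $C^{k-5}$, then $a'=a$. 3. We have $a\le\frac12$, and $a=\frac12$ if and only if $K$ is ellipsoidal, i.e. a linear image of the cone $\{x_0\ge\sqrt{x_1^2+x_2^2}\}$ under an invertible linear map. 4. The number $a$ is determined by the monodromy of any parametrization, balanced or not. Let $c$ be any $2\pi$-periodic parametrization of $\gamma$ of class $C^{k-1}$ with a $2\pi$-periodic lift $y$ of class $C^{k-2}$ solving $$y'''+2\alpha y'+\alpha' y+\beta y=0$$ with $2\pi$-periodic functions $\alpha,\beta$ of class $C^{k-4}$, $C^{k-5}$. Then the equation $x''+\frac12\alpha x=0$ has a monodromy, that is, there are a vector-valued solution $x=(x_1,x_2)$ with linearly independent components and a real $2\times2$ matrix $T$ with $x(t+2\pi)=T\,x(t)$ for all $t$. For every such $T$, with spectrum $\sigma(T)\subset\mathbb C$: - for every $\lambda>1$: $\sigma(T)=\{\lambda,\lambda^{-1}\}$ if and only if $a=-\dfrac{\log^2\lambda}{2\pi^2}$;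 - $\sigma(T)=\{1\}$ if and only if $a=0$; - for every $\varphi\in(0,\pi)$: $\sigma(T)=\{e^{i\varphi},e^{-i\varphi}\}$ if and only if $a=\dfrac{\varphi^2}{2\pi^2}$; - $T=-I$ if and only if $a=\frac12$. -/

import Mathlib

open Set Filter Topology Real

/-- The ambient space `ℝ³`. -/
abbrev Space3 : Type := Fin 3 → ℝ

/-- The real projective plane. -/
abbrev ProjPlane : Type := Projectivization ℝ Space3

/-- A regular convex cone in `ℝ³`: a closed convex cone with non-empty interior that contains no
line (a closed convex cone contains a line if and only if it contains some `v ≠ 0` together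
with `-v`). -/
structure IsRegularCone (K : ConvexCone ℝ Space3) : Prop where
  isClosed : IsClosed (K : Set Space3)
  interior_nonempty : (interior (K : Set Space3)).Nonempty
  salient : K.Salient

/-- `∂K ∖ {0}` is a surface of class `C^k` which is positively curved: near each of its points `p`
the cone is the sublevel set `f ≤ 0` of a `C^k` function with `Df(p) ≠ 0`, and the second
fundamental form of the surface `f = 0` at `p` (which is `D²f(p)` restricted to the tangent plane
`ker Df(p)`, up to a positive factor) is positive on all tangent vectors except those along the
ray through `p`, on which it vanishes for any cone. -/
def HasPositivelyCurvedBoundary (k : ℕ) (K : ConvexCone ℝ Space3) : Prop :=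
  ∀ p ∈ frontier (K : Set Space3), p ≠ 0 →
    ∃ f : Space3 → ℝ, ContDiffAt ℝ k f p ∧ fderiv ℝ f p ≠ 0 ∧
      (∀ᶠ x in 𝓝 p, x ∈ K ↔ f x ≤ 0) ∧
      ∀ v : Space3, fderiv ℝ f p v = 0 → v ∉ Submodule.span ℝ {p} →
        0 < fderiv ℝ (fderiv ℝ f) p v v

/-- The cone `√(x₁² + x₂²) ≤ x₀`. -/
def lorentzCone : Set Space3 := {x | 0 ≤ x 0 ∧ x 1 ^ 2 + x 2 ^ 2 ≤ x 0 ^ 2}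

/-- A cone is ellipsoidal if it is a linear image of the circular cone. -/
def IsEllipsoidal (K : ConvexCone ℝ Space3) : Prop :=
  ∃ A : Space3 ≃ₗ[ℝ] Space3, (K : Set Space3) = A '' lorentzCone

/-- The projective image of `∂K ∖ {0}`. -/
def projBoundary (K : ConvexCone ℝ Space3) : Set ProjPlane :=
  {q | ∃ (v : Space3) (hv : v ≠ 0), v ∈ frontier (K : Set Space3) ∧ q = Projectivization.mk ℝ v hv}

/-- `c` is a regular `2π`-periodic parametrization of class `C^n` (`n ≥ 1`) of the projective
boundary curve of `K`, one period running once through the curve. Smoothness and regularity of a map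
into the projective plane are expressed by local lifts `η` to `ℝ³ ∖ {0}`: the tangent vector
does not vanish if and only if `η` and `η'` are linearly independent. -/
structure IsPeriodicParam (K : ConvexCone ℝ Space3) (n : ℕ) (c : ℝ → ProjPlane) : Prop where
  periodic : Function.Periodic c (2 * π)
  injOn : InjOn c (Ico 0 (2 * π))
  range_eq : range c = projBoundary K
  regular : ∀ t, ∃ η : ℝ → Space3, ContDiffAt ℝ n η t ∧
    LinearIndependent ℝ ![η t, deriv η t] ∧
    ∀ᶠ s in 𝓝 t, ∃ h : η s ≠ 0, c s = Projectivization.mk ℝ (η s) h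

/-- `y` is a `2π`-periodic lift of class `C^(k-2)` of the curve `c`, solving
`[y''' + 2 α y' + α' y] + β y = 0` with `2π`-periodic coefficients `α`, `β` of class `C^(k-4)` and
`C^(k-5)` (used for `k ≥ 5`). -/
structure IsODELift (k : ℕ) (c : ℝ → ProjPlane) (y : ℝ → Space3) (α β : ℝ → ℝ) : Prop where
  lift : ∀ t, ∃ h : y t ≠ 0, c t = Projectivization.mk ℝ (y t) h
  periodic : Function.Periodic y (2 * π)
  periodic_alpha : Function.Periodic α (2 * π)
  periodic_beta : Function.Periodic β (2 * π)
  contDiff : ContDiff ℝ (k - 2 : ℕ) y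
  contDiff_alpha : ContDiff ℝ (k - 4 : ℕ) α
  contDiff_beta : ContDiff ℝ (k - 5 : ℕ) β
  ode : ∀ t, (iteratedDeriv 3 y t + (2 * α t) • deriv y t + deriv α t • y t) + β t • y t = 0

/-- `T` is the monodromy, with respect to some basis `x = (x₁, x₂)` of solutions, of the equation
`x'' + (α / 2) x = 0` with `2π`-periodic `α`: one has `x (t + 2π) = T x(t)`. -/
def IsMonodromy (α : ℝ → ℝ) (T : Matrix (Fin 2) (Fin 2) ℝ) : Prop :=
  ∃ x : ℝ → Fin 2 → ℝ, ContDiff ℝ 2 x ∧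
    (∀ t, iteratedDeriv 2 x t + (α t / 2) • x t = 0) ∧
    LinearIndependent ℝ (fun (i : Fin 2) (t : ℝ) => x t i) ∧
    ∀ t, x (t + 2 * π) = T.mulVec (x t)

/-- The set of complex eigenvalues of a real matrix. -/
def complexSpectrum (T : Matrix (Fin 2) (Fin 2) ℝ) : Set ℂ :=
  spectrum ℂ (T.map (algebraMap ℝ ℂ))

/-! In suitable linear coordinates the boundary of `K` is the cone over a graph `(cos t, sin t, h
t)`, and positive curvature means `h'' + h > 0`. Write `h'' + h = m⁻³`. The lift `Y = m (cos, sin,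
h)` has `det (Y, Y', Y'') = 1`, so its equation has no second order term: `Y''' + 2αY' + α'Y + βY =
0`. Up to a fixed linear map, a lift of any other parametrization that solves an equation of this
form is `μ Y(ψ)` with `μψ'` constant. Then `√μ x(ψ)` solves the new equation `x'' + (α/2) x = 0`
whenever `x` solves the old one. One turn shifts `ψ` by `2π` or `-2π`, so the monodromy `T` of this
Hill equation depends only on the curve, up to conjugation and inversion
(`IsODELift.exists_hillBasis`).

The analytic core is `hill_comparison`: zeros of a solution of the Hill equation are at least one
period apart, and are exactly one period apart only if `β = 0`. Let `u(t)` be the height of `Y(t)`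
above the tangent plane at `s`, and `v(t)` the height of the fixed boundary point at `s` above the
suitably scaled tangent plane at `t`. They solve the third order equation and its adjoint (`β`
replaced by `-β`), have double zeros at `s` and `s + 2π`, and are positive in between by convexity
(`SupportData.gap_pos`). The function `X = (uv)^(1/4)` satisfies `X'' + (α/2) X ≤ 0`, and Sturm's
argument applies.

For existence, `det (x(t), x(t + 2π))` is a `T`-invariant quadratic form in `x(t)`. If it has no
zero, it gives up to sign a positive periodic function. If it has one, then `β = 0` and `T = -1`, so
every definite form is invariant. In both cases there is a positive periodic `g = Q(x)`, scaled so
that `1/g` has integral `2π` over a period. The expression `2gg'' - g'² + 2αg²` is a first integral,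
equal to `2a`, and along the flow `ψ' = g(ψ)` the lift `g⁻¹ Y` has the constant coefficient `a`
(`SupportData.exists_balanced_field`, `SupportData.hasDerivAt_balanced`).

For constant coefficient `a` the spacing of zeros forces `a ≤ 1/2`, and on this range the trace of
the monodromy, `2 cos` or `2 cosh` of an explicit angle, is injective in `a`. This gives uniqueness,
and, since `det T = 1`, the dictionary with the spectrum. If `a = 1/2`, the trace is `-2`, some
solution is antiperiodic and has zeros one period apart, so `β = 0`. Then `Y` is a linear image of
`(x₀² + x₁², x₀² - x₁², 2x₀x₁)`, which lies on the circular cone. Conversely an ellipsoidal cone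
admits `h = 1`, which is balanced with constant `1/2`, and uniqueness concludes. -/

/-! ### Linear differential equations: uniqueness and global existence. -/

/-- A curve whose velocity is bounded by a continuous multiple of its norm vanishes identically
as soon as it vanishes somewhere. -/
theorem eq_zero_of_norm_deriv_le {E : Type*} [NormedAddCommGroup E] [NormedSpace ℝ E]
    {f f' : ℝ → E} {M : ℝ → ℝ} (hM : Continuous M) (hf : ∀ t, HasDerivAt f (f' t) t)
    (hle : ∀ t, ‖f' t‖ ≤ M t * ‖f t‖) {s : ℝ} (hs : f s = 0) (t : ℝ) : f t = 0 := by
  have right : ∀ {g g' : ℝ → E} {N : ℝ → ℝ}, Continuous N → (∀ t, HasDerivAt g (g' t) t) →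
      (∀ t, ‖g' t‖ ≤ N t * ‖g t‖) → ∀ a b : ℝ, a ≤ b → g a = 0 → g b = 0 := by
    intro g g' N hN hg hgle a b hab ha
    obtain ⟨C, hC⟩ := (isCompact_Icc (a := a) (b := b)).exists_bound_of_continuousOn
      hN.continuousOn
    refine eq_zero_of_abs_deriv_le_mul_abs_self_of_eq_zero_right (K := C)
      (fun x _ => (hg x).continuousAt.continuousWithinAt)
      (fun x _ => (hg x).hasDerivWithinAt) ha (fun x hx => (hgle x).trans ?_) b ⟨hab, le_rfl⟩
    exact mul_le_mul_of_nonneg_right ((le_abs_self _).trans (hC x ⟨hx.1, hx.2.le⟩))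
      (norm_nonneg _)
  rcases le_total s t with h | h
  · exact right hM hf hle s t h hs
  -- The Grönwall estimate runs forward only; times before `s` are reached by reversing time.
  · have hf2 : ∀ t, HasDerivAt (fun t => f (-t)) (-f' (-t)) t := fun t =>
      ((hf (-t)).scomp t (hasDerivAt_neg t)).congr_deriv (by simp)
    have := right (g := fun t => f (-t)) (g' := fun t => -f' (-t)) (N := fun t => M (-t))
      (by fun_prop) hf2 (fun t => by simpa using hle (-t)) (-s) (-t) (by linarith) (by simpa)
    simpa using this

/-- Uniqueness for the equation `z'' = -q z`. -/
theorem hill_unique {q z z1 : ℝ → ℝ} (hq : Continuous q) (hz : ∀ t, HasDerivAt z (z1 t) t)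
    (hz1 : ∀ t, HasDerivAt z1 (-(q t * z t)) t) {s : ℝ} (h0 : z s = 0) (h1 : z1 s = 0) (t : ℝ) :
    z t = 0 ∧ z1 t = 0 := by
  have := eq_zero_of_norm_deriv_le (f := fun t => (z t, z1 t)) (M := fun t => 1 + |q t|)
    (by fun_prop) (fun t => (hz t).prodMk (hz1 t)) (fun t => ?_) (s := s) (by simp [h0, h1]) t
  · simpa using this
  · rw [Prod.norm_def]
    have h1 := norm_fst_le (z t, z1 t)
    have h2 := norm_snd_le (z t, z1 t)
    have h3 := norm_nonneg (z t, z1 t)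
    have h4 := abs_nonneg (q t)
    simp only [Real.norm_eq_abs] at h1 h2 ⊢
    rw [max_le_iff, abs_neg, abs_mul]
    constructor <;> nlinarith

/-- Uniqueness for linear equations of third order. -/
theorem third_order_unique {E : Type*} [NormedAddCommGroup E] [NormedSpace ℝ E]
    {a b : ℝ → ℝ} {y y1 y2 : ℝ → E} (ha : Continuous a) (hb : Continuous b)
    (hy : ∀ t, HasDerivAt y (y1 t) t) (hy1 : ∀ t, HasDerivAt y1 (y2 t) t)
    (hy2 : ∀ t, HasDerivAt y2 (a t • y1 t + b t • y t) t) {s : ℝ} (h0 : y s = 0) (h1 : y1 s = 0)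
    (h2 : y2 s = 0) (t : ℝ) : y t = 0 := by
  have := eq_zero_of_norm_deriv_le (f := fun t => (y t, y1 t, y2 t))
    (M := fun t => 1 + |a t| + |b t|)
    (by fun_prop) (fun t => (hy t).prodMk ((hy1 t).prodMk (hy2 t))) (fun t => ?_) (s := s)
    (by simp [h0, h1, h2]) t
  · exact (Prod.ext_iff.1 this).1
  · have h1 : ‖y t‖ ≤ ‖(y t, y1 t, y2 t)‖ := norm_fst_le (y t, y1 t, y2 t)
    have h5 : ‖(y1 t, y2 t)‖ ≤ ‖(y t, y1 t, y2 t)‖ := norm_snd_le (y t, y1 t, y2 t)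
    have h2 : ‖y1 t‖ ≤ ‖(y t, y1 t, y2 t)‖ := (norm_fst_le (y1 t, y2 t)).trans h5
    have h3 : ‖y2 t‖ ≤ ‖(y t, y1 t, y2 t)‖ := (norm_snd_le (y1 t, y2 t)).trans h5
    set N := ‖(y t, y1 t, y2 t)‖
    have h4 := abs_nonneg (a t)
    have h6 := abs_nonneg (b t)
    have h0 := (norm_nonneg _).trans h1
    rw [Prod.norm_def, Prod.norm_def, max_le_iff, max_le_iff]
    refine ⟨by dsimp only; nlinarith, by dsimp only; nlinarith, ?_⟩
    refine (norm_add_le _ _).trans ?_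
    rw [norm_smul, norm_smul, Real.norm_eq_abs, Real.norm_eq_abs]
    nlinarith

/-- The equation `z'' = -q z` with bounded `q` of class `C^1` has global solutions. -/
theorem hill_exists {q : ℝ → ℝ} (hq : ContDiff ℝ 1 q) {C : ℝ} (hC : ∀ t, |q t| ≤ C) (a b : ℝ) :
    ∃ z z1 : ℝ → ℝ, (∀ t, HasDerivAt z (z1 t) t) ∧ (∀ t, HasDerivAt z1 (-(q t * z t)) t) ∧
      z 0 = a ∧ z1 0 = b := by
  have hC0 : 0 ≤ C := (abs_nonneg _).trans (hC 0)
  set M := 1 + C with hM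
  have hM1 : 1 ≤ M := by linarith
  -- Time becomes a coordinate, so that solutions are integral curves of an autonomous field. By
  -- linearity the local existence time `1 / (2M)` does not depend on the initial point, which is
  -- what allows local curves to be glued to a global one.
  let v : ℝ × ℝ × ℝ → ℝ × ℝ × ℝ := fun p => (1, p.2.2, -(q p.1 * p.2.1))
  have hv : ContDiff ℝ 1 v := by fun_prop
  have key : ∀ p : ℝ × ℝ × ℝ, ∃ γ : ℝ → ℝ × ℝ × ℝ, γ 0 = p ∧
      ∀ t ∈ Ioo (-(1 / (2 * M))) (1 / (2 * M)), HasDerivAt γ (v (γ t)) t := by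
    rintro ⟨t0, x0⟩
    have hε : 0 < 1 / (2 * M) := by positivity
    let f : ℝ → ℝ × ℝ → ℝ × ℝ := fun t x => (x.2, -(q (t0 + t) * x.1))
    -- On the ball of radius `‖x0‖ + 1` about `x0` the speed is at most `M (2‖x0‖ + 1)`. In time `1
    -- / (2M)` the displacement is at most `‖x0‖ + 1/2`, within the radius.
    have hpl : IsPicardLindelof f (tmin := -(1 / (2 * M))) (tmax := 1 / (2 * M))
        ⟨0, by constructor <;> linarith⟩ x0 (‖x0‖.toNNReal + 1) 0
        (M.toNNReal * (2 * ‖x0‖.toNNReal + 1)) M.toNNReal := by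
      have hbound : ∀ t (x : ℝ × ℝ), ‖f t x‖ ≤ M * ‖x‖ := by
        intro t x
        have h1 := norm_fst_le x
        have h2 := norm_snd_le x
        have h3 := norm_nonneg x
        rw [Prod.norm_def, max_le_iff]
        simp only [f, Real.norm_eq_abs, abs_neg, abs_mul] at h1 h2 ⊢
        have := hC (t0 + t)
        have := abs_nonneg (q (t0 + t))
        have := abs_nonneg x.1
        constructor <;> nlinarith
      refine ⟨fun t _ => ?_, fun x _ => ?_, fun t _ x hx => ?_, ?_⟩
      · refine (LipschitzWith.of_dist_le_mul fun x y => ?_).lipschitzOnWith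
        rw [dist_eq_norm, dist_eq_norm, Real.coe_toNNReal _ (by linarith)]
        have hsub : f t x - f t y = f t (x - y) := by
          ext
          · simp [f]
          · simp [f]; ring
        exact hsub ▸ hbound t (x - y)
      · have : Continuous q := hq.continuous
        fun_prop
      · refine (hbound t x).trans ?_
        rw [mem_closedBall_iff_norm] at hx
        push_cast at hx ⊢
        rw [Real.coe_toNNReal _ (norm_nonneg _)] at hx ⊢
        rw [Real.coe_toNNReal _ (by linarith)]
        refine mul_le_mul_of_nonneg_left ?_ (by linarith)
        have := norm_le_norm_add_norm_sub x0 x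
        rw [norm_sub_rev] at this
        linarith
      · push_cast
        rw [Real.coe_toNNReal _ (norm_nonneg _), Real.coe_toNNReal _ (by linarith)]
        simp only [sub_zero, zero_sub, neg_neg, max_self]
        have : M * (2 * ‖x0‖ + 1) * (1 / (2 * M)) = ‖x0‖ + 1 / 2 := by field_simp
        rw [this]; linarith
    obtain ⟨γ, h0, hγ⟩ := hpl.exists_eq_forall_mem_Icc_hasDerivWithinAt₀
    refine ⟨fun t => (t0 + t, γ t), by simp_all, fun t ht => ?_⟩
    have h1 := (hγ t ⟨ht.1.le, ht.2.le⟩).hasDerivAt (Icc_mem_nhds ht.1 ht.2)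
    exact ((hasDerivAt_id t).const_add t0).prodMk h1
  obtain ⟨γ, h0, hγ⟩ := exists_isMIntegralCurve_of_isMIntegralCurveOn
    (I := modelWithCornersSelf ℝ (ℝ × ℝ × ℝ)) (M := ℝ × ℝ × ℝ) (v := v)
    ((contMDiff_vectorSpace_iff_contDiff).2 hv) (ε := 1 / (2 * M)) (by positivity)
    (fun p => by
      obtain ⟨γ, h0, h⟩ := key p
      exact ⟨γ, h0, fun t ht => (h t ht).hasFDerivAt.hasMFDerivAt.hasMFDerivWithinAt⟩) (0, a, b)
  have hγ2 : ∀ t, HasDerivAt γ (v (γ t)) t := fun t => by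
    have : HasFDerivAt γ ((1 : ℝ →L[ℝ] ℝ).smulRight (v (γ t))) t :=
      hasMFDerivAt_iff_hasFDerivAt.1 (hγ t)
    exact this.hasDerivAt.congr_deriv (by simp)
  have hγfst : ∀ t, HasDerivAt (fun t => (γ t).1) 1 t := fun t =>
    ((hasFDerivAt_fst (𝕜 := ℝ)).comp_hasDerivAt t (hγ2 t)).congr_deriv (by simp [v])
  have hγsnd : ∀ t, HasDerivAt (fun t => (γ t).2) (v (γ t)).2 t := fun t =>
    ((hasFDerivAt_snd (𝕜 := ℝ)).comp_hasDerivAt t (hγ2 t)).congr_deriv (by simp)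
  have hfst : ∀ t, (γ t).1 = t := by
    have hd : ∀ t, HasDerivAt (fun t => (γ t).1 - t) 0 t := fun t =>
      ((hγfst t).sub (hasDerivAt_id t)).congr_deriv (by simp)
    intro t
    have := is_const_of_deriv_eq_zero (f := fun t => (γ t).1 - t)
      (fun t => (hd t).differentiableAt) (fun t => (hd t).deriv) t 0
    simp only [h0] at this
    linarith
  refine ⟨fun t => (γ t).2.1, fun t => (γ t).2.2, fun t =>
    ((hasFDerivAt_fst (𝕜 := ℝ)).comp_hasDerivAt t (hγsnd t)).congr_deriv (by simp [v]), fun t => ?_,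
    by simp [h0], by simp [h0]⟩
  exact ((hasFDerivAt_snd (𝕜 := ℝ)).comp_hasDerivAt t (hγsnd t)).congr_deriv (by simp [v, hfst])

/-! ### Sturm comparison with the third order equation and its adjoint. -/

/-- If `F` vanishes to order exactly two at `p` and `z` vanishes at `p`, then `z F' / F` has
the limit `2 z'(p)` there. -/
theorem tendsto_mul_logDeriv_of_double_zero {F F1 z : ℝ → ℝ} {p c z1 : ℝ}
    (hF : ∀ t, HasDerivAt F (F1 t) t) (hF1 : HasDerivAt F1 c p) (h0 : F p = 0) (h1 : F1 p = 0)
    (hc : c ≠ 0) (hz : HasDerivAt z z1 p) (hz0 : z p = 0) :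
    Tendsto (fun t => z t * (F1 t / F t)) (𝓝[≠] p) (𝓝 (2 * z1)) := by
  have sF1 : Tendsto (fun t => F1 t / (t - p)) (𝓝[≠] p) (𝓝 c) := by
    have := hasDerivAt_iff_tendsto_slope.1 hF1
    refine this.congr fun t => ?_
    rw [slope_def_field, h1, sub_zero]
  have sz : Tendsto (fun t => z t / (t - p)) (𝓝[≠] p) (𝓝 z1) := by
    have := hasDerivAt_iff_tendsto_slope.1 hz
    refine this.congr fun t => ?_
    rw [slope_def_field, hz0, sub_zero]
  have hne : ∀ᶠ t in 𝓝[≠] p, t - p ≠ 0 :=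
    eventually_mem_nhdsWithin.mono fun t ht => sub_ne_zero.2 ht
  have sF : Tendsto (fun t => F t / (t - p) ^ 2) (𝓝[≠] p) (𝓝 (c / 2)) := by
    refine HasDerivAt.lhopital_zero_nhdsNE (f' := F1) (g' := fun t => 2 * (t - p))
      (.of_forall hF) (.of_forall fun t => ?_) (hne.mono fun t ht => by positivity) ?_ ?_ ?_
    · simpa using ((hasDerivAt_id t).sub_const p).fun_pow 2
    · have := (hF p).continuousAt.tendsto.mono_left (nhdsWithin_le_nhds (s := {p}ᶜ))
      rwa [h0] at this
    · have : Tendsto (fun t => (t - p) ^ 2) (𝓝 p) (𝓝 ((p - p) ^ 2)) := by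
        apply Continuous.tendsto; fun_prop
      simpa using this.mono_left nhdsWithin_le_nhds
    · refine (sF1.div_const 2).congr fun t => ?_
      rw [div_div, mul_comm (t - p) 2]
  have := (sz.mul sF1).div sF (by simpa using hc)
  have hval : z1 * c / (c / 2) = 2 * z1 := by field_simp
  rw [hval] at this
  refine this.congr' (hne.mono fun t ht => ?_)
  simp only [Pi.div_apply]
  by_cases hFt : F t = 0
  · simp [hFt]
  · field_simp

/-- The comparison between `z'' + (α/2) z = 0` and the third order equations
`u''' + 2αu' + α'u + βu = 0`, `v''' + 2αv' + α'v - βv = 0`: the function `(uv)^(1/4)` is a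
subsolution of the former. -/
theorem hill_comparison {u u1 u2 u3 v v1 v2 v3 z z1 α α1 β : ℝ → ℝ} {s e : ℝ}
    (hu : ∀ t, HasDerivAt u (u1 t) t) (hu1 : ∀ t, HasDerivAt u1 (u2 t) t)
    (hu2 : ∀ t, HasDerivAt u2 (u3 t) t) (hv : ∀ t, HasDerivAt v (v1 t) t)
    (hv1 : ∀ t, HasDerivAt v1 (v2 t) t) (hv2 : ∀ t, HasDerivAt v2 (v3 t) t)
    (hα : ∀ t, HasDerivAt α (α1 t) t)
    (hLu : ∀ t, u3 t + 2 * α t * u1 t + α1 t * u t + β t * u t = 0)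
    (hLv : ∀ t, v3 t + 2 * α t * v1 t + α1 t * v t - β t * v t = 0)
    (upos : ∀ t ∈ Ioo s e, 0 < u t) (vpos : ∀ t ∈ Ioo s e, 0 < v t)
    (us : u s = 0) (us1 : u1 s = 0) (us2 : u2 s ≠ 0) (vs : v s = 0) (vs1 : v1 s = 0)
    (vs2 : v2 s ≠ 0) (ue : u e = 0) (ue1 : u1 e = 0) (ue2 : u2 e ≠ 0) (ve : v e = 0)
    (ve1 : v1 e = 0) (ve2 : v2 e ≠ 0) (hz : ∀ t, HasDerivAt z (z1 t) t)
    (hz1 : ∀ t, HasDerivAt z1 (-(α t / 2 * z t)) t) (zs : z s = 0) (zs1 : 0 < z1 s)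
    (hz1ne : ∀ t, z t = 0 → z1 t ≠ 0) :
    (∀ t ∈ Ioo s e, 0 < z t) ∧ (z e = 0 → ∀ t ∈ Ioo s e, β t = 0) := by
  -- The bilinear concomitant of the equation and its adjoint is a first integral; it vanishes
  -- because `u`, `u'` and `v` vanish at `s`.
  have hE : ∀ t, 2 * α t * (u t * v t) + u2 t * v t + u t * v2 t - u1 t * v1 t = 0 := by
    have hd : ∀ t, HasDerivAt
        (fun t => 2 * α t * (u t * v t) + u2 t * v t + u t * v2 t - u1 t * v1 t) 0 t := fun t => by
      refine ((((((hα t).const_mul 2).fun_mul ((hu t).fun_mul (hv t))).fun_add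
        ((hu2 t).fun_mul (hv t))).fun_add ((hu t).fun_mul (hv2 t))).fun_sub
        ((hu1 t).fun_mul (hv1 t))).congr_deriv ?_
      linear_combination (v t) * hLu t + u t * hLv t
    intro t
    rw [is_const_of_deriv_eq_zero (fun t => (hd t).differentiableAt) (fun t => (hd t).deriv) t s]
    simp [us, us1, vs]
  set X : ℝ → ℝ := fun t => √(√(u t * v t)) with hX
  have hXc : Continuous X := by
    have h1 : Continuous u := continuous_iff_continuousAt.2 fun t => (hu t).continuousAt
    have h2 : Continuous v := continuous_iff_continuousAt.2 fun t => (hv t).continuousAt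
    fun_prop
  set d : ℝ → ℝ := fun t => (u1 t / u t + v1 t / v t) / 4 with hd
  have Xpos : ∀ t ∈ Ioo s e, 0 < X t := fun t ht =>
    Real.sqrt_pos.2 (Real.sqrt_pos.2 (mul_pos (upos t ht) (vpos t ht)))
  have hX1 : ∀ t ∈ Ioo s e, HasDerivAt X (X t * d t) t := fun t ht => by
    have hu0 := upos t ht
    have hv0 := vpos t ht
    have hp := mul_pos hu0 hv0
    have hp2 := Real.sqrt_pos.2 hp
    refine ((((hu t).fun_mul (hv t)).sqrt hp.ne').sqrt hp2.ne').congr_deriv ?_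
    have hXt := Xpos t ht
    have e1 : √(u t * v t) = X t ^ 2 := (Real.sq_sqrt hp2.le).symm
    have e2 : u t * v t = X t ^ 4 := by
      rw [show X t ^ 4 = (X t ^ 2) ^ 2 by ring, ← e1, Real.sq_sqrt hp.le]
    have e3 : √√(u t * v t) = X t := rfl
    rw [e3, e1, hd]
    have : (u1 t / u t + v1 t / v t) = (u1 t * v t + u t * v1 t) / X t ^ 4 := by
      rw [← e2]; field_simp; try ring
    simp only [this]
    field_simp
    try ring
  -- Since `d = X'/X`, this is the Wronskian `X z' - X' z`.
  set w : ℝ → ℝ := fun t => X t * (z1 t - z t * d t) with hw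
  have hd1 : ∀ t ∈ Ioo s e, HasDerivAt d
      ((u2 t / u t - (u1 t / u t) ^ 2 + (v2 t / v t - (v1 t / v t) ^ 2)) / 4) t := fun t ht => by
    have hu0 := (upos t ht).ne'
    have hv0 := (vpos t ht).ne'
    refine ((((hu1 t).fun_div (hu t) hu0).fun_add ((hv1 t).fun_div (hv t) hv0)).div_const 4).congr_deriv ?_
    field_simp
  have hw1 : ∀ t ∈ Ioo s e, HasDerivAt w
      (3 / 16 * (u1 t / u t - v1 t / v t) ^ 2 * X t * z t) t := fun t ht => by
    refine ((hX1 t ht).fun_mul ((hz1 t).fun_sub ((hz t).fun_mul (hd1 t ht)))).congr_deriv ?_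
    have hu0 := (upos t ht).ne'
    have hv0 := (vpos t ht).ne'
    -- The first integral, solved for `α`. It turns `X'' + (α/2) X` into `-(3/16) (u'/u - v'/v)² X`,
    -- so `w` increases as long as `z ≥ 0`.
    have hα2 : α t = (u1 t / u t * (v1 t / v t) - u2 t / u t - v2 t / v t) / 2 := by
      field_simp
      linear_combination hE t
    rw [hα2]
    simp only [hd]
    ring
  -- At a common double zero `X` tends to zero while `z u'/u` and `z v'/v` stay bounded, so `w`
  -- tends to zero although `X'/X` blows up.
  have hlim : ∀ p, u p = 0 → u1 p = 0 → u2 p ≠ 0 → v p = 0 → v1 p = 0 → v2 p ≠ 0 → z p = 0 →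
      Tendsto w (𝓝[≠] p) (𝓝 0) := by
    intro p up up1 up2 vp vp1 vp2 zp
    have a1 := tendsto_mul_logDeriv_of_double_zero hu (hu1 p) up up1 up2 (hz p) zp
    have a2 := tendsto_mul_logDeriv_of_double_zero hv (hv1 p) vp vp1 vp2 (hz p) zp
    have a3 : Tendsto z1 (𝓝[≠] p) (𝓝 (z1 p)) :=
      (hz1 p).continuousAt.tendsto.mono_left nhdsWithin_le_nhds
    have a4 : Tendsto X (𝓝[≠] p) (𝓝 0) := by
      have := hXc.continuousAt (x := p) |>.tendsto.mono_left (nhdsWithin_le_nhds (s := {p}ᶜ))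
      simpa [hX, up] using this
    have := a4.mul (a3.sub ((a1.add a2).div_const 4))
    rw [zero_mul] at this
    refine this.congr fun t => ?_
    simp only [hw, hd]
    ring
  have hws := (hlim s us us1 us2 vs vs1 vs2 zs).mono_left
    (nhdsWithin_mono s (fun t (ht : s < t) => ht.ne') : 𝓝[>] s ≤ 𝓝[≠] s)
  have hmono : ∀ b ≤ e, (∀ t ∈ Ioo s b, 0 ≤ z t) → MonotoneOn w (Ioo s b) := by
    intro b hb hzb
    have hsub : Ioo s b ⊆ Ioo s e := Ioo_subset_Ioo_right hb
    refine monotoneOn_of_deriv_nonneg (convex_Ioo s b)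
      (fun t ht => (hw1 t (hsub ht)).continuousAt.continuousWithinAt)
      (fun t ht => ?_) (fun t ht => ?_)
    · rw [interior_Ioo] at ht
      exact (hw1 t (hsub ht)).differentiableAt.differentiableWithinAt
    · rw [interior_Ioo] at ht
      rw [(hw1 t (hsub ht)).deriv]
      have := Xpos t (hsub ht)
      have := hzb t ht
      positivity
  have hnonneg : ∀ b ≤ e, (∀ t ∈ Ioo s b, 0 ≤ z t) → ∀ t ∈ Ioo s b, 0 ≤ w t := by
    intro b hb hzb t ht
    refine le_of_tendsto hws ?_
    filter_upwards [Ioo_mem_nhdsGT ht.1] with x hx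
    exact hmono b hb hzb ⟨hx.1, hx.2.trans ht.2⟩ ht hx.2.le
  have hpos : ∀ t ∈ Ioo s e, 0 < z t := by
    by_contra! hcon
    obtain ⟨t2, ht2, hzt2⟩ := hcon
    have hzc : Continuous z := continuous_iff_continuousAt.2 fun t => (hz t).continuousAt
    have hev : ∀ᶠ t in 𝓝[>] s, 0 < z t := by
      have := hasDerivAt_iff_tendsto_slope.1 (hz s)
      have h2 := this.mono_left (nhdsWithin_mono s (fun t (ht : s < t) => ht.ne') :
        𝓝[>] s ≤ 𝓝[≠] s)
      filter_upwards [h2.eventually (lt_mem_nhds zs1), self_mem_nhdsWithin] with t ht ht'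
      rw [slope_def_field, zs, sub_zero] at ht
      exact (div_pos_iff_of_pos_right (sub_pos.2 ht')).1 ht
    obtain ⟨δ, hδ, hδz⟩ := mem_nhdsGT_iff_exists_Ioo_subset.1 hev
    have hδ' : s < δ := hδ
    -- The search for the first zero starts at a point `a` up to which `z` is already known to be
    -- positive. At that zero `b` one would have `w b = X(b) z'(b) < 0`, against the monotonicity of
    -- `w`.
    set a := min ((s + δ) / 2) ((s + t2) / 2)
    have ha1 : a < δ := (min_le_left _ _).trans_lt (by linarith)
    have ha2 : a < t2 := (min_le_right _ _).trans_lt (by linarith [ht2.1])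
    have ha3 : s < a := lt_min (by linarith) (by linarith [ht2.1])
    obtain ⟨b, ⟨⟨hab, hbt⟩, hbz⟩, hbl⟩ :=
      (isCompact_Icc.inter_right (isClosed_le hzc continuous_const) :
        IsCompact (Icc a t2 ∩ {t | z t ≤ 0})).exists_isLeast ⟨t2, ⟨ha2.le, le_rfl⟩, hzt2⟩
    have hzb : ∀ t ∈ Ioo s b, 0 < z t := fun t ht => by
      by_contra! hneg
      rcases lt_or_ge t a with h | h
      · exact absurd (hδz ⟨ht.1, h.trans ha1⟩) (not_lt.2 hneg)
      · exact absurd (hbl ⟨⟨h, ht.2.le.trans hbt⟩, hneg⟩) (not_le.2 ht.2)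
    have hsb : s < b := ha3.trans_le hab
    have hbe : b < e := hbt.trans_lt ht2.2
    have hleft : ∀ᶠ t in 𝓝[<] b, t ∈ Ioo s b := Ioo_mem_nhdsLT hsb
    have hzb0 : z b = 0 := le_antisymm hbz (ge_of_tendsto
      (hzc.continuousAt.tendsto.mono_left (nhdsWithin_le_nhds (s := Iio b)))
      (hleft.mono fun t ht => (hzb t ht).le))
    have hwb : 0 ≤ w b := ge_of_tendsto
      ((hw1 b ⟨hsb, hbe⟩).continuousAt.tendsto.mono_left (nhdsWithin_le_nhds (s := Iio b)))
      (hleft.mono fun t ht => hnonneg b hbe.le (fun t ht => (hzb t ht).le) t ht)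
    have hz1b : z1 b ≤ 0 := by
      have := hasDerivAt_iff_tendsto_slope.1 (hz b)
      refine le_of_tendsto (this.mono_left (nhdsWithin_mono b (fun t (ht : t < b) => ht.ne) :
        𝓝[<] b ≤ 𝓝[≠] b)) (hleft.mono fun t ht => ?_)
      rw [slope_def_field, hzb0, sub_zero]
      exact div_nonpos_of_nonneg_of_nonpos (hzb t ht).le (by linarith [ht.2])
    have hz1b' : z1 b < 0 := lt_of_le_of_ne hz1b (hz1ne b hzb0)
    have : w b < 0 := by
      simp only [hw, hzb0, zero_mul, sub_zero]
      exact mul_neg_of_pos_of_neg (Xpos b ⟨hsb, hbe⟩) hz1b'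
    linarith
  refine ⟨hpos, fun hze => ?_⟩
  have hwe := (hlim e ue ue1 ue2 ve ve1 ve2 hze).mono_left
    (nhdsWithin_mono e (fun t (ht : t < e) => ht.ne) : 𝓝[<] e ≤ 𝓝[≠] e)
  have hnn : ∀ t ∈ Ioo s e, 0 ≤ z t := fun t ht => (hpos t ht).le
  -- If `z` also vanishes at `e`, then the nondecreasing `w` has limit zero at both ends. Hence `w =
  -- 0` and `u'/u = v'/v`: `u` and `v` are proportional, and a function solving both the equation
  -- and its adjoint forces `β = 0`.
  have hw0 : ∀ t ∈ Ioo s e, w t = 0 := fun t ht => by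
    refine le_antisymm (ge_of_tendsto hwe ?_) (hnonneg e le_rfl hnn t ht)
    filter_upwards [Ioo_mem_nhdsLT ht.2] with x hx
    exact hmono e le_rfl hnn ht ⟨ht.1.trans hx.1, hx.2⟩ hx.1.le
  have zero_deriv : ∀ {f f1 : ℝ → ℝ}, (∀ t ∈ Ioo s e, f t = 0) →
      (∀ t ∈ Ioo s e, HasDerivAt f (f1 t) t) → ∀ t ∈ Ioo s e, f1 t = 0 := by
    intro f f1 h0 h1 t ht
    have : f =ᶠ[𝓝 t] fun _ => 0 := by
      filter_upwards [Ioo_mem_nhds ht.1 ht.2] with x hx using h0 x hx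
    exact (h1 t ht).unique ((hasDerivAt_const t (0 : ℝ)).congr_of_eventuallyEq this)
  have hN : ∀ t ∈ Ioo s e, u1 t * v t - u t * v1 t = 0 := fun t ht => by
    have h1 := zero_deriv hw0 hw1 t ht
    have hu0 := (upos t ht).ne'
    have hv0 := (vpos t ht).ne'
    have h2 : u1 t / u t - v1 t / v t = 0 := by
      simpa [(Xpos t ht).ne', (hpos t ht).ne'] using h1
    field_simp at h2
    linarith
  have hN1 := zero_deriv hN fun t _ =>
    ((hu1 t).fun_mul (hv t)).fun_sub ((hu t).fun_mul (hv1 t))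
  have hN2 := zero_deriv hN1 fun t _ =>
    (((hu2 t).fun_mul (hv t)).fun_add ((hu1 t).fun_mul (hv1 t))).fun_sub
      (((hu1 t).fun_mul (hv1 t)).fun_add ((hu t).fun_mul (hv2 t)))
  intro t ht
  have hu0 := (upos t ht).ne'
  have hv0 := (vpos t ht).ne'
  have e0 := hN t ht
  have e1 := hN1 t ht
  have e2 := hN2 t ht
  have e3 : u2 t * v1 t - u1 t * v2 t = 0 := by
    have : u t * (u2 t * v1 t - u1 t * v2 t) = 0 := by
      linear_combination -(u2 t) * e0 + u1 t * e1
    simpa [hu0] using this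
  have : β t * (u t * v t) = 0 := by
    linear_combination -(1 / 2) * e2 + 1 / 2 * e3 + (v t / 2) * hLu t - (u t / 2) * hLv t - α t * e0
  simpa [hu0, hv0] using this

/-! ### Support functions and the spacing of zeros over one period. -/

theorem Function.Periodic.of_hasDerivAt {E : Type*} [NormedAddCommGroup E] [NormedSpace ℝ E]
    {f f1 : ℝ → E} {c : ℝ} (hf : Function.Periodic f c) (h : ∀ t, HasDerivAt f (f1 t) t) :
    Function.Periodic f1 c := fun t => by
  have h1 : HasDerivAt (fun t => f (t + c)) (f1 (t + c)) t := (h (t + c)).comp_add_const t c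
  rw [funext hf] at h1
  exact h1.unique (h t)

/-- The data of a positively curved closed support function `h` of the circle: the radius of
curvature `h'' + h` is `m⁻³` with `m > 0` three times continuously differentiable. -/
structure SupportData where
  (h h1 m m1 m2 m3 : ℝ → ℝ)
  hasDerivAt_h : ∀ t, HasDerivAt h (h1 t) t
  hasDerivAt_h1 : ∀ t, HasDerivAt h1 ((m t ^ 3)⁻¹ - h t) t
  hasDerivAt_m : ∀ t, HasDerivAt m (m1 t) t
  hasDerivAt_m1 : ∀ t, HasDerivAt m1 (m2 t) t
  hasDerivAt_m2 : ∀ t, HasDerivAt m2 (m3 t) t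
  continuous_m3 : Continuous m3
  m_pos : ∀ t, 0 < m t
  periodic_h : Function.Periodic h (2 * π)
  periodic_m : Function.Periodic m (2 * π)

namespace SupportData

variable (D : SupportData)

/-- The coefficient `α` of the third order equation satisfied by `m • (cos, sin, h)`. -/
noncomputable def alpha (t : ℝ) : ℝ := 1 / 2 - 3 / 2 * (D.m2 t / D.m t)

/-- The derivative of `alpha`. -/
noncomputable def alpha1 (t : ℝ) : ℝ := -(3 / 2) * (D.m3 t / D.m t - D.m2 t * D.m1 t / D.m t ^ 2)

/-- The coefficient `β` of the third order equation satisfied by `m • (cos, sin, h)`. -/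
noncomputable def beta (t : ℝ) : ℝ :=
  1 / 2 * (D.m3 t / D.m t) + 2 * (D.m1 t / D.m t) + 3 / 2 * (D.m1 t * D.m2 t / D.m t ^ 2)

theorem m_ne (t : ℝ) : D.m t ≠ 0 := (D.m_pos t).ne'

theorem periodic_h1 : Function.Periodic D.h1 (2 * π) := D.periodic_h.of_hasDerivAt D.hasDerivAt_h
theorem periodic_m1 : Function.Periodic D.m1 (2 * π) := D.periodic_m.of_hasDerivAt D.hasDerivAt_m
theorem periodic_m2 : Function.Periodic D.m2 (2 * π) := D.periodic_m1.of_hasDerivAt D.hasDerivAt_m1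
theorem periodic_m3 : Function.Periodic D.m3 (2 * π) := D.periodic_m2.of_hasDerivAt D.hasDerivAt_m2

theorem hasDerivAt_alpha (t : ℝ) : HasDerivAt D.alpha (D.alpha1 t) t := by
  refine ((((D.hasDerivAt_m2 t).fun_div (D.hasDerivAt_m t) (D.m_ne t)).const_mul
    (3 / 2)).const_sub (1 / 2)).congr_deriv ?_
  have := D.m_ne t
  simp only [alpha1]
  field_simp

theorem continuous_m : Continuous D.m :=
  continuous_iff_continuousAt.2 fun t => (D.hasDerivAt_m t).continuousAt
theorem continuous_m1 : Continuous D.m1 :=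
  continuous_iff_continuousAt.2 fun t => (D.hasDerivAt_m1 t).continuousAt
theorem continuous_m2 : Continuous D.m2 :=
  continuous_iff_continuousAt.2 fun t => (D.hasDerivAt_m2 t).continuousAt

theorem continuous_alpha : Continuous D.alpha :=
  continuous_iff_continuousAt.2 fun t => (D.hasDerivAt_alpha t).continuousAt

theorem continuous_alpha1 : Continuous D.alpha1 := by
  have h0 := D.continuous_m
  have h1 := D.continuous_m1
  have h2 := D.continuous_m2
  have h3 := D.continuous_m3
  have hm := D.m_ne
  have hm2 : ∀ t, D.m t ^ 2 ≠ 0 := fun t => pow_ne_zero 2 (hm t)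
  unfold alpha1
  fun_prop (disch := assumption)

theorem continuous_beta : Continuous D.beta := by
  have h0 := D.continuous_m
  have h1 := D.continuous_m1
  have h2 := D.continuous_m2
  have h3 := D.continuous_m3
  have hm := D.m_ne
  have hm2 : ∀ t, D.m t ^ 2 ≠ 0 := fun t => pow_ne_zero 2 (hm t)
  unfold beta
  fun_prop (disch := assumption)

theorem contDiff_alpha : ContDiff ℝ 1 D.alpha := by
  rw [contDiff_one_iff_deriv]
  refine ⟨fun t => (D.hasDerivAt_alpha t).differentiableAt, ?_⟩
  rw [funext fun t => (D.hasDerivAt_alpha t).deriv]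
  exact D.continuous_alpha1

theorem periodic_alpha : Function.Periodic D.alpha (2 * π) := fun t => by
  simp only [alpha, D.periodic_m t, D.periodic_m2 t]

theorem periodic_beta : Function.Periodic D.beta (2 * π) := fun t => by
  simp only [beta, D.periodic_m t, D.periodic_m1 t, D.periodic_m2 t, D.periodic_m3 t]

/-- The height of the point of the curve with parameter `t` above the tangent at `s`. -/
noncomputable def gap (s t : ℝ) : ℝ := D.h t - D.h s * cos (t - s) - D.h1 s * sin (t - s)

/-- The derivative of `gap` in the second variable. -/
noncomputable def gap1 (s t : ℝ) : ℝ := D.h1 t + D.h s * sin (t - s) - D.h1 s * cos (t - s)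

theorem hasDerivAt_gap (s t : ℝ) : HasDerivAt (D.gap s) (D.gap1 s t) t := by
  have h1 : HasDerivAt (fun t => t - s) 1 t := (hasDerivAt_id t).sub_const s
  refine (((D.hasDerivAt_h t).fun_sub (h1.cos.const_mul (D.h s))).fun_sub
    (h1.sin.const_mul (D.h1 s))).congr_deriv ?_
  simp only [gap1]
  ring

theorem hasDerivAt_gap1 (s t : ℝ) :
    HasDerivAt (D.gap1 s) ((D.m t ^ 3)⁻¹ - D.gap s t) t := by
  have h1 : HasDerivAt (fun t => t - s) 1 t := (hasDerivAt_id t).sub_const s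
  refine (((D.hasDerivAt_h1 t).fun_add (h1.sin.const_mul (D.h s))).fun_sub
    (h1.cos.const_mul (D.h1 s))).congr_deriv ?_
  simp only [gap]
  ring

/-- Moving the tangent rotates it about its point of contact, so everything cancels but a multiple
of the sine. This keeps the derivatives of the adjoint solution in `hill_pos` short. -/
theorem hasDerivAt_gap_left (s t : ℝ) :
    HasDerivAt (fun t => D.gap t s) ((D.m t ^ 3)⁻¹ * sin (t - s)) t := by
  have h1 : HasDerivAt (fun t => s - t) (-1) t := (hasDerivAt_id t).const_sub s
  refine ((((D.hasDerivAt_h t).fun_mul h1.cos).const_sub (D.h s)).fun_sub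
    ((D.hasDerivAt_h1 t).fun_mul h1.sin)).congr_deriv ?_
  rw [← neg_sub s t, sin_neg]
  ring

theorem gap_self (s : ℝ) : D.gap s s = 0 := by simp [gap]
theorem gap1_self (s : ℝ) : D.gap1 s s = 0 := by simp [gap1]

theorem gap_add_right (s t : ℝ) : D.gap s (t + 2 * π) = D.gap s t := by
  simp only [gap, D.periodic_h t, show t + 2 * π - s = t - s + 2 * π by ring, cos_add_two_pi,
    sin_add_two_pi]

theorem gap1_add_right (s t : ℝ) : D.gap1 s (t + 2 * π) = D.gap1 s t := by
  simp only [gap1, D.periodic_h1 t, show t + 2 * π - s = t - s + 2 * π by ring, cos_add_two_pi,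
    sin_add_two_pi]

theorem gap_add_left (s t : ℝ) : D.gap (s + 2 * π) t = D.gap s t := by
  simp only [gap, D.periodic_h s, D.periodic_h1 s, show t - (s + 2 * π) = t - s - 2 * π by ring,
    cos_sub_two_pi, sin_sub_two_pi]

/-- Strict convexity: the curve lies strictly above each of its tangents. -/
theorem gap_pos {s t : ℝ} (h1 : s < t) (h2 : t < s + 2 * π) : 0 < D.gap s t := by
  -- Variation of constants for `gap'' + gap = m⁻³`: the function of `x` equals `gap s t` at `x = t`
  -- and vanishes at `x = s` and `x = s + 2π`. One goes from `t` to whichever of the two is within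
  -- distance `π`, where the sine has a constant sign.
  have hd : ∀ x, HasDerivAt (fun x => D.gap1 s x * sin (t - x) + D.gap s x * cos (t - x))
      ((D.m x ^ 3)⁻¹ * sin (t - x)) x := fun x => by
    have h1 : HasDerivAt (fun x => t - x) (-1) x := (hasDerivAt_id x).const_sub t
    refine (((D.hasDerivAt_gap1 s x).fun_mul h1.sin).fun_add
      ((D.hasDerivAt_gap s x).fun_mul h1.cos)).congr_deriv ?_
    ring
  have hc : Continuous (fun x => D.gap1 s x * sin (t - x) + D.gap s x * cos (t - x)) :=
    continuous_iff_continuousAt.2 fun x => (hd x).continuousAt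
  have hr : ∀ x, 0 < (D.m x ^ 3)⁻¹ := fun x => inv_pos.2 (pow_pos (D.m_pos x) 3)
  rcases le_or_gt t (s + π) with h | h
  · have := strictMonoOn_of_deriv_pos (convex_Icc s t) hc.continuousOn (fun x hx => by
      rw [interior_Icc] at hx
      rw [(hd x).deriv]
      exact mul_pos (hr x) (sin_pos_of_pos_of_lt_pi (by linarith [hx.2]) (by linarith [hx.1])))
      ⟨le_rfl, h1.le⟩ ⟨h1.le, le_rfl⟩ h1
    simpa [D.gap_self, D.gap1_self] using this
  · have := strictAntiOn_of_deriv_neg (convex_Icc t (s + 2 * π)) hc.continuousOn (fun x hx => by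
      rw [interior_Icc] at hx
      rw [(hd x).deriv]
      exact mul_neg_of_pos_of_neg (hr x)
        (sin_neg_of_neg_of_neg_pi_lt (by linarith [hx.1]) (by linarith [hx.2])))
      ⟨le_rfl, h2.le⟩ ⟨h2.le, le_rfl⟩ h2
    simpa [D.gap_self, D.gap1_self, D.gap_add_right, D.gap1_add_right] using this

/-- A solution of `z'' + (α/2) z = 0` vanishing at `s` is positive on the next period; if it
vanishes at the end of this period, then `β` is zero. -/
theorem hill_pos {z z1 : ℝ → ℝ} (hz : ∀ t, HasDerivAt z (z1 t) t)
    (hz1 : ∀ t, HasDerivAt z1 (-(D.alpha t / 2 * z t)) t) {s : ℝ} (zs : z s = 0)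
    (zs1 : 0 < z1 s) :
    (∀ t ∈ Ioo s (s + 2 * π), 0 < z t) ∧ (z (s + 2 * π) = 0 → ∀ t, D.beta t = 0) := by
  have hm := D.m_ne
  -- `u = m · gap s` is the fixed linear functional of the tangent plane at `s`, evaluated on `m
  -- (cos, sin, h)`; hence it solves the third order equation.
  have hu : ∀ t, HasDerivAt (fun t => D.m t * D.gap s t)
      (D.m1 t * D.gap s t + D.m t * D.gap1 s t) t :=
    fun t => (D.hasDerivAt_m t).fun_mul (D.hasDerivAt_gap s t)
  have hu1 : ∀ t, HasDerivAt (fun t => D.m1 t * D.gap s t + D.m t * D.gap1 s t)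
      ((D.m2 t - D.m t) * D.gap s t + 2 * D.m1 t * D.gap1 s t + (D.m t ^ 2)⁻¹) t := fun t => by
    refine (((D.hasDerivAt_m1 t).fun_mul (D.hasDerivAt_gap s t)).fun_add
      ((D.hasDerivAt_m t).fun_mul (D.hasDerivAt_gap1 s t))).congr_deriv ?_
    have := hm t
    field_simp
    ring
  have hu2 : ∀ t, HasDerivAt
      (fun t => (D.m2 t - D.m t) * D.gap s t + 2 * D.m1 t * D.gap1 s t + (D.m t ^ 2)⁻¹)
      ((D.m3 t - 3 * D.m1 t) * D.gap s t + (3 * D.m2 t - D.m t) * D.gap1 s t) t := fun t => by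
    refine (((((D.hasDerivAt_m2 t).fun_sub (D.hasDerivAt_m t)).fun_mul
      (D.hasDerivAt_gap s t)).fun_add (((D.hasDerivAt_m1 t).const_mul 2).fun_mul
      (D.hasDerivAt_gap1 s t))).fun_add (((D.hasDerivAt_m t).fun_pow 2).fun_inv
      (pow_ne_zero 2 (hm t)))).congr_deriv ?_
    have := hm t
    field_simp
    norm_num
    ring
  have hS : ∀ t, HasDerivAt (fun t => sin (t - s)) (cos (t - s)) t := fun t => by
    simpa using ((hasDerivAt_id t).sub_const s).sin
  have hC : ∀ t, HasDerivAt (fun t => cos (t - s)) (-sin (t - s)) t := fun t => by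
    simpa using ((hasDerivAt_id t).sub_const s).cos
  -- `v = m² · gap · s` is the dual curve `Y × Y'`, paired with the fixed point `(cos s, sin s, h
  -- s)`; hence it solves the adjoint equation. The weight `m²` arises from the two factors `m` in
  -- `Y × Y'`.
  have hv : ∀ t, HasDerivAt (fun t => D.m t ^ 2 * D.gap t s)
      (2 * D.m t * D.m1 t * D.gap t s + (D.m t)⁻¹ * sin (t - s)) t := fun t => by
    refine (((D.hasDerivAt_m t).fun_pow 2).fun_mul (D.hasDerivAt_gap_left s t)).congr_deriv ?_
    have := hm t
    field_simp
    norm_num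
    ring
  have hv1 : ∀ t, HasDerivAt (fun t => 2 * D.m t * D.m1 t * D.gap t s + (D.m t)⁻¹ * sin (t - s))
      (2 * (D.m1 t ^ 2 + D.m t * D.m2 t) * D.gap t s + (D.m t ^ 2)⁻¹ * D.m1 t * sin (t - s) +
        (D.m t)⁻¹ * cos (t - s)) t := fun t => by
    refine (((((D.hasDerivAt_m t).const_mul 2).fun_mul (D.hasDerivAt_m1 t)).fun_mul
      (D.hasDerivAt_gap_left s t)).fun_add (((D.hasDerivAt_m t).fun_inv (hm t)).fun_mul
      (hS t))).congr_deriv ?_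
    have := hm t
    field_simp
    ring
  have hv2 : ∀ t, HasDerivAt (fun t => 2 * (D.m1 t ^ 2 + D.m t * D.m2 t) * D.gap t s +
      (D.m t ^ 2)⁻¹ * D.m1 t * sin (t - s) + (D.m t)⁻¹ * cos (t - s))
      (2 * (3 * D.m1 t * D.m2 t + D.m t * D.m3 t) * D.gap t s +
        3 * (D.m t ^ 2)⁻¹ * D.m2 t * sin (t - s) - (D.m t)⁻¹ * sin (t - s)) t := fun t => by
    refine ((((((((D.hasDerivAt_m1 t).fun_pow 2).fun_add ((D.hasDerivAt_m t).fun_mul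
      (D.hasDerivAt_m2 t))).const_mul 2).fun_mul (D.hasDerivAt_gap_left s t)).fun_add
      (((((D.hasDerivAt_m t).fun_pow 2).fun_inv (pow_ne_zero 2 (hm t))).fun_mul
      (D.hasDerivAt_m1 t)).fun_mul (hS t))).fun_add
      (((D.hasDerivAt_m t).fun_inv (hm t)).fun_mul (hC t)))).congr_deriv ?_
    have := hm t
    field_simp
    norm_num
    ring
  have hpi := two_pi_pos
  have hgs : ∀ t, D.gap (t + 2 * π) t = 0 := fun t => by rw [D.gap_add_left, D.gap_self]
  have main := hill_comparison (s := s) (e := s + 2 * π) hu hu1 hu2 hv hv1 hv2 D.hasDerivAt_alpha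
    (β := D.beta) (fun t => ?_) (fun t => ?_)
    (fun t ht => mul_pos (D.m_pos t) (D.gap_pos ht.1 ht.2))
    (fun t ht => mul_pos (pow_pos (D.m_pos t) 2) (by
      rw [← D.gap_add_right]; exact D.gap_pos ht.2 (by linarith [ht.1])))
    (by simp [D.gap_self]) (by simp [D.gap_self, D.gap1_self])
    (by simp [D.gap_self, D.gap1_self, hm]) (by simp [D.gap_self]) (by simp [D.gap_self])
    (by simp [D.gap_self, hm]) (by simp [D.gap_self, D.gap_add_right])
    (by simp [D.gap_self, D.gap1_self, D.gap_add_right, D.gap1_add_right])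
    (by simp [D.gap_self, D.gap1_self, D.gap_add_right, D.gap1_add_right, hm])
    (by simp [hgs]) (by simp [hgs]) (by simp [hgs, hm]) hz hz1 zs zs1 (fun t h0 h1 => ?_)
  · refine ⟨main.1, fun h => ?_⟩
    have h0 := main.2 h
    -- Continuity adds the end points, and periodicity then covers the whole line.
    have hcl : ∀ t ∈ Icc s (s + 2 * π), D.beta t = 0 := by
      rw [← closure_Ioo (by linarith)]
      exact fun t ht => closure_minimal (fun x hx => h0 x hx)
        (isClosed_singleton.preimage D.continuous_beta) ht
    intro t
    obtain ⟨y, hy, hty⟩ := D.periodic_beta.exists_mem_Ico hpi t s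
    rw [hty]
    exact hcl y ⟨hy.1, hy.2.le⟩
  · have := hm t
    simp only [alpha, alpha1, beta]
    field_simp
    ring
  · have := hm t
    simp only [alpha, alpha1, beta]
    field_simp
    ring
  · have := (hill_unique (D.continuous_alpha.div_const 2) hz hz1 h0 h1 s).2
    linarith

end SupportData

/-! ### Bases of solutions of Hill's equation and their monodromy. -/

/-- `x` is a basis of solutions of `x'' + (α/2) x = 0`, and `x'` is its derivative. -/
structure IsHillBasis (α : ℝ → ℝ) (x x' : ℝ → Fin 2 → ℝ) : Prop where
  hasDerivAt : ∀ i t, HasDerivAt (fun t => x t i) (x' t i) t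
  hasDerivAt' : ∀ i t, HasDerivAt (fun t => x' t i) (-(α t / 2 * x t i)) t
  wronskian_ne : ∀ t, x t 0 * x' t 1 - x t 1 * x' t 0 ≠ 0

theorem wronskian_const {q z w z1 w1 : ℝ → ℝ} (hz : ∀ t, HasDerivAt z (z1 t) t)
    (hz1 : ∀ t, HasDerivAt z1 (-(q t * z t)) t) (hw : ∀ t, HasDerivAt w (w1 t) t)
    (hw1 : ∀ t, HasDerivAt w1 (-(q t * w t)) t) (s t : ℝ) :
    z s * w1 s - w s * z1 s = z t * w1 t - w t * z1 t := by
  have hd : ∀ t, HasDerivAt (fun t => z t * w1 t - w t * z1 t) 0 t := fun t =>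
    (((hz t).fun_mul (hw1 t)).fun_sub ((hw t).fun_mul (hz1 t))).congr_deriv (by ring)
  exact is_const_of_deriv_eq_zero (fun t => (hd t).differentiableAt) (fun t => (hd t).deriv) s t

namespace IsHillBasis

variable {α : ℝ → ℝ} {x x' y y' : ℝ → Fin 2 → ℝ} {T S : Matrix (Fin 2) (Fin 2) ℝ}

theorem hasDerivAt_vec (h : IsHillBasis α x x') (t : ℝ) : HasDerivAt x (x' t) t :=
  hasDerivAt_pi.2 fun i => h.hasDerivAt i t

theorem hasDerivAt_vec' (h : IsHillBasis α x x') (t : ℝ) :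
    HasDerivAt x' (-((α t / 2) • x t)) t :=
  hasDerivAt_pi.2 fun i => h.hasDerivAt' i t

theorem wronskian_eq (h : IsHillBasis α x x') (s t : ℝ) :
    x s 0 * x' s 1 - x s 1 * x' s 0 = x t 0 * x' t 1 - x t 1 * x' t 0 :=
  wronskian_const (q := fun t => α t / 2) (h.hasDerivAt 0) (h.hasDerivAt' 0) (h.hasDerivAt 1)
    (h.hasDerivAt' 1) s t

/-- A linear combination of basis solutions vanishing with its derivative is trivial. -/
theorem coeff_eq_zero (h : IsHillBasis α x x') {a b t : ℝ} (h0 : a * x t 0 + b * x t 1 = 0)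
    (h1 : a * x' t 0 + b * x' t 1 = 0) : a = 0 ∧ b = 0 := by
  have hw := h.wronskian_ne t
  have ha : a * (x t 0 * x' t 1 - x t 1 * x' t 0) = 0 := by
    linear_combination x' t 1 * h0 - x t 1 * h1
  have hb : b * (x t 0 * x' t 1 - x t 1 * x' t 0) = 0 := by
    linear_combination -x' t 0 * h0 + x t 0 * h1
  exact ⟨by simpa [hw] using ha, by simpa [hw] using hb⟩

theorem hasDerivAt_comb (h : IsHillBasis α x x') (a b t : ℝ) :
    HasDerivAt (fun t => a * x t 0 + b * x t 1) (a * x' t 0 + b * x' t 1) t :=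
  ((h.hasDerivAt 0 t).const_mul a).fun_add ((h.hasDerivAt 1 t).const_mul b)

theorem hasDerivAt_comb' (h : IsHillBasis α x x') (a b t : ℝ) :
    HasDerivAt (fun t => a * x' t 0 + b * x' t 1) (-(α t / 2 * (a * x t 0 + b * x t 1))) t :=
  (((h.hasDerivAt' 0 t).const_mul a).fun_add ((h.hasDerivAt' 1 t).const_mul b)).congr_deriv
    (by ring)

theorem comb_eq_zero (h : IsHillBasis α x x') {a b : ℝ} (h0 : ∀ t, a * x t 0 + b * x t 1 = 0) :
    a = 0 ∧ b = 0 := by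
  refine h.coeff_eq_zero (h0 0) ((h.hasDerivAt_comb a b 0).unique ?_)
  rw [funext h0]
  exact hasDerivAt_const _ _

/-- Every solution is a linear combination of a basis of solutions. -/
theorem exists_comb (h : IsHillBasis α x x') (hα : Continuous α) {z z1 : ℝ → ℝ}
    (hz : ∀ t, HasDerivAt z (z1 t) t) (hz1 : ∀ t, HasDerivAt z1 (-(α t / 2 * z t)) t) :
    ∃ a b : ℝ, ∀ t, z t = a * x t 0 + b * x t 1 := by
  have hw := h.wronskian_ne 0
  set w := x 0 0 * x' 0 1 - x 0 1 * x' 0 0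
  let a := (z 0 * x' 0 1 - z1 0 * x 0 1) / w
  let b := (x 0 0 * z1 0 - x' 0 0 * z 0) / w
  refine ⟨a, b, fun t => ?_⟩
  have := (hill_unique (z := fun t => z t - (a * x t 0 + b * x t 1))
    (z1 := fun t => z1 t - (a * x' t 0 + b * x' t 1)) (q := fun t => α t / 2)
    (hα.div_const 2) (fun t => (hz t).fun_sub (h.hasDerivAt_comb a b t))
    (fun t => ((hz1 t).fun_sub (h.hasDerivAt_comb' a b t)).congr_deriv (by ring)) (s := 0)
    (by simp only [a, b]; field_simp; simp only [w]; ring)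
    (by simp only [a, b]; field_simp; simp only [w]; ring) t).1
  linarith

theorem matrix_ext (h : IsHillBasis α x x') (hTS : ∀ t, T.mulVec (x t) = S.mulVec (x t)) :
    T = S := by
  ext i j
  have := h.comb_eq_zero (a := T i 0 - S i 0) (b := T i 1 - S i 1) (fun t => by
    have := congrFun (hTS t) i
    simp only [Matrix.mulVec, dotProduct, Fin.sum_univ_two] at this
    linarith)
  fin_cases j
  · exact sub_eq_zero.1 this.1
  · exact sub_eq_zero.1 this.2

theorem deriv_mulVec (h : IsHillBasis α x x') {c : ℝ} (hT : ∀ t, x (t + c) = T.mulVec (x t))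
    (t : ℝ) : x' (t + c) = T.mulVec (x' t) := by
  have h1 : HasDerivAt (fun t => x (t + c)) (x' (t + c)) t :=
    (h.hasDerivAt_vec (t + c)).comp_add_const t c
  refine h1.unique ?_
  rw [funext hT, hasDerivAt_pi]
  intro i
  simp only [Matrix.mulVec, dotProduct, Fin.sum_univ_two]
  exact ((h.hasDerivAt 0 t).const_mul _).fun_add ((h.hasDerivAt 1 t).const_mul _)

/-- The Wronskian is constant, while the shift by `c` multiplies it by `det T`. -/
theorem det_eq_one (h : IsHillBasis α x x') {c : ℝ} (hT : ∀ t, x (t + c) = T.mulVec (x t)) :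
    T.det = 1 := by
  have h0 := h.wronskian_eq (0 + c) 0
  rw [hT, h.deriv_mulVec hT, ← sub_eq_zero] at h0
  have hw := h.wronskian_ne 0
  simp only [Matrix.mulVec, dotProduct, Fin.sum_univ_two] at h0
  have : (T.det - 1) * (x 0 0 * x' 0 1 - x 0 1 * x' 0 0) = 0 := by
    rw [Matrix.det_fin_two]
    linear_combination h0
  simpa [hw, sub_eq_zero] using this

theorem exists_mulVec (hx : IsHillBasis α x x') (hα : Continuous α) (hy : IsHillBasis α y y') :
    ∃ P : Matrix (Fin 2) (Fin 2) ℝ, IsUnit P.det ∧ ∀ t, y t = P.mulVec (x t) := by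
  obtain ⟨a, b, h0⟩ := hx.exists_comb hα (hy.hasDerivAt 0) (hy.hasDerivAt' 0)
  obtain ⟨c, d, h1⟩ := hx.exists_comb hα (hy.hasDerivAt 1) (hy.hasDerivAt' 1)
  refine ⟨!![a, b; c, d], ?_, fun t => ?_⟩
  · rw [isUnit_iff_ne_zero, Matrix.det_fin_two_of]
    intro hdet
    have e0 : y' 0 0 = a * x' 0 0 + b * x' 0 1 := (hy.hasDerivAt 0 0).unique
      (by rw [funext h0]; exact hx.hasDerivAt_comb a b 0)
    have e1 : y' 0 1 = c * x' 0 0 + d * x' 0 1 := (hy.hasDerivAt 1 0).unique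
      (by rw [funext h1]; exact hx.hasDerivAt_comb c d 0)
    apply hy.wronskian_ne 0
    rw [e0, e1, h0, h1]
    linear_combination (x 0 0 * x' 0 1 - x 0 1 * x' 0 0) * hdet
  · ext i
    fin_cases i
    · simpa [Matrix.mulVec, dotProduct] using h0 t
    · simpa [Matrix.mulVec, dotProduct] using h1 t

/-- Monodromies with respect to two bases are conjugate. -/
theorem monodromy_conj (hx : IsHillBasis α x x') (hα : Continuous α) (hy : IsHillBasis α y y')
    (hT : ∀ t, x (t + 2 * π) = T.mulVec (x t)) (hS : ∀ t, y (t + 2 * π) = S.mulVec (y t)) :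
    ∃ P : Matrix (Fin 2) (Fin 2) ℝ, IsUnit P.det ∧ S = P * T * P⁻¹ := by
  obtain ⟨P, hP, hPx⟩ := hx.exists_mulVec hα hy
  refine ⟨P, hP, ?_⟩
  have : S * P = P * T := hx.matrix_ext fun t => by
    rw [← Matrix.mulVec_mulVec, ← hPx, ← hS, hPx, hT, Matrix.mulVec_mulVec]
  rw [← this, Matrix.mul_nonsing_inv_cancel_right _ _ hP]

end IsHillBasis

/-- Independence of the components as functions is traded for a nowhere vanishing Wronskian, which
is what the computations use. The equation also upgrades plain differentiability to class `C²`. -/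
theorem isMonodromy_iff {α : ℝ → ℝ} (hα : Continuous α) {T : Matrix (Fin 2) (Fin 2) ℝ} :
    IsMonodromy α T ↔ ∃ x x', IsHillBasis α x x' ∧ ∀ t, x (t + 2 * π) = T.mulVec (x t) := by
  constructor
  · rintro ⟨x, hx2, hode, hli, hT⟩
    refine ⟨x, deriv x, ?_, hT⟩
    have hd : ∀ t, HasDerivAt x (deriv x t) t := fun t =>
      (hx2.differentiable (by norm_num) t).hasDerivAt
    have hd' : ∀ t, HasDerivAt (deriv x) (-((α t / 2) • x t)) t := fun t => by
      have h1 : ContDiff ℝ 1 (deriv x) := ((contDiff_succ_iff_deriv (n := 1)).1 hx2).2.2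
      have h2 := (h1.differentiable (by norm_num) t).hasDerivAt
      refine h2.congr_deriv ?_
      have h3 := hode t
      rw [iteratedDeriv_succ, iteratedDeriv_one] at h3
      exact eq_neg_of_add_eq_zero_left h3
    have hdi : ∀ i t, HasDerivAt (fun t => x t i) (deriv x t i) t := fun i t =>
      hasDerivAt_pi.1 (hd t) i
    have hdi' : ∀ i t, HasDerivAt (fun t => deriv x t i) (-(α t / 2 * x t i)) t := fun i t =>
      hasDerivAt_pi.1 (hd' t) i
    refine ⟨hdi, hdi', fun t hw => ?_⟩
    -- A zero of the Wronskian yields a nontrivial combination of the components with zero Cauchy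
    -- data at `t`, hence one that vanishes identically.
    have hM : Matrix.det !![x t 0, x t 1; deriv x t 0, deriv x t 1] = 0 := by
      rw [Matrix.det_fin_two_of]; exact hw
    obtain ⟨v, hv, hMv⟩ := Matrix.exists_mulVec_eq_zero_iff.2 hM
    have e0 : x t 0 * v 0 + x t 1 * v 1 = 0 := by
      simpa [Matrix.mulVec, dotProduct] using congrFun hMv 0
    have e1 : deriv x t 0 * v 0 + deriv x t 1 * v 1 = 0 := by
      simpa [Matrix.mulVec, dotProduct] using congrFun hMv 1
    have hz := fun r => (hill_unique (q := fun t => α t / 2) (hα.div_const 2)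
      (fun t => ((hdi 0 t).mul_const (v 0)).fun_add ((hdi 1 t).mul_const (v 1)))
      (fun t => (((hdi' 0 t).mul_const (v 0)).fun_add ((hdi' 1 t).mul_const (v 1))).congr_deriv
        (by ring)) e0 e1 r).1
    rw [Fintype.linearIndependent_iff] at hli
    refine hv (funext fun i => hli v (funext fun r => ?_) i)
    simp only [Fin.sum_univ_two, Pi.add_apply, Pi.smul_apply, smul_eq_mul, Pi.zero_apply]
    linarith [hz r]
  · rintro ⟨x, x', hx, hT⟩
    have hd : deriv x = x' := funext fun t => (hx.hasDerivAt_vec t).deriv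
    have hd' : deriv x' = fun t => -((α t / 2) • x t) :=
      funext fun t => (hx.hasDerivAt_vec' t).deriv
    have hxc : Continuous x := continuous_iff_continuousAt.2 fun t =>
      (hx.hasDerivAt_vec t).continuousAt
    refine ⟨x, ?_, fun t => ?_, ?_, hT⟩
    · refine (contDiff_succ_iff_deriv (n := 1)).2
        ⟨fun t => (hx.hasDerivAt_vec t).differentiableAt, by simp, ?_⟩
      rw [hd, contDiff_one_iff_deriv, hd']
      exact ⟨fun t => (hx.hasDerivAt_vec' t).differentiableAt, by fun_prop⟩
    · rw [iteratedDeriv_succ, iteratedDeriv_one, hd, hd', neg_add_cancel]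
    · rw [Fintype.linearIndependent_iff]
      intro g hg
      have := hx.comb_eq_zero (a := g 0) (b := g 1) fun t => by
        simpa [Fin.sum_univ_two] using congrFun hg t
      intro i
      fin_cases i
      · exact this.1
      · exact this.2

/-! ### Constant coefficients: trace and spectrum. -/

/-- The trace of the monodromy of the equation with constant coefficient `a`. -/
noncomputable def constTrace (a : ℝ) : ℝ :=
  if 0 ≤ a then 2 * cos (2 * π * √(a / 2)) else 2 * cosh (2 * π * √(-a / 2))

theorem exists_isHillBasis_const (a : ℝ) : ∃ x x' T, IsHillBasis (fun _ => a) x x' ∧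
    (∀ t, x (t + 2 * π) = Matrix.mulVec T (x t)) ∧ T.trace = constTrace a := by
  have hmul : ∀ w t : ℝ, HasDerivAt (fun t => w * t) w t := fun w t => by
    simpa using (hasDerivAt_id t).const_mul w
  rcases lt_trichotomy a 0 with ha | ha | ha
  · have hw0 : 0 < √(-a / 2) := Real.sqrt_pos.2 (by linarith)
    have hw2 : √(-a / 2) ^ 2 = -a / 2 := Real.sq_sqrt (by linarith)
    rw [constTrace, if_neg (not_le.2 ha)]
    set w := √(-a / 2)
    refine ⟨fun t => ![cosh (w * t), sinh (w * t)], fun t => ![w * sinh (w * t), w * cosh (w * t)],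
      !![cosh (2 * π * w), sinh (2 * π * w); sinh (2 * π * w), cosh (2 * π * w)],
      ⟨fun i t => ?_, fun i t => ?_, fun t => ?_⟩, fun t => ?_, ?_⟩
    · fin_cases i
      · exact (hmul w t).cosh.congr_deriv (by simp [mul_comm])
      · exact (hmul w t).sinh.congr_deriv (by simp [mul_comm])
    · fin_cases i
      · exact ((hmul w t).sinh.const_mul w).congr_deriv (by simp; linear_combination cosh (w * t) * hw2)
      · exact ((hmul w t).cosh.const_mul w).congr_deriv (by simp; linear_combination sinh (w * t) * hw2)
    · have := Real.cosh_sq (w * t)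
      simp only [Matrix.cons_val_zero, Matrix.cons_val_one]
      have : cosh (w * t) * (w * cosh (w * t)) - sinh (w * t) * (w * sinh (w * t)) = w := by
        linear_combination w * this
      rw [this]; exact hw0.ne'
    · beta_reduce
      rw [show w * (t + 2 * π) = w * t + 2 * π * w by ring, Real.cosh_add, Real.sinh_add]
      ext i
      fin_cases i <;> simp [Matrix.mulVec, dotProduct] <;> ring
    · simp [Matrix.trace]; ring
  · rw [constTrace, if_pos ha.ge, ha]
    refine ⟨fun t => ![1, t], fun _ => ![0, 1], !![1, 0; 2 * π, 1], ⟨fun i t => ?_, fun i t => ?_,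
      fun t => by simp⟩, fun t => ?_, by simp [Matrix.trace]; norm_num⟩
    · fin_cases i
      · exact hasDerivAt_const t 1
      · exact hasDerivAt_id t
    · fin_cases i
      · exact (hasDerivAt_const t 0).congr_deriv (by simp)
      · exact (hasDerivAt_const t 1).congr_deriv (by simp)
    · ext i
      fin_cases i <;> simp [Matrix.mulVec, dotProduct]; ring
  · have hw0 : 0 < √(a / 2) := Real.sqrt_pos.2 (by linarith)
    have hw2 : √(a / 2) ^ 2 = a / 2 := Real.sq_sqrt (by linarith)
    rw [constTrace, if_pos ha.le]
    set w := √(a / 2)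
    refine ⟨fun t => ![cos (w * t), sin (w * t)], fun t => ![-(w * sin (w * t)), w * cos (w * t)],
      !![cos (2 * π * w), -sin (2 * π * w); sin (2 * π * w), cos (2 * π * w)],
      ⟨fun i t => ?_, fun i t => ?_, fun t => ?_⟩, fun t => ?_, ?_⟩
    · fin_cases i
      · exact (hmul w t).cos.congr_deriv (by simp [mul_comm])
      · exact (hmul w t).sin.congr_deriv (by simp [mul_comm])
    · fin_cases i
      · exact ((hmul w t).sin.const_mul w).fun_neg.congr_deriv
          (by simp; linear_combination cos (w * t) * hw2)
      · exact ((hmul w t).cos.const_mul w).congr_deriv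
          (by simp; linear_combination sin (w * t) * hw2)
    · have := Real.sin_sq_add_cos_sq (w * t)
      simp only [Matrix.cons_val_zero, Matrix.cons_val_one]
      have : cos (w * t) * (w * cos (w * t)) - sin (w * t) * -(w * sin (w * t)) = w := by
        linear_combination w * this
      rw [this]; exact hw0.ne'
    · beta_reduce
      rw [show w * (t + 2 * π) = w * t + 2 * π * w by ring, Real.cos_add, Real.sin_add]
      ext i
      fin_cases i <;> simp [Matrix.mulVec, dotProduct] <;> ring
    · simp [Matrix.trace]; ring

/-- For `0 ≤ a ≤ 1/2` the angle stays in `[0, π]`, where the cosine is injective; this is where the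
bound `1/2` matters. For `a < 0` the hyperbolic cosine gives values above `2`, so the two ranges do
not meet. -/
theorem constTrace_injOn : InjOn constTrace (Iic (1 / 2)) := by
  have hpi := pi_pos
  have hcosh : ∀ a < 0, 2 < 2 * cosh (2 * π * √(-a / 2)) := fun a ha => by
    have : 0 < √(-a / 2) := Real.sqrt_pos.2 (by linarith)
    have := Real.one_lt_cosh.2 (show 2 * π * √(-a / 2) ≠ 0 by positivity)
    linarith
  intro a ha b hb hab
  simp only [mem_Iic] at ha hb
  unfold constTrace at hab
  split_ifs at hab with h1 h2 h2
  · have hr : ∀ c : ℝ, 0 ≤ c → c ≤ 1 / 2 → 2 * π * √(c / 2) ∈ Icc 0 π := fun c h0 h1 => by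
      have h2 : √(c / 2) ≤ 1 / 2 := Real.sqrt_le_iff.2 ⟨by norm_num, by linarith⟩
      have h3 := Real.sqrt_nonneg (c / 2)
      exact ⟨by positivity, by nlinarith⟩
    have h3 := injOn_cos (hr a h1 ha) (hr b h2 hb) (by linarith)
    have h4 := mul_left_cancel₀ (by positivity) h3
    have h5 := (Real.sqrt_inj (by linarith) (by linarith)).1 h4
    linarith
  · have := hcosh b (not_le.1 h2)
    have := cos_le_one (2 * π * √(a / 2))
    linarith
  · have := hcosh a (not_le.1 h1)
    have := cos_le_one (2 * π * √(b / 2))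
    linarith
  · push Not at h1 h2
    have h3 : |2 * π * √(-a / 2)| = |2 * π * √(-b / 2)| := by
      have h4 : cosh (2 * π * √(-a / 2)) = cosh (2 * π * √(-b / 2)) := by linarith
      exact le_antisymm (Real.cosh_le_cosh.1 h4.le) (Real.cosh_le_cosh.1 h4.ge)
    rw [abs_of_nonneg (by positivity), abs_of_nonneg (by positivity)] at h3
    have h4 := mul_left_cancel₀ (by positivity) h3
    have h5 := (Real.sqrt_inj (by linarith) (by linarith)).1 h4
    linarith

theorem constTrace_of_log {l : ℝ} (hl : 1 < l) :
    constTrace (-(Real.log l) ^ 2 / (2 * π ^ 2)) = l + l⁻¹ := by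
  have hlog := Real.log_pos hl
  have hpi := pi_pos
  have hneg : -(Real.log l) ^ 2 / (2 * π ^ 2) < 0 := by
    rw [neg_div]; exact neg_neg_of_pos (by positivity)
  rw [constTrace, if_neg (not_le.2 hneg)]
  have : -(-(Real.log l) ^ 2 / (2 * π ^ 2)) / 2 = (Real.log l / (2 * π)) ^ 2 := by
    field_simp
  rw [this, Real.sqrt_sq (by positivity), mul_div_cancel₀ _ (by positivity), Real.cosh_log (by linarith)]
  ring

theorem constTrace_of_angle {φ : ℝ} (h0 : 0 ≤ φ) : constTrace (φ ^ 2 / (2 * π ^ 2)) = 2 * cos φ := by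
  have hpi := pi_pos
  rw [constTrace, if_pos (by positivity)]
  have : φ ^ 2 / (2 * π ^ 2) / 2 = (φ / (2 * π)) ^ 2 := by
    field_simp
  rw [this, Real.sqrt_sq (by positivity), mul_div_cancel₀ _ (by positivity)]

theorem constTrace_zero : constTrace 0 = 2 := by simp [constTrace]

theorem constTrace_half : constTrace (1 / 2) = -2 := by
  have := constTrace_of_angle pi_pos.le
  have h : π ^ 2 / (2 * π ^ 2) = 1 / 2 := by
    have := pi_pos
    field_simp
  rw [h, cos_pi] at this
  rw [this]; norm_num

/-- The characteristic polynomial of a matrix of determinant one depends on the trace alone. -/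
theorem mem_complexSpectrum {T : Matrix (Fin 2) (Fin 2) ℝ} (hT : T.det = 1) (z : ℂ) :
    z ∈ complexSpectrum T ↔ z ^ 2 - T.trace * z + 1 = 0 := by
  rw [complexSpectrum, spectrum.mem_iff, Matrix.isUnit_iff_isUnit_det, isUnit_iff_ne_zero, not_not,
    Matrix.det_fin_two]
  rw [Matrix.det_fin_two] at hT
  have hT' : (T 0 0 : ℂ) * T 1 1 - T 0 1 * T 1 0 = 1 := by exact_mod_cast hT
  simp [Matrix.algebraMap_matrix_apply, Matrix.trace]
  constructor <;> intro h
  · linear_combination h - hT'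
  · linear_combination h + hT'

theorem complexSpectrum_eq_pair {T : Matrix (Fin 2) (Fin 2) ℝ} (hT : T.det = 1) {z w : ℂ}
    (hzw : z * w = 1) : complexSpectrum T = {z, w} ↔ (T.trace : ℂ) = z + w := by
  have hz : z ≠ 0 := left_ne_zero_of_mul_eq_one hzw
  constructor
  · intro h
    have : z ∈ complexSpectrum T := h ▸ mem_insert z _
    rw [mem_complexSpectrum hT] at this
    apply mul_left_cancel₀ hz
    linear_combination -this - hzw
  · intro h
    ext p
    rw [mem_complexSpectrum hT, h, mem_insert_iff, mem_singleton_iff, ← sub_eq_zero (a := p),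
      ← sub_eq_zero (a := p) (b := w), ← mul_eq_zero]
    constructor <;> intro h
    · linear_combination h + hzw
    · linear_combination h - hzw

/-- The spectral cases for a matrix whose trace is `constTrace a`, `a ≤ 1/2`. -/
theorem complexSpectrum_cases {T : Matrix (Fin 2) (Fin 2) ℝ} (hT : T.det = 1) {a : ℝ}
    (ha : a ≤ 1 / 2) (htr : T.trace = constTrace a) :
    (∀ l : ℝ, 1 < l → (complexSpectrum T = {(l : ℂ), (l : ℂ)⁻¹} ↔
      a = -(Real.log l) ^ 2 / (2 * π ^ 2))) ∧
    (complexSpectrum T = {1} ↔ a = 0) ∧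
    (∀ φ : ℝ, 0 < φ → φ < π →
      (complexSpectrum T = {Complex.exp (φ * Complex.I), Complex.exp (-(φ * Complex.I))} ↔
        a = φ ^ 2 / (2 * π ^ 2))) := by
  have hpi := pi_pos
  have key : ∀ b ≤ 1 / 2, (T.trace = constTrace b ↔ a = b) := fun b hb =>
    ⟨fun h => constTrace_injOn ha hb (htr ▸ h), fun h => h ▸ htr⟩
  refine ⟨fun l hl => ?_, ?_, fun φ h0 h1 => ?_⟩
  · have hl0 : (l : ℂ) ≠ 0 := by exact_mod_cast (by linarith : l ≠ 0)
    rw [complexSpectrum_eq_pair hT (mul_inv_cancel₀ hl0), ← key, constTrace_of_log hl]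
    · norm_cast
    · have : 0 ≤ (Real.log l) ^ 2 / (2 * π ^ 2) := by positivity
      rw [neg_div]; linarith
  · have := complexSpectrum_eq_pair hT (mul_one (1 : ℂ))
    rw [pair_eq_singleton] at this
    rw [this, ← key 0 (by norm_num), constTrace_zero, one_add_one_eq_two]
    norm_cast
  · rw [complexSpectrum_eq_pair hT (by rw [← Complex.exp_add]; simp), ← key,
      constTrace_of_angle h0.le]
    · rw [← neg_mul, ← Complex.two_cos]
      norm_cast
    · rw [div_le_iff₀ (by positivity)]
      nlinarith

/-! ### The symmetric square of Hill's equation. -/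

/-- The linear independence of three vectors, in terms of coefficients. -/
theorem linearIndependent_three {E : Type*} [AddCommGroup E] [Module ℝ E] {u v w : E}
    (h : ∀ a b c : ℝ, a • u + b • v + c • w = 0 → a = 0 ∧ b = 0 ∧ c = 0) :
    LinearIndependent ℝ ![u, v, w] := by
  rw [Fintype.linearIndependent_iff]
  intro g hg
  simp only [Fin.sum_univ_three, Matrix.cons_val_zero, Matrix.cons_val_one,
    Matrix.cons_val_two, Matrix.tail_cons, Matrix.head_cons] at hg
  obtain ⟨h0, h1, h2⟩ := h _ _ _ hg
  intro i
  fin_cases i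
  exacts [h0, h1, h2]

theorem exists_linearEquiv_of_linearIndependent {u v : Fin 3 → Space3}
    (hu : LinearIndependent ℝ u) (hv : LinearIndependent ℝ v) :
    ∃ A : Space3 ≃ₗ[ℝ] Space3, ∀ i, A (u i) = v i := by
  have hc : Fintype.card (Fin 3) = Module.finrank ℝ Space3 := by simp
  refine ⟨(basisOfLinearIndependentOfCardEqFinrank hu hc).equiv
    (basisOfLinearIndependentOfCardEqFinrank hv hc) (Equiv.refl _), fun i => ?_⟩
  have := (basisOfLinearIndependentOfCardEqFinrank hu hc).equiv_apply i
    (basisOfLinearIndependentOfCardEqFinrank hv hc) (Equiv.refl _)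
  simpa using this

namespace IsHillBasis

variable {α : ℝ → ℝ} {x x' : ℝ → Fin 2 → ℝ} {T : Matrix (Fin 2) (Fin 2) ℝ}

/-- A quadratic form vanishing along a basis of solutions is zero. -/
theorem quadratic_eq_zero (hx : IsHillBasis α x x') {a b c : ℝ}
    (h : ∀ t, a * x t 0 ^ 2 + b * (x t 0 * x t 1) + c * x t 1 ^ 2 = 0) :
    a = 0 ∧ b = 0 ∧ c = 0 := by
  have h1 : ∀ t, 2 * a * (x t 0 * x' t 0) + b * (x' t 0 * x t 1 + x t 0 * x' t 1) +
      2 * c * (x t 1 * x' t 1) = 0 := fun t => by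
    have hd := ((((hx.hasDerivAt 0 t).fun_pow 2).const_mul a).fun_add
      (((hx.hasDerivAt 0 t).fun_mul (hx.hasDerivAt 1 t)).const_mul b)).fun_add
      (((hx.hasDerivAt 1 t).fun_pow 2).const_mul c)
    rw [funext h] at hd
    have := hd.unique (hasDerivAt_const t 0)
    norm_num at this
    linear_combination this
  -- Differentiating `Q(x) = 0` twice and using the equation gives `Q(x, x) = Q(x, x') = Q(x', x') =
  -- 0`. As `x` and `x'` span the plane, `Q = 0`.
  have h2 : ∀ t, a * x' t 0 ^ 2 + b * (x' t 0 * x' t 1) + c * x' t 1 ^ 2 = 0 := fun t => by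
    have hd := ((((hx.hasDerivAt 0 t).fun_mul (hx.hasDerivAt' 0 t)).const_mul (2 * a)).fun_add
      ((((hx.hasDerivAt' 0 t).fun_mul (hx.hasDerivAt 1 t)).fun_add
        ((hx.hasDerivAt 0 t).fun_mul (hx.hasDerivAt' 1 t))).const_mul b)).fun_add
      (((hx.hasDerivAt 1 t).fun_mul (hx.hasDerivAt' 1 t)).const_mul (2 * c))
    rw [funext h1] at hd
    have := hd.unique (hasDerivAt_const t 0)
    linear_combination this / 2 + α t / 2 * h t
  have hw := pow_ne_zero 2 (hx.wronskian_ne 0)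
  have ha : a * (x 0 0 * x' 0 1 - x 0 1 * x' 0 0) ^ 2 = 0 := by
    linear_combination x' 0 1 ^ 2 * h 0 - x 0 1 * x' 0 1 * h1 0 + x 0 1 ^ 2 * h2 0
  have hb : b * (x 0 0 * x' 0 1 - x 0 1 * x' 0 0) ^ 2 = 0 := by
    linear_combination -2 * (x' 0 0 * x' 0 1) * h 0 + (x 0 0 * x' 0 1 + x 0 1 * x' 0 0) * h1 0 -
      2 * x 0 0 * x 0 1 * h2 0
  have hc : c * (x 0 0 * x' 0 1 - x 0 1 * x' 0 0) ^ 2 = 0 := by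
    linear_combination x' 0 0 ^ 2 * h 0 - x 0 0 * x' 0 0 * h1 0 + x 0 0 ^ 2 * h2 0
  exact ⟨(mul_eq_zero.1 ha).resolve_right hw, (mul_eq_zero.1 hb).resolve_right hw,
    (mul_eq_zero.1 hc).resolve_right hw⟩

/-- If `x(t)` and `x(t + c)` are parallel for all `t`, the monodromy is a multiple of the
identity. -/
theorem eq_one_or_neg_one (hx : IsHillBasis α x x') {c : ℝ}
    (hT : ∀ t, x (t + c) = T.mulVec (x t))
    (hpar : ∀ t, x t 0 * x (t + c) 1 - x t 1 * x (t + c) 0 = 0) : T = 1 ∨ T = -1 := by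
  -- The form `det (x, Tx)` has coefficients `T₁₀`, `T₁₁ - T₀₀`, `-T₀₁`. Its vanishing makes `T`
  -- scalar, and determinant one leaves the two signs.
  obtain ⟨h0, h1, h2⟩ := hx.quadratic_eq_zero (a := T 1 0) (b := T 1 1 - T 0 0) (c := -T 0 1)
    fun t => by
      have := hpar t
      rw [hT] at this
      simp only [Matrix.mulVec, dotProduct, Fin.sum_univ_two] at this
      linarith
  have hdet := hx.det_eq_one hT
  rw [Matrix.det_fin_two, h0, mul_zero, sub_zero, sub_eq_zero.1 h1, mul_self_eq_one_iff] at hdet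
  rw [neg_eq_zero] at h2
  refine hdet.imp (fun h => ?_) fun h => ?_ <;> ext i j <;> fin_cases i <;> fin_cases j <;>
    simp [h0, h2, h, sub_eq_zero.1 h1]

/-- The curve of the squares of the basis solutions, on the circular cone. -/
theorem exists_linearEquiv_square (hx : IsHillBasis α x x') {α1 : ℝ → ℝ}
    (hα : ∀ t, HasDerivAt α (α1 t) t) (hα1 : Continuous α1) {y y1 y2 : ℝ → Space3}
    (hy : ∀ t, HasDerivAt y (y1 t) t) (hy1 : ∀ t, HasDerivAt y1 (y2 t) t)
    (hy2 : ∀ t, HasDerivAt y2 ((-(2 * α t)) • y1 t + (-α1 t) • y t) t)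
    (hli : LinearIndependent ℝ ![y 0, y1 0, y2 0]) :
    ∃ A : Space3 ≃ₗ[ℝ] Space3, ∀ t, y t =
      A ![x t 0 ^ 2 + x t 1 ^ 2, x t 0 ^ 2 - x t 1 ^ 2, 2 * (x t 0 * x t 1)] := by
  -- Products of two solutions of `x'' + (α/2) x = 0` solve `y''' + 2αy' + α'y = 0`. The three
  -- chosen combinations are a basis of such products on which `q₁² + q₂² = q₀²`.
  let q : ℝ → Space3 := fun t =>
    ![x t 0 ^ 2 + x t 1 ^ 2, x t 0 ^ 2 - x t 1 ^ 2, 2 * (x t 0 * x t 1)]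
  let q1 : ℝ → Space3 := fun t => ![2 * (x t 0 * x' t 0) + 2 * (x t 1 * x' t 1),
    2 * (x t 0 * x' t 0) - 2 * (x t 1 * x' t 1), 2 * (x' t 0 * x t 1 + x t 0 * x' t 1)]
  let q2 : ℝ → Space3 := fun t => (2 : ℝ) • ![x' t 0 ^ 2 + x' t 1 ^ 2, x' t 0 ^ 2 - x' t 1 ^ 2,
    2 * (x' t 0 * x' t 1)] - α t • q t
  have d0 := hx.hasDerivAt 0
  have d1 := hx.hasDerivAt 1
  have d0' := hx.hasDerivAt' 0
  have d1' := hx.hasDerivAt' 1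
  have hq : ∀ t, HasDerivAt q (q1 t) t := fun t => by
    rw [hasDerivAt_pi]
    intro i
    fin_cases i
    · exact (((d0 t).fun_pow 2).fun_add ((d1 t).fun_pow 2)).congr_deriv (by simp [q1]; ring)
    · exact (((d0 t).fun_pow 2).fun_sub ((d1 t).fun_pow 2)).congr_deriv (by simp [q1]; ring)
    · exact (((d0 t).fun_mul (d1 t)).const_mul 2).congr_deriv (by simp [q1])
  have hq1 : ∀ t, HasDerivAt q1 (q2 t) t := fun t => by
    rw [hasDerivAt_pi]
    intro i
    fin_cases i
    · exact ((((d0 t).fun_mul (d0' t)).const_mul 2).fun_add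
        (((d1 t).fun_mul (d1' t)).const_mul 2)).congr_deriv (by simp [q2, q]; ring)
    · exact ((((d0 t).fun_mul (d0' t)).const_mul 2).fun_sub
        (((d1 t).fun_mul (d1' t)).const_mul 2)).congr_deriv (by simp [q2, q]; ring)
    · exact ((((d0' t).fun_mul (d1 t)).fun_add ((d0 t).fun_mul (d1' t))).const_mul 2).congr_deriv
        (by simp [q2, q]; ring)
  have hp : ∀ t, HasDerivAt (fun t => (2 : ℝ) • (![x' t 0 ^ 2 + x' t 1 ^ 2,
      x' t 0 ^ 2 - x' t 1 ^ 2, 2 * (x' t 0 * x' t 1)] : Space3)) (-α t • q1 t) t := fun t => by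
    rw [hasDerivAt_pi]
    intro i
    fin_cases i
    · exact ((((d0' t).fun_pow 2).fun_add ((d1' t).fun_pow 2)).const_mul 2).congr_deriv
        (by simp [q1]; ring)
    · exact ((((d0' t).fun_pow 2).fun_sub ((d1' t).fun_pow 2)).const_mul 2).congr_deriv
        (by simp [q1]; ring)
    · exact ((((d0' t).fun_mul (d1' t)).const_mul 2).const_mul 2).congr_deriv (by simp [q1]; ring)
  have hq2 : ∀ t, HasDerivAt q2 ((-(2 * α t)) • q1 t + (-α1 t) • q t) t := fun t => by
    exact ((hp t).fun_sub ((hα t).fun_smul (hq t))).congr_deriv (by module)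
  have hqi : LinearIndependent ℝ ![q 0, q1 0, q2 0] := by
    refine linearIndependent_three fun a b c habc => ?_
    have e0 := congrFun habc 0
    have e1 := congrFun habc 1
    have e2 := congrFun habc 2
    simp [q, q1, q2] at e0 e1 e2
    have hw := hx.wronskian_ne 0
    have hc : c * (x 0 0 * x' 0 1 - x 0 1 * x' 0 0) ^ 2 = 0 := by
      linear_combination (x 0 1 ^ 2 + x 0 0 ^ 2) / 4 * e0 + (x 0 1 ^ 2 - x 0 0 ^ 2) / 4 * e1 -
        (x 0 0 * x 0 1) / 2 * e2
    have hc0 : c = 0 := (mul_eq_zero.1 hc).resolve_right (pow_ne_zero 2 hw)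
    subst hc0
    have hb0 : b * x 0 0 * (x 0 0 * x' 0 1 - x 0 1 * x' 0 0) = 0 := by
      linear_combination -x 0 1 / 2 * e0 - x 0 1 / 2 * e1 + x 0 0 / 2 * e2
    have hb1 : b * x 0 1 * (x 0 0 * x' 0 1 - x 0 1 * x' 0 0) = 0 := by
      linear_combination x 0 0 / 2 * e0 - x 0 0 / 2 * e1 - x 0 1 / 2 * e2
    have hb0' := (mul_eq_zero.1 hb0).resolve_right hw
    have hb1' := (mul_eq_zero.1 hb1).resolve_right hw
    have hb : b = 0 := by
      have : b * (x 0 0 * x' 0 1 - x 0 1 * x' 0 0) = 0 := by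
        linear_combination x' 0 1 * hb0' - x' 0 0 * hb1'
      exact (mul_eq_zero.1 this).resolve_right hw
    subst hb
    refine ⟨?_, rfl, rfl⟩
    by_contra ha
    have e3 : a * x 0 0 ^ 2 = 0 := by linear_combination e0 / 2 + e1 / 2
    have e4 : a * x 0 1 ^ 2 = 0 := by linear_combination e0 / 2 - e1 / 2
    have e5 : x 0 0 = 0 := by simpa [ha] using e3
    have e6 : x 0 1 = 0 := by simpa [ha] using e4
    exact hw (by rw [e5, e6]; ring)
  -- The linear map is fixed by the initial data at `0`; uniqueness propagates the identity.
  obtain ⟨A, hA⟩ := exists_linearEquiv_of_linearIndependent hqi hli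
  refine ⟨A, fun t => ?_⟩
  have hAd : ∀ {f : ℝ → Space3} {f' : Space3} {t : ℝ}, HasDerivAt f f' t →
      HasDerivAt (fun t => A (f t)) (A f') t := fun hf =>
    (A.toContinuousLinearEquiv.hasFDerivAt).comp_hasDerivAt _ hf
  have hαc : Continuous α := continuous_iff_continuousAt.2 fun t => (hα t).continuousAt
  have h0 : A (q 0) = y 0 := hA 0
  have h1 : A (q1 0) = y1 0 := hA 1
  have h2 : A (q2 0) = y2 0 := hA 2
  have := third_order_unique (a := fun t => -(2 * α t)) (b := fun t => -α1 t) (by fun_prop)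
    (by fun_prop) (fun t => (hy t).fun_sub (hAd (hq t))) (fun t => (hy1 t).fun_sub (hAd (hq1 t)))
    (fun t => ((hy2 t).fun_sub (hAd (hq2 t))).congr_deriv (by
      simp only [map_add, map_smul]; module)) (s := 0) (by simp [h0]) (by simp [h1])
    (by simp [h2]) t
  exact sub_eq_zero.1 this

end IsHillBasis

/-! ### The unimodular lift and the case of vanishing `β`. -/

namespace SupportData

variable (D : SupportData)

/-- The section of the cone given by the support function. -/
noncomputable def point (t : ℝ) : Space3 := ![cos t, sin t, D.h t]
/-- The derivative of `point`. -/
noncomputable def point1 (t : ℝ) : Space3 := ![-sin t, cos t, D.h1 t]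
/-- The derivative of `point1`. -/
noncomputable def point2 (t : ℝ) : Space3 := ![-cos t, -sin t, (D.m t ^ 3)⁻¹ - D.h t]

theorem hasDerivAt_point (t : ℝ) : HasDerivAt D.point (D.point1 t) t := by
  rw [hasDerivAt_pi]
  intro i
  fin_cases i
  exacts [hasDerivAt_cos t, hasDerivAt_sin t, D.hasDerivAt_h t]

theorem hasDerivAt_point1 (t : ℝ) : HasDerivAt D.point1 (D.point2 t) t := by
  rw [hasDerivAt_pi]
  intro i
  fin_cases i
  exacts [(hasDerivAt_sin t).fun_neg, hasDerivAt_cos t, D.hasDerivAt_h1 t]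

theorem hasDerivAt_point2 (t : ℝ) : HasDerivAt D.point2
    (-D.point1 t - (3 * (D.m1 t / D.m t)) • (D.point t + D.point2 t)) t := by
  rw [hasDerivAt_pi]
  have := D.m_ne t
  intro i
  fin_cases i
  · exact (hasDerivAt_cos t).fun_neg.congr_deriv (by simp [point, point1, point2])
  · exact (hasDerivAt_sin t).fun_neg.congr_deriv (by simp [point, point1, point2])
  · refine ((((D.hasDerivAt_m t).fun_pow 3).fun_inv (pow_ne_zero 3 this)).fun_sub
      (D.hasDerivAt_h t)).congr_deriv ?_
    simp [point, point1, point2]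
    field_simp
    ring

/-- The distinguished lift of the projective curve. -/
noncomputable def curve (t : ℝ) : Space3 := D.m t • D.point t
/-- The derivative of `curve`. -/
noncomputable def curve1 (t : ℝ) : Space3 := D.m1 t • D.point t + D.m t • D.point1 t
/-- The derivative of `curve1`. -/
noncomputable def curve2 (t : ℝ) : Space3 :=
  D.m2 t • D.point t + (2 * D.m1 t) • D.point1 t + D.m t • D.point2 t

theorem hasDerivAt_curve (t : ℝ) : HasDerivAt D.curve (D.curve1 t) t :=
  ((D.hasDerivAt_m t).fun_smul (D.hasDerivAt_point t)).congr_deriv (by simp only [curve1]; module)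

theorem hasDerivAt_curve1 (t : ℝ) : HasDerivAt D.curve1 (D.curve2 t) t :=
  (((D.hasDerivAt_m1 t).fun_smul (D.hasDerivAt_point t)).fun_add
    ((D.hasDerivAt_m t).fun_smul (D.hasDerivAt_point1 t))).congr_deriv
      (by simp only [curve2]; module)

/-- The determinant of `curve`, `curve1`, `curve2` is `m³ · m⁻³ = 1`, so the third derivative has no
`curve2` component. The formulas for `alpha` and `beta` are read off from the other two components.
-/
theorem hasDerivAt_curve2 (t : ℝ) : HasDerivAt D.curve2
    ((-(2 * D.alpha t)) • D.curve1 t + (-(D.alpha1 t + D.beta t)) • D.curve t) t := by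
  refine ((((D.hasDerivAt_m2 t).fun_smul (D.hasDerivAt_point t)).fun_add
    (((D.hasDerivAt_m1 t).const_mul 2).fun_smul (D.hasDerivAt_point1 t))).fun_add
    ((D.hasDerivAt_m t).fun_smul (D.hasDerivAt_point2 t))).congr_deriv ?_
  have := D.m_ne t
  simp only [curve, curve1, alpha, alpha1, beta]
  match_scalars <;> field_simp <;> ring

/-- `point + point2` is the vertical vector of height `m⁻³ ≠ 0`, while `point` and `point1` have
orthonormal horizontal parts. The passage to `curve`, `curve1`, `curve2` is triangular with diagonal
`m`. -/
theorem curve_comb_eq_zero {t a b c : ℝ}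
    (h : a • D.curve t + b • D.curve1 t + c • D.curve2 t = 0) : a = 0 ∧ b = 0 ∧ c = 0 := by
  have hm := D.m_ne t
  have key : ∀ p q r : ℝ, p • D.point t + q • D.point1 t + r • D.point2 t = 0 →
      p = 0 ∧ q = 0 ∧ r = 0 := by
    intro p q r h
    have e0 := congrFun h 0
    have e1 := congrFun h 1
    have e2 := congrFun h 2
    simp [point, point1, point2] at e0 e1 e2
    have hs := sin_sq_add_cos_sq t
    have hq : q = 0 := by linear_combination -sin t * e0 + cos t * e1 - q * hs
    have hp : p = r := by linear_combination cos t * e0 + sin t * e1 - (p - r) * hs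
    have hr : r * (D.m t ^ 3)⁻¹ = 0 := by
      rw [hq, hp] at e2
      linear_combination e2
    have hr0 : r = 0 := by simpa [hm] using hr
    exact ⟨hp.trans hr0, hq, hr0⟩
  obtain ⟨h1, h2, h3⟩ := key (a * D.m t + b * D.m1 t + c * D.m2 t) (b * D.m t + c * (2 * D.m1 t))
    (c * D.m t) (by rw [← h]; simp only [curve, curve1, curve2]; module)
  have hc : c = 0 := by simpa [hm] using h3
  have hb : b = 0 := by simpa [hm, hc] using h2
  have ha : a = 0 := by simpa [hm, hc, hb] using h1
  exact ⟨ha, hb, hc⟩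

theorem periodic_point : Function.Periodic D.point (2 * π) := fun t => by
  simp only [point, cos_add_two_pi, sin_add_two_pi, D.periodic_h t]

theorem periodic_curve : Function.Periodic D.curve (2 * π) := fun t => by
  simp only [curve, D.periodic_point t, D.periodic_m t]

variable {D} {x x' : ℝ → Fin 2 → ℝ} {T : Matrix (Fin 2) (Fin 2) ℝ}

/-- Consecutive zeros of a solution are at least one period apart. -/
theorem zero_gap {z z1 : ℝ → ℝ} (hz : ∀ t, HasDerivAt z (z1 t) t)
    (hz1 : ∀ t, HasDerivAt z1 (-(D.alpha t / 2 * z t)) t) {s e : ℝ} (hse : s < e) (zs : z s = 0)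
    (ze : z e = 0) (zs1 : z1 s ≠ 0) :
    s + 2 * π ≤ e ∧ (e = s + 2 * π → ∀ t, D.beta t = 0) := by
  wlog hpos : 0 < z1 s generalizing z z1
  · exact this (z := fun t => -z t) (z1 := fun t => -z1 t) (fun t => (hz t).fun_neg)
      (fun t => (hz1 t).fun_neg.congr_deriv (by ring)) (by simp [zs]) (by simp [ze]) (by simpa)
      (by simpa using lt_of_le_of_ne (not_lt.1 hpos) zs1)
  have h := D.hill_pos hz hz1 zs hpos
  refine ⟨?_, fun he => h.2 (he ▸ ze)⟩
  by_contra! hlt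
  have := h.1 e ⟨hse, hlt⟩
  linarith

theorem comb_zero_gap (hx : IsHillBasis D.alpha x x') {a b s e : ℝ} (hab : a ≠ 0 ∨ b ≠ 0)
    (hse : s < e) (zs : a * x s 0 + b * x s 1 = 0) (ze : a * x e 0 + b * x e 1 = 0) :
    s + 2 * π ≤ e ∧ (e = s + 2 * π → ∀ t, D.beta t = 0) := by
  refine zero_gap (hx.hasDerivAt_comb a b) (hx.hasDerivAt_comb' a b) hse zs ze fun h => ?_
  obtain ⟨ha, hb⟩ := hx.coeff_eq_zero zs h
  simp [ha, hb] at hab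

theorem exists_linearEquiv_of_beta_eq_zero (hx : IsHillBasis D.alpha x x')
    (hβ : ∀ t, D.beta t = 0) : ∃ A : Space3 ≃ₗ[ℝ] Space3, ∀ t, D.curve t =
      A ![x t 0 ^ 2 + x t 1 ^ 2, x t 0 ^ 2 - x t 1 ^ 2, 2 * (x t 0 * x t 1)] :=
  hx.exists_linearEquiv_square D.hasDerivAt_alpha D.continuous_alpha1 D.hasDerivAt_curve
    D.hasDerivAt_curve1 (fun t => (D.hasDerivAt_curve2 t).congr_deriv (by rw [hβ, add_zero]))
    (linearIndependent_three fun _ _ _ h => D.curve_comb_eq_zero h)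

/-- Periodicity of the curve means that the squares of the solutions are periodic, so `x(t + 2π)` is
parallel to `x(t)` and `T = ±1`. The sign is decided by the positivity of solutions between zeros.
-/
theorem monodromy_of_beta_eq_zero (hx : IsHillBasis D.alpha x x')
    (hT : ∀ t, x (t + 2 * π) = T.mulVec (x t)) (hβ : ∀ t, D.beta t = 0) : T = -1 := by
  obtain ⟨A, hA⟩ := exists_linearEquiv_of_beta_eq_zero hx hβ
  refine (hx.eq_one_or_neg_one hT fun t => ?_).resolve_left ?_
  · have h := D.periodic_curve t
    rw [hA, hA, A.injective.eq_iff] at h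
    have e0 := congrFun h 0
    have e1 := congrFun h 1
    have e2 := congrFun h 2
    simp at e0 e1 e2
    -- The Lorentz product of the light-like vectors built from `x` and from its shift is `2 det²`;
    -- it vanishes because these vectors coincide.
    rw [← sq_eq_zero_iff]
    linear_combination (x t 0 ^ 2 + x t 1 ^ 2) / 2 * e0 - (x t 0 ^ 2 - x t 1 ^ 2) / 2 * e1 -
      2 * (x t 0 * x t 1) * e2
  · rintro rfl
    have hp : Function.Periodic x (2 * π) := fun t => by simpa using hT t
    have hp' := hp.of_hasDerivAt hx.hasDerivAt_vec
    have hw := hx.wronskian_ne 0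
    -- The combination that vanishes at `0`. If `T = 1`, it vanishes at `2π` with the same nonzero
    -- derivative, yet has one sign in between. The factor `c` below only makes this derivative
    -- positive.
    set a := -x 0 1
    set b := x 0 0
    have zs : ∀ s : ℝ, s = 0 ∨ s = 2 * π → a * x s 0 + b * x s 1 = 0 := by
      rintro s (rfl | rfl)
      · simp only [a, b]; ring
      · have := hp 0
        rw [zero_add] at this
        rw [this]; simp only [a, b]; ring
    have hw' : a * x' 0 0 + b * x' 0 1 ≠ 0 := by
      intro h; apply hw; linear_combination h
    have h1 := hx.hasDerivAt_comb a b
    have h2 := hx.hasDerivAt_comb' a b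
    have key : ∀ c : ℝ, 0 < c * (a * x' 0 0 + b * x' 0 1) → False := by
      intro c hc
      have h := D.hill_pos (fun t => (h1 t).const_mul c)
        (fun t => ((h2 t).const_mul c).congr_deriv (by ring)) (s := 0)
        (by rw [zs 0 (.inl rfl), mul_zero]) hc
      have hd := (h1 (2 * π)).const_mul c
      have hx2 : x' (2 * π) = x' 0 := by simpa using hp' 0
      rw [hx2] at hd
      have hle := hasDerivAt_iff_tendsto_slope.1 hd
      have := le_of_tendsto (hle.mono_left (nhdsWithin_mono _
        (fun t (ht : t < 2 * π) => ht.ne) : 𝓝[<] (2 * π) ≤ 𝓝[≠] (2 * π))) (b := 0) (by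
          filter_upwards [Ioo_mem_nhdsLT two_pi_pos] with t ht
          rw [slope_def_field, zs _ (.inr rfl), mul_zero, sub_zero]
          exact div_nonpos_of_nonneg_of_nonpos (h.1 t (by simpa using ht)).le
            (by linarith [ht.2]))
      linarith
    exact key (a * x' 0 0 + b * x' 0 1) (mul_self_pos.2 hw')

/-- Trace `-2` and determinant one give the eigenvalue `-1`. The corresponding antiperiodic solution
changes sign within a period, so it has two zeros exactly one period apart. -/
theorem beta_eq_zero_of_trace (hx : IsHillBasis D.alpha x x')
    (hT : ∀ t, x (t + 2 * π) = T.mulVec (x t)) (htr : T.trace = -2) : ∀ t, D.beta t = 0 := by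
  have hdet := hx.det_eq_one hT
  have h1 : (T + 1).det = 0 := by
    rw [Matrix.det_fin_two] at hdet ⊢
    rw [Matrix.trace_fin_two] at htr
    simp
    linear_combination hdet + htr
  obtain ⟨v, hv, hvT⟩ := Matrix.exists_vecMul_eq_zero_iff.2 h1
  have hv0 : v 0 ≠ 0 ∨ v 1 ≠ 0 := by
    by_contra! h
    exact hv (funext fun i => by fin_cases i; exacts [h.1, h.2])
  have e0 := congrFun hvT 0
  have e1 := congrFun hvT 1
  simp [Matrix.vecMul, dotProduct, Fin.sum_univ_two] at e0 e1
  have hneg : ∀ t, v 0 * x (t + 2 * π) 0 + v 1 * x (t + 2 * π) 1 =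
      -(v 0 * x t 0 + v 1 * x t 1) := fun t => by
    rw [hT]
    simp only [Matrix.mulVec, dotProduct, Fin.sum_univ_two]
    linear_combination x t 0 * e0 + x t 1 * e1
  have hc : Continuous fun t => v 0 * x t 0 + v 1 * x t 1 :=
    continuous_iff_continuousAt.2 fun t => (hx.hasDerivAt_comb (v 0) (v 1) t).continuousAt
  have hivt : (0 : ℝ) ∈ uIcc (v 0 * x 0 0 + v 1 * x 0 1)
      (v 0 * x (0 + 2 * π) 0 + v 1 * x (0 + 2 * π) 1) := by
    rw [hneg, mem_uIcc]
    rcases le_total 0 (v 0 * x 0 0 + v 1 * x 0 1) with h | h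
    · right; constructor <;> linarith
    · left; constructor <;> linarith
  obtain ⟨s, -, hs⟩ := intermediate_value_uIcc hc.continuousOn hivt
  exact (comb_zero_gap hx hv0 (by linarith [two_pi_pos]) hs
    (by rw [hneg s, neg_eq_zero]; exact hs)).2 rfl

end SupportData

/-! ### Regularity, and flows on the circle. -/

theorem contDiff_succ_of_hasDerivAt {E : Type*} [NormedAddCommGroup E] [NormedSpace ℝ E]
    {f f' : ℝ → E} {n : ℕ} (hf : ∀ t, HasDerivAt f (f' t) t) (hf' : ContDiff ℝ n f') :
    ContDiff ℝ (n + 1 : ℕ) f := by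
  have hd : deriv f = f' := funext fun t => (hf t).deriv
  push_cast
  exact contDiff_succ_iff_deriv.2 ⟨fun t => (hf t).differentiableAt, by simp, hd ▸ hf'⟩

theorem contDiff_of_hasDerivAt {E : Type*} [NormedAddCommGroup E] [NormedSpace ℝ E]
    {f f' : ℝ → E} {n : ℕ} (hf : ∀ t, HasDerivAt f (f' t) t) (h : ContDiff ℝ (n + 1 : ℕ) f) :
    ContDiff ℝ n f' := by
  have hd : deriv f = f' := funext fun t => (hf t).deriv
  push_cast at h
  exact hd ▸ (contDiff_succ_iff_deriv.1 h).2.2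

theorem continuous_of_hasDerivAt {E : Type*} [NormedAddCommGroup E] [NormedSpace ℝ E]
    {f f' : ℝ → E} (hf : ∀ t, HasDerivAt f (f' t) t) : Continuous f :=
  continuous_iff_continuousAt.2 fun t => (hf t).continuousAt

theorem IsHillBasis.contDiff {α : ℝ → ℝ} {x x' : ℝ → Fin 2 → ℝ} (hx : IsHillBasis α x x')
    {n : ℕ} (hα : ContDiff ℝ n α) : ContDiff ℝ (n + 2 : ℕ) x := by
  induction n with
  | zero =>
    have h0 := continuous_of_hasDerivAt hx.hasDerivAt_vec
    have h1 : Continuous α := hα.continuous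
    exact contDiff_succ_of_hasDerivAt (n := 1) hx.hasDerivAt_vec
      (contDiff_succ_of_hasDerivAt (n := 0) hx.hasDerivAt_vec'
        (contDiff_zero.2 (by fun_prop)))
  | succ n ih =>
    have h0 : ContDiff ℝ (n + 1 : ℕ) x :=
      (ih (hα.of_le (by exact_mod_cast n.le_succ))).of_le (by exact_mod_cast (n + 1).le_succ)
    exact contDiff_succ_of_hasDerivAt (n := n + 2) hx.hasDerivAt_vec
      (contDiff_succ_of_hasDerivAt (n := n + 1) hx.hasDerivAt_vec'
        ((hα.div_const 2).smul h0).neg)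

theorem Function.Periodic.sub_id_surjective {f : ℝ → ℝ} {c : ℝ} (hc : 0 < c) (hf : Continuous f)
    (h : ∀ t, f (t + c) = f t + c) : Function.Surjective f := by
  have hp : Function.Periodic (fun t => f t - t) c := fun t => by
    simp only [h]; ring
  have key : ∀ n : ℤ, f (n * c) = f 0 + n * c := fun n => by
    have := hp.int_mul n 0
    simp only [zero_add, sub_zero] at this
    linarith
  intro y
  obtain ⟨n, hn⟩ := exists_int_gt ((y - f 0) / c)
  obtain ⟨k, hk⟩ := exists_int_lt ((y - f 0) / c)
  rw [div_lt_iff₀ hc] at hn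
  rw [lt_div_iff₀ hc] at hk
  exact mem_range_of_exists_le_of_exists_ge hf ⟨k * c, by rw [key]; linarith⟩
    ⟨n * c, by rw [key]; linarith⟩

/-- The flow of a positive periodic vector field on the circle of total period `2π`. -/
theorem exists_periodic_flow {g : ℝ → ℝ} {n : ℕ} (hg : ContDiff ℝ n g) (hpos : ∀ t, 0 < g t)
    (hper : Function.Periodic g (2 * π)) (hint : ∫ t in (0 : ℝ)..2 * π, (g t)⁻¹ = 2 * π) :
    ∃ ψ : ℝ → ℝ, (∀ t, HasDerivAt ψ (g (ψ t)) t) ∧ ContDiff ℝ (n + 1 : ℕ) ψ ∧ StrictMono ψ ∧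
      Function.Surjective ψ ∧ ∀ t, ψ (t + 2 * π) = ψ t + 2 * π := by
  have hgi : Continuous fun t => (g t)⁻¹ := hg.continuous.inv₀ fun t => (hpos t).ne'
  -- The flow is the inverse of the travel time `θ = ∫ 1/g`. The normalisation of the integral says
  -- that one turn takes time `2π`.
  set θ : ℝ → ℝ := fun t => ∫ s in (0 : ℝ)..t, (g s)⁻¹ with hθ
  have hθd : ∀ t, HasDerivAt θ (g t)⁻¹ t := fun t => (hgi.integral_hasStrictDerivAt 0 t).hasDerivAt
  have hθc : Continuous θ := continuous_of_hasDerivAt hθd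
  have hθp : ∀ t, θ (t + 2 * π) = θ t + 2 * π := fun t => by
    have hd : ∀ t, HasDerivAt (fun t => θ (t + 2 * π) - θ t) 0 t := fun t =>
      (((hθd (t + 2 * π)).comp_add_const t (2 * π)).fun_sub (hθd t)).congr_deriv
        (by rw [hper t, sub_self])
    have := is_const_of_deriv_eq_zero (fun t => (hd t).differentiableAt)
      (fun t => (hd t).deriv) t 0
    simp only [zero_add] at this
    have h0 : θ 0 = 0 := by simp [hθ]
    have h1 : θ (2 * π) = 2 * π := hint
    linarith
  have hmono : StrictMono θ := strictMono_of_deriv_pos fun t => by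
    rw [(hθd t).deriv]; exact inv_pos.2 (hpos t)
  have hsurj := Function.Periodic.sub_id_surjective two_pi_pos hθc hθp
  let e := hmono.orderIsoOfSurjective θ hsurj
  have he : ∀ t, θ (e.symm t) = t := fun t => e.apply_symm_apply t
  have hψd : ∀ t, HasDerivAt e.symm (g (e.symm t)) t := fun t => by
    have := (hθd (e.symm t)).of_local_left_inverse e.symm.continuous.continuousAt
      (inv_ne_zero (hpos _).ne') (.of_forall he)
    rwa [inv_inv] at this
  refine ⟨e.symm, hψd, ?_, e.symm.strictMono, e.symm.surjective, fun t => ?_⟩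
  -- Bootstrapping in `ψ' = g(ψ)`.
  · have : ∀ j ≤ n, ContDiff ℝ (j + 1 : ℕ) e.symm := by
      intro j
      induction j with
      | zero =>
        exact fun _ => contDiff_succ_of_hasDerivAt (n := 0) hψd
          (contDiff_zero.2 (hg.continuous.comp e.symm.continuous))
      | succ j ih =>
        exact fun hj => contDiff_succ_of_hasDerivAt (n := j + 1) hψd
          ((hg.of_le (by exact_mod_cast hj)).comp (ih (by omega)))
    exact this n le_rfl
  · apply hmono.injective
    rw [he, hθp, he]

/-! ### Existence of the balanced parametrization. -/

namespace SupportData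

variable {D : SupportData} {x x' : ℝ → Fin 2 → ℝ} {T : Matrix (Fin 2) (Fin 2) ℝ}

/-- There is a monodromy-invariant quadratic form which is positive along the solutions. -/
theorem exists_invariant_form (hx : IsHillBasis D.alpha x x')
    (hT : ∀ t, x (t + 2 * π) = T.mulVec (x t)) : ∃ a b c : ℝ,
      (∀ t, 0 < a * x t 0 ^ 2 + b * (x t 0 * x t 1) + c * x t 1 ^ 2) ∧
      Function.Periodic (fun t => a * x t 0 ^ 2 + b * (x t 0 * x t 1) + c * x t 1 ^ 2)
        (2 * π) := by
  have hdet := hx.det_eq_one hT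
  have hTx : ∀ t, x (t + 2 * π) 0 = T 0 0 * x t 0 + T 0 1 * x t 1 ∧
      x (t + 2 * π) 1 = T 1 0 * x t 0 + T 1 1 * x t 1 := fun t => by
    rw [hT]; simp [Matrix.mulVec, dotProduct, Fin.sum_univ_two]
  -- A zero at `s` says that `-x₁(s) x₀ + x₀(s) x₁` vanishes at both `s` and `s + 2π`. This forces
  -- `β = 0` and `T = -1`, under which `x₀² + x₁²` is invariant.
  by_cases hz : ∃ s, x s 0 * x (s + 2 * π) 1 - x s 1 * x (s + 2 * π) 0 = 0
  · obtain ⟨s, hs⟩ := hz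
    have hw := hx.wronskian_ne s
    have hβ := (comb_zero_gap hx (a := -x s 1) (b := x s 0) (s := s) (e := s + 2 * π)
      (by
        by_contra! h
        have h1 : x s 1 = 0 := neg_eq_zero.1 h.1
        exact hw (by rw [h.2, h1]; ring))
      (by linarith [two_pi_pos]) (by ring) (by linear_combination hs)).2 rfl
    have hT1 := monodromy_of_beta_eq_zero hx hT hβ
    refine ⟨1, 0, 1, fun t => ?_, fun t => ?_⟩
    · have hw := hx.wronskian_ne t
      have : x t 0 ≠ 0 ∨ x t 1 ≠ 0 := by
        by_contra! h
        exact hw (by rw [h.1, h.2]; ring)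
      have h0 := sq_nonneg (x t 0)
      have h1 := sq_nonneg (x t 1)
      rcases this with h | h
      · have : 0 < x t 0 ^ 2 := by positivity
        linarith
      · have : 0 < x t 1 ^ 2 := by positivity
        linarith
    · simp only [hT t, hT1, Matrix.neg_mulVec, Matrix.one_mulVec, Pi.neg_apply]
      ring
  · push Not at hz
    -- Otherwise the form is `det (x, Tx)`. It is invariant since `det (Tx, T²x) = det T · det (x,
    -- Tx)`, and it has constant sign by continuity.
    have hG : ∀ t, x t 0 * x (t + 2 * π) 1 - x t 1 * x (t + 2 * π) 0 =
        T 1 0 * x t 0 ^ 2 + (T 1 1 - T 0 0) * (x t 0 * x t 1) + (-T 0 1) * x t 1 ^ 2 := fun t => by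
      rw [(hTx t).1, (hTx t).2]; ring
    have hGp : Function.Periodic (fun t => T 1 0 * x t 0 ^ 2 + (T 1 1 - T 0 0) *
        (x t 0 * x t 1) + (-T 0 1) * x t 1 ^ 2) (2 * π) := fun t => by
      rw [Matrix.det_fin_two] at hdet
      simp only [(hTx t).1, (hTx t).2]
      linear_combination (T 1 0 * x t 0 ^ 2 + (T 1 1 - T 0 0) *
        (x t 0 * x t 1) + (-T 0 1) * x t 1 ^ 2) * hdet
    have hGc : Continuous (fun t => T 1 0 * x t 0 ^ 2 + (T 1 1 - T 0 0) *
        (x t 0 * x t 1) + (-T 0 1) * x t 1 ^ 2) := by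
      have := continuous_of_hasDerivAt (hx.hasDerivAt 0)
      have := continuous_of_hasDerivAt (hx.hasDerivAt 1)
      fun_prop
    have hsign : (∀ t, 0 < T 1 0 * x t 0 ^ 2 + (T 1 1 - T 0 0) * (x t 0 * x t 1) +
        (-T 0 1) * x t 1 ^ 2) ∨ (∀ t, T 1 0 * x t 0 ^ 2 + (T 1 1 - T 0 0) * (x t 0 * x t 1) +
        (-T 0 1) * x t 1 ^ 2 < 0) := by
      by_contra! h
      obtain ⟨⟨s, hs⟩, ⟨t, ht⟩⟩ := h
      obtain ⟨r, hr⟩ := mem_range_of_exists_le_of_exists_ge hGc ⟨s, hs⟩ ⟨t, ht⟩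
      exact hz r ((hG r).trans hr)
    rcases hsign with h | h
    · exact ⟨_, _, _, h, hGp⟩
    · refine ⟨-T 1 0, -(T 1 1 - T 0 0), T 0 1, fun t => by linarith [h t], fun t => ?_⟩
      have := hGp t
      simp only at this ⊢
      linarith

/-- The infinitesimal form of the balanced parametrization. -/
theorem exists_balanced_field (hx : IsHillBasis D.alpha x x')
    (hT : ∀ t, x (t + 2 * π) = T.mulVec (x t)) {n : ℕ} (hα : ContDiff ℝ n D.alpha) :
    ∃ (a : ℝ) (g g1 g2 : ℝ → ℝ), ContDiff ℝ (n + 2 : ℕ) g ∧ (∀ t, 0 < g t) ∧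
      Function.Periodic g (2 * π) ∧ ∫ t in (0 : ℝ)..2 * π, (g t)⁻¹ = 2 * π ∧
      (∀ t, HasDerivAt g (g1 t) t) ∧ (∀ t, HasDerivAt g1 (g2 t) t) ∧
      (∀ t, HasDerivAt g2 (-(D.alpha1 t * g t) - 2 * D.alpha t * g1 t) t) ∧
      ∀ t, 2 * g t * g2 t - g1 t ^ 2 + 2 * D.alpha t * g t ^ 2 = 2 * a := by
  obtain ⟨a', b', c', hpos', hper'⟩ := exists_invariant_form hx hT
  have hxc : ContDiff ℝ (n + 2 : ℕ) x := hx.contDiff hα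
  have hc0 : Continuous fun t => x t 0 := continuous_of_hasDerivAt (hx.hasDerivAt 0)
  have hc1 : Continuous fun t => x t 1 := continuous_of_hasDerivAt (hx.hasDerivAt 1)
  have hgc : Continuous fun t =>
      (a' * x t 0 ^ 2 + b' * (x t 0 * x t 1) + c' * x t 1 ^ 2)⁻¹ :=
    Continuous.inv₀ (by fun_prop) fun t => (hpos' t).ne'
  have hIpos : 0 < ∫ t in (0 : ℝ)..2 * π,
      (a' * x t 0 ^ 2 + b' * (x t 0 * x t 1) + c' * x t 1 ^ 2)⁻¹ :=
    intervalIntegral.intervalIntegral_pos_of_pos (hgc.intervalIntegrable _ _)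
      (fun t => inv_pos.2 (hpos' t)) two_pi_pos
  set I := ∫ t in (0 : ℝ)..2 * π, (a' * x t 0 ^ 2 + b' * (x t 0 * x t 1) + c' * x t 1 ^ 2)⁻¹
  have hpi := pi_pos
  -- Scaling the form by `r` divides the integral `I` of its inverse by `r`, which gives `2π`.
  set r := I / (2 * π) with hr
  have hrpos : 0 < r := by positivity
  obtain ⟨a, b, c, habc⟩ : ∃ a b c : ℝ, ∀ t, a * x t 0 ^ 2 + b * (x t 0 * x t 1) +
      c * x t 1 ^ 2 = r * (a' * x t 0 ^ 2 + b' * (x t 0 * x t 1) + c' * x t 1 ^ 2) :=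
    ⟨r * a', r * b', r * c', fun t => by ring⟩
  have d0 := hx.hasDerivAt 0
  have d1 := hx.hasDerivAt 1
  have d0' := hx.hasDerivAt' 0
  have d1' := hx.hasDerivAt' 1
  set w := x 0 0 * x' 0 1 - x 0 1 * x' 0 0
  have hw : ∀ t, x t 0 * x' t 1 - x t 1 * x' t 0 = w := fun t => hx.wronskian_eq t 0
  -- With `g = Q(x)` one has `g'' = 2Q(x') - αg`, so `2gg'' - g'² + 2αg²` is the discriminant `4ac -
  -- b²` of `Q` times the squared Wronskian.
  refine ⟨(4 * a * c - b ^ 2) * w ^ 2 / 2,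
    fun t => a * x t 0 ^ 2 + b * (x t 0 * x t 1) + c * x t 1 ^ 2,
    fun t => a * (2 * (x t 0 * x' t 0)) + b * (x' t 0 * x t 1 + x t 0 * x' t 1) +
      c * (2 * (x t 1 * x' t 1)),
    fun t => a * (2 * x' t 0 ^ 2) + b * (2 * (x' t 0 * x' t 1)) + c * (2 * x' t 1 ^ 2) -
      D.alpha t * (a * x t 0 ^ 2 + b * (x t 0 * x t 1) + c * x t 1 ^ 2),
    ?_, fun t => ?_, fun t => ?_, ?_, fun t => ?_, fun t => ?_, fun t => ?_, fun t => ?_⟩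
  · have e0 : ContDiff ℝ (n + 2 : ℕ) fun t => x t 0 := contDiff_pi.1 hxc 0
    have e1 : ContDiff ℝ (n + 2 : ℕ) fun t => x t 1 := contDiff_pi.1 hxc 1
    fun_prop
  · exact (mul_pos hrpos (hpos' t)).trans_eq (habc t).symm
  · simp only [habc]
    exact congrArg (r * ·) (hper' t)
  · simp only [habc, mul_inv]
    rw [intervalIntegral.integral_const_mul, hr]
    change (I / (2 * π))⁻¹ * I = 2 * π
    field_simp
  · exact ((((d0 t).fun_pow 2).const_mul a).fun_add (((d0 t).fun_mul (d1 t)).const_mul b)).fun_add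
      (((d1 t).fun_pow 2).const_mul c) |>.congr_deriv (by norm_num; ring)
  · exact (((((d0 t).fun_mul (d0' t)).const_mul 2).const_mul a).fun_add
      ((((d0' t).fun_mul (d1 t)).fun_add ((d0 t).fun_mul (d1' t))).const_mul b)).fun_add
      ((((d1 t).fun_mul (d1' t)).const_mul 2).const_mul c) |>.congr_deriv (by ring)
  · exact ((((((d0' t).fun_pow 2).const_mul 2).const_mul a).fun_add
      ((((d0' t).fun_mul (d1' t)).const_mul 2).const_mul b)).fun_add
      ((((d1' t).fun_pow 2).const_mul 2).const_mul c)).fun_sub ((D.hasDerivAt_alpha t).fun_mul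
      (((((d0 t).fun_pow 2).const_mul a).fun_add (((d0 t).fun_mul (d1 t)).const_mul b)).fun_add
      (((d1 t).fun_pow 2).const_mul c))) |>.congr_deriv (by norm_num; ring)
  · rw [← hw t]; ring

/-- The balanced parametrization solves the third order equation with constant coefficient. -/
theorem hasDerivAt_balanced {a : ℝ} {g g1 g2 ψ : ℝ → ℝ} (hpos : ∀ t, 0 < g t)
    (hg : ∀ t, HasDerivAt g (g1 t) t) (hg1 : ∀ t, HasDerivAt g1 (g2 t) t)
    (hg2 : ∀ t, HasDerivAt g2 (-(D.alpha1 t * g t) - 2 * D.alpha t * g1 t) t)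
    (ha : ∀ t, 2 * g t * g2 t - g1 t ^ 2 + 2 * D.alpha t * g t ^ 2 = 2 * a)
    (hψ : ∀ t, HasDerivAt ψ (g (ψ t)) t) :
    ∃ y1 y2 : ℝ → Space3,
      (∀ t, HasDerivAt (fun t => (g (ψ t))⁻¹ • D.curve (ψ t)) (y1 t) t) ∧
      (∀ t, HasDerivAt y1 (y2 t) t) ∧
      (∀ t, HasDerivAt y2 (-((2 * a) • y1 t) -
        (D.beta (ψ t) * g (ψ t) ^ 3) • ((g (ψ t))⁻¹ • D.curve (ψ t))) t) := by
  have hne : ∀ t, g t ≠ 0 := fun t => (hpos t).ne'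
  have hd1 : ∀ s, HasDerivAt (fun s => (g s)⁻¹ • D.curve s)
      ((g s)⁻¹ • (D.curve1 s - (g1 s / g s) • D.curve s)) s := fun s => by
    refine (((hg s).fun_inv (hne s)).fun_smul (D.hasDerivAt_curve s)).congr_deriv ?_
    have := hne s
    match_scalars <;> field_simp
  have hd2 : ∀ s, HasDerivAt (fun s => D.curve1 s - (g1 s / g s) • D.curve s)
      ((g s)⁻¹ • (g s • D.curve2 s - g1 s • D.curve1 s - (g2 s - g1 s ^ 2 / g s) • D.curve s)) s :=
    fun s => by
    refine ((D.hasDerivAt_curve1 s).fun_sub (((hg1 s).fun_div (hg s) (hne s)).fun_smul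
      (D.hasDerivAt_curve s))).congr_deriv ?_
    have := hne s
    match_scalars <;> field_simp
  have hd3 : ∀ s, HasDerivAt (fun s => g s • D.curve2 s - g1 s • D.curve1 s -
      (g2 s - g1 s ^ 2 / g s) • D.curve s)
      ((g s)⁻¹ • (-((2 * a) • (D.curve1 s - (g1 s / g s) • D.curve s)) -
        (D.beta s * g s ^ 3) • ((g s)⁻¹ • D.curve s))) s := fun s => by
    refine ((((hg s).fun_smul (D.hasDerivAt_curve2 s)).fun_sub ((hg1 s).fun_smul
      (D.hasDerivAt_curve1 s))).fun_sub (((hg2 s).fun_sub (((hg1 s).fun_pow 2).fun_div (hg s)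
      (hne s))).fun_smul (D.hasDerivAt_curve s))).congr_deriv ?_
    have := hne s
    rw [← ha s]
    match_scalars <;> field_simp <;> norm_num <;> ring
  -- Each of the three functions above has a derivative with a factor `g⁻¹`, which cancels against
  -- `ψ' = g(ψ)`.
  have hcomp : ∀ {F : ℝ → Space3} {F' : ℝ → Space3},
      (∀ s, HasDerivAt F ((g s)⁻¹ • F' s) s) → ∀ t, HasDerivAt (fun t => F (ψ t)) (F' (ψ t)) t :=
    fun h t => ((h (ψ t)).scomp t (hψ t)).congr_deriv (by rw [smul_inv_smul₀ (hne _)])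
  exact ⟨_, _, hcomp hd1, hcomp hd2, hcomp hd3⟩

end SupportData

/-! ### From a positively curved cone to a support function. -/

namespace ConvexCone

theorem add_smul_mem {K : ConvexCone ℝ Space3} {p e : Space3} (hp : p ∈ K) (he : e ∈ K) {c : ℝ}
    (hc : 0 < c) : p + c • e ∈ K := K.add_mem hp (K.smul_mem hc he)

theorem add_smul_mem_interior {K : ConvexCone ℝ Space3} {p e : Space3} (hp : p ∈ K)
    (he : e ∈ interior (K : Set Space3)) {c : ℝ} (hc : 0 < c) :
    p + c • e ∈ interior (K : Set Space3) := by
  refine mem_interior.2 ⟨(fun x => c⁻¹ • (x - p)) ⁻¹' interior (K : Set Space3), fun x hx => ?_,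
    isOpen_interior.preimage (by fun_prop), by simpa [hc.ne'] using he⟩
  have := add_smul_mem hp (interior_subset hx : c⁻¹ • (x - p) ∈ (K : Set Space3)) hc
  rwa [smul_inv_smul₀ hc.ne', add_sub_cancel] at this

theorem smul_mem_interior {K : ConvexCone ℝ Space3} {e : Space3}
    (he : e ∈ interior (K : Set Space3)) {c : ℝ} (hc : 0 < c) :
    c • e ∈ interior (K : Set Space3) := by
  refine mem_interior.2 ⟨(fun x => c⁻¹ • x) ⁻¹' interior (K : Set Space3), fun x hx => ?_,
    isOpen_interior.preimage (by fun_prop), by simpa [hc.ne'] using he⟩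
  have := K.smul_mem hc (interior_subset hx : c⁻¹ • x ∈ (K : Set Space3))
  rwa [smul_inv_smul₀ hc.ne'] at this

theorem smul_mem_frontier {K : ConvexCone ℝ Space3} (hK : IsClosed (K : Set Space3)) {v : Space3}
    (hv : v ∈ frontier (K : Set Space3)) {c : ℝ} (hc : 0 < c) :
    c • v ∈ frontier (K : Set Space3) := by
  rw [hK.frontier_eq] at hv ⊢
  refine ⟨K.smul_mem hc hv.1, fun h => hv.2 ?_⟩
  have := smul_mem_interior h (inv_pos.2 hc)
  rwa [inv_smul_smul₀ hc.ne'] at this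

theorem eventually_add_smul_mem {K : ConvexCone ℝ Space3} {e : Space3}
    (he : e ∈ interior (K : Set Space3)) (w : Space3) : ∀ᶠ s in 𝓝 (0 : ℝ), e + s • w ∈ K := by
  have hc : Continuous fun s : ℝ => e + s • w := by fun_prop
  have := hc.continuousAt (x := 0) |>.eventually_mem
    (isOpen_interior.mem_nhds (show e + (0 : ℝ) • w ∈ interior (K : Set Space3) by simpa))
  exact this.mono fun s hs => interior_subset hs

theorem exists_pos_add_smul_mem {K : ConvexCone ℝ Space3} {e : Space3}
    (he : e ∈ interior (K : Set Space3)) (w : Space3) : ∃ s > (0 : ℝ), e + s • w ∈ K := by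
  obtain ⟨s, hs, hs0⟩ := (((eventually_add_smul_mem he w).filter_mono
    (nhdsWithin_le_nhds (s := Ioi 0))).and self_mem_nhdsWithin).exists
  exact ⟨s, hs0, hs⟩

/-- A cone which contains arbitrarily low points over `w` contains the opposite of the
vertical direction. -/
theorem exists_add_smul_not_mem {K : ConvexCone ℝ Space3} (hcl : IsClosed (K : Set Space3))
    {e : Space3} (he : -e ∉ K) (w : Space3) : ∃ z : ℝ, w + z • e ∉ K := by
  by_contra! h
  apply he
  -- If the whole line over `w` were in the cone, then so would be `s (w - s⁻¹ e) = s w - e`, which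
  -- tends to `-e`.
  have hlim : Tendsto (fun s : ℝ => s • w - e) (𝓝[>] 0) (𝓝 ((0 : ℝ) • w - e)) := by
    apply Tendsto.mono_left _ nhdsWithin_le_nhds
    apply Continuous.tendsto
    fun_prop
  rw [zero_smul, zero_sub] at hlim
  refine hcl.mem_of_tendsto hlim ?_
  filter_upwards [self_mem_nhdsWithin] with s (hs : 0 < s)
  have := K.smul_mem hs (h (-s⁻¹))
  rwa [smul_add, smul_smul, mul_neg, mul_inv_cancel₀ hs.ne', neg_one_smul, ← sub_eq_add_neg] at this

end ConvexCone

/-- The height function of a cone above the unit circle, in the coordinates given by `B`. -/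
noncomputable def coneHeight (K : ConvexCone ℝ Space3) (B : Space3 ≃L[ℝ] Space3) (t : ℝ) : ℝ :=
  sInf {z | B ![cos t, sin t, z] ∈ K}

section ConeHeight

variable {K : ConvexCone ℝ Space3} {B : Space3 ≃L[ℝ] Space3}

theorem vec_add_height (B : Space3 ≃L[ℝ] Space3) (a b z z' : ℝ) :
    B ![a, b, z + z'] = B ![a, b, z] + z' • B ![0, 0, 1] := by
  rw [← map_smul, ← map_add]
  congr 1
  ext i
  fin_cases i <;> simp

/-- The heights over a direction form a closed half-line: closed upwards since the axis is in `K`,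
nonempty since the axis is interior, bounded below since the opposite of the axis is not in `K`. -/
theorem mem_cone_iff_coneHeight_le (hcl : IsClosed (K : Set Space3))
    (he : B ![0, 0, 1] ∈ interior (K : Set Space3)) (hne : -B ![0, 0, 1] ∉ K) (t z : ℝ) :
    B ![cos t, sin t, z] ∈ K ↔ coneHeight K B t ≤ z := by
  have heK : B ![0, 0, 1] ∈ K := interior_subset he
  have hup : ∀ z z', z ≤ z' → B ![cos t, sin t, z] ∈ K → B ![cos t, sin t, z'] ∈ K := by
    intro z z' hzz hz
    rcases hzz.eq_or_lt with rfl | h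
    · exact hz
    · have := ConvexCone.add_smul_mem hz heK (sub_pos.2 h)
      rwa [← vec_add_height, add_sub_cancel] at this
  have hnonempty : {z | B ![cos t, sin t, z] ∈ K}.Nonempty := by
    obtain ⟨s, hs, hmem⟩ := ConvexCone.exists_pos_add_smul_mem he (B ![cos t, sin t, 0])
    refine ⟨s⁻¹, ?_⟩
    have := K.smul_mem (inv_pos.2 hs) hmem
    rw [smul_add, inv_smul_smul₀ hs.ne', add_comm, ← vec_add_height, zero_add] at this
    exact this
  have hbdd : BddBelow {z | B ![cos t, sin t, z] ∈ K} := by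
    obtain ⟨z0, hz0⟩ := ConvexCone.exists_add_smul_not_mem hcl hne (B ![cos t, sin t, 0])
    rw [← vec_add_height, zero_add] at hz0
    refine ⟨z0, fun z hz => ?_⟩
    by_contra! hlt
    exact hz0 (hup z z0 hlt.le hz)
  have hcl' : IsClosed {z | B ![cos t, sin t, z] ∈ K} := by
    have hc : Continuous fun z : ℝ => B ![cos t, sin t, z] := by fun_prop
    exact hcl.preimage hc
  exact ⟨fun h => csInf_le hbdd h, fun h => hup _ _ h (hcl'.csInf_mem hnonempty hbdd)⟩

theorem mem_interior_iff_coneHeight_lt (hcl : IsClosed (K : Set Space3))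
    (he : B ![0, 0, 1] ∈ interior (K : Set Space3)) (hne : -B ![0, 0, 1] ∉ K) (t z : ℝ) :
    B ![cos t, sin t, z] ∈ interior (K : Set Space3) ↔ coneHeight K B t < z := by
  constructor
  · intro h
    obtain ⟨s, hs, hmem⟩ := ConvexCone.exists_pos_add_smul_mem h (-B ![0, 0, 1])
    rw [smul_neg, ← neg_smul, ← vec_add_height, mem_cone_iff_coneHeight_le hcl he hne] at hmem
    linarith
  · intro h
    have := ConvexCone.add_smul_mem_interior
      ((mem_cone_iff_coneHeight_le hcl he hne t _).2 le_rfl) he (sub_pos.2 h)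
    rwa [← vec_add_height, add_sub_cancel] at this

theorem mem_frontier_iff_coneHeight_eq (hcl : IsClosed (K : Set Space3))
    (he : B ![0, 0, 1] ∈ interior (K : Set Space3)) (hne : -B ![0, 0, 1] ∉ K) (t z : ℝ) :
    B ![cos t, sin t, z] ∈ frontier (K : Set Space3) ↔ z = coneHeight K B t := by
  rw [hcl.frontier_eq, Set.mem_sdiff, mem_interior_iff_coneHeight_lt hcl he hne, SetLike.mem_coe,
    mem_cone_iff_coneHeight_le hcl he hne, not_lt, le_antisymm_iff, and_comm]

theorem exists_polar (a b : ℝ) (h : a ≠ 0 ∨ b ≠ 0) :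
    ∃ r > 0, ∃ t, a = r * cos t ∧ b = r * sin t := by
  have hz : (⟨a, b⟩ : ℂ) ≠ 0 := by
    intro h0
    rcases h with h | h
    · exact h (congrArg Complex.re h0)
    · exact h (congrArg Complex.im h0)
  exact ⟨‖(⟨a, b⟩ : ℂ)‖, norm_pos_iff.2 hz, Complex.arg ⟨a, b⟩,
    (Complex.norm_mul_cos_arg ⟨a, b⟩).symm, (Complex.norm_mul_sin_arg ⟨a, b⟩).symm⟩

theorem vec_smul (B : Space3 ≃L[ℝ] Space3) (r a b z : ℝ) :
    B ![r * a, r * b, r * z] = r • B ![a, b, z] := by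
  rw [← map_smul]
  congr 1
  ext i
  fin_cases i <;> simp

theorem mem_frontier_iff_exists (hcl : IsClosed (K : Set Space3))
    (he : B ![0, 0, 1] ∈ interior (K : Set Space3)) (hne : -B ![0, 0, 1] ∉ K) (v : Space3) :
    (v ∈ frontier (K : Set Space3) ∧ v ≠ 0) ↔
      ∃ r > (0 : ℝ), ∃ t, v = r • B ![cos t, sin t, coneHeight K B t] := by
  constructor
  · rintro ⟨hv, hv0⟩
    obtain ⟨w, rfl⟩ := B.surjective v
    have hw : w = ![w 0, w 1, w 2] := by ext i; fin_cases i <;> rfl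
    by_cases h : w 0 ≠ 0 ∨ w 1 ≠ 0
    · obtain ⟨r, hr, t, h0, h1⟩ := exists_polar _ _ h
      refine ⟨r, hr, t, ?_⟩
      have hBw : B w = r • B ![cos t, sin t, w 2 / r] := by
        rw [← vec_smul, ← h0, ← h1, mul_div_cancel₀ _ hr.ne', ← hw]
      have := ConvexCone.smul_mem_frontier hcl hv (inv_pos.2 hr)
      rw [hBw, inv_smul_smul₀ hr.ne', mem_frontier_iff_coneHeight_eq hcl he hne] at this
      rw [hBw, this]
    -- On the axis itself there are no nonzero boundary points: one half is interior, the other lies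
    -- outside `K`.
    · push Not at h
      exfalso
      have hBw : B w = w 2 • B ![0, 0, 1] := by
        have := vec_smul B (w 2) 0 0 1
        rw [mul_zero, mul_one] at this
        rw [← this, hw, h.1, h.2]
        simp
      rw [hcl.frontier_eq] at hv
      rcases lt_trichotomy (w 2) 0 with hz | hz | hz
      · apply hne
        have := K.smul_mem (inv_pos.2 (neg_pos.2 hz)) hv.1
        rwa [hBw, smul_smul, inv_neg, neg_mul, inv_mul_cancel₀ hz.ne, neg_one_smul] at this
      · rw [hBw, hz, zero_smul] at hv0
        exact hv0 rfl
      · exact hv.2 (hBw ▸ ConvexCone.smul_mem_interior he hz)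
  · rintro ⟨r, hr, t, rfl⟩
    refine ⟨ConvexCone.smul_mem_frontier hcl
      ((mem_frontier_iff_coneHeight_eq hcl he hne t _).2 rfl) hr, ?_⟩
    intro h0
    rw [smul_eq_zero_iff_right hr.ne', map_eq_zero_iff _ B.injective] at h0
    have e0 : cos t = 0 := congrFun h0 0
    have e1 : sin t = 0 := congrFun h0 1
    have := sin_sq_add_cos_sq t
    rw [e0, e1] at this
    norm_num at this

theorem periodic_coneHeight : Function.Periodic (coneHeight K B) (2 * π) := fun t => by
  simp only [coneHeight, cos_add_two_pi, sin_add_two_pi]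

theorem continuous_coneHeight (hcl : IsClosed (K : Set Space3))
    (he : B ![0, 0, 1] ∈ interior (K : Set Space3)) (hne : -B ![0, 0, 1] ∉ K) :
    Continuous (coneHeight K B) := by
  refine continuous_iff_continuousAt.2 fun t => tendsto_order.2 ⟨fun a ha => ?_, fun a ha => ?_⟩
  · have hc : Continuous fun t : ℝ => B ![cos t, sin t, a] := by fun_prop
    have := hc.continuousAt (x := t) |>.eventually_mem (hcl.isOpen_compl.mem_nhds
      (fun h => not_le.2 ha ((mem_cone_iff_coneHeight_le hcl he hne t a).1 h)))
    exact this.mono fun s hs => not_le.1 fun h =>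
      hs ((mem_cone_iff_coneHeight_le hcl he hne s a).2 h)
  · have hc : Continuous fun t : ℝ => B ![cos t, sin t, a] := by fun_prop
    have := hc.continuousAt (x := t) |>.eventually_mem (isOpen_interior.mem_nhds
      ((mem_interior_iff_coneHeight_lt hcl he hne t a).2 ha))
    exact this.mono fun s hs => (mem_interior_iff_coneHeight_lt hcl he hne s a).1 hs

/-- A defining function vanishes on the boundary. -/
theorem eventually_eq_zero_of_mem_frontier {f : Space3 → ℝ} {q : Space3}
    (hcl : IsClosed (K : Set Space3)) (hf : ContDiffAt ℝ 1 f q)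
    (hloc : ∀ᶠ x in 𝓝 q, x ∈ K ↔ f x ≤ 0) :
    ∀ᶠ x in 𝓝 q, x ∈ frontier (K : Set Space3) → f x = 0 := by
  filter_upwards [hloc.eventually_nhds, hf.eventually (by simp)] with x hx hfx hxf
  rw [hcl.frontier_eq] at hxf
  refine le_antisymm (hx.self_of_nhds.1 hxf.1) ?_
  by_contra! hneg
  apply hxf.2
  rw [mem_interior_iff_mem_nhds]
  filter_upwards [hx, hfx.continuousAt.eventually (gt_mem_nhds hneg)] with y hy hy'
  exact hy.2 (le_of_lt hy')

/-- The derivative of a defining function at a boundary point is non-positive on the cone. -/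
theorem fderiv_nonpos_of_mem {f : Space3 → ℝ} {q x : Space3}
    (hq : q ∈ K) (hf : ContDiffAt ℝ 1 f q) (hfq : f q = 0)
    (hloc : ∀ᶠ x in 𝓝 q, x ∈ K ↔ f x ≤ 0) (hx : x ∈ K) : fderiv ℝ f q x ≤ 0 := by
  have hline : HasDerivAt (fun s : ℝ => q + s • x) x 0 := by
    simpa using ((hasDerivAt_id (0 : ℝ)).smul_const x).const_add q
  have hd : HasDerivAt (fun s : ℝ => f (q + s • x)) (fderiv ℝ f q x) 0 := by
    have h1 : HasFDerivAt f (fderiv ℝ f q) (q + (0 : ℝ) • x) := by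
      simpa using (hf.differentiableAt (by simp)).hasFDerivAt
    exact h1.comp_hasDerivAt 0 hline
  have hs := (hasDerivAt_iff_tendsto_slope.1 hd).mono_left
    (nhdsWithin_mono 0 (fun t (ht : 0 < t) => ht.ne') : 𝓝[>] (0 : ℝ) ≤ 𝓝[≠] 0)
  refine le_of_tendsto hs ?_
  have hev := hline.continuousAt.tendsto.eventually (by simpa using hloc)
  filter_upwards [hev.filter_mono nhdsWithin_le_nhds, self_mem_nhdsWithin] with s h1 (h2 : 0 < s)
  rw [slope_def_field, zero_smul, add_zero, hfq, sub_zero, sub_zero]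
  exact div_nonpos_of_nonpos_of_nonneg (h1.1 (ConvexCone.add_smul_mem hq hx h2)) h2.le

/-- An interior vector can be pushed a little in a direction where the derivative is positive
without leaving the cone, and the derivative is non-positive on the cone. -/
theorem fderiv_neg_of_mem_interior {f : Space3 → ℝ} {q e : Space3}
    (hq : q ∈ K) (hf : ContDiffAt ℝ 1 f q) (hfq : f q = 0) (hdf : fderiv ℝ f q ≠ 0)
    (hloc : ∀ᶠ x in 𝓝 q, x ∈ K ↔ f x ≤ 0) (he : e ∈ interior (K : Set Space3)) :
    fderiv ℝ f q e < 0 := by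
  obtain ⟨v, hv⟩ : ∃ v, 0 < fderiv ℝ f q v := by
    by_contra! h
    refine hdf (ContinuousLinearMap.ext fun v => le_antisymm (h v) ?_)
    have := h (-v)
    rw [map_neg] at this
    simpa using this
  obtain ⟨s, hs, hmem⟩ := ConvexCone.exists_pos_add_smul_mem he v
  have := fderiv_nonpos_of_mem hq hf hfq hloc hmem
  rw [map_add, map_smul, smul_eq_mul] at this
  have := mul_pos hs hv
  linarith

/-- Implicit function theorem for a defining function in the coordinates (angle, height): its
vertical derivative is nonzero because the axis is interior. -/
theorem contDiff_coneHeight {k : ℕ} (hk : 1 ≤ k) (hcl : IsClosed (K : Set Space3))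
    (he : B ![0, 0, 1] ∈ interior (K : Set Space3)) (hne : -B ![0, 0, 1] ∉ K)
    (hbd : HasPositivelyCurvedBoundary k K) : ContDiff ℝ k (coneHeight K B) := by
  have hk0 : (k : WithTop ℕ∞) ≠ 0 := by exact_mod_cast (by omega : k ≠ 0)
  have hk1 : (1 : WithTop ℕ∞) ≤ k := by exact_mod_cast hk
  refine contDiff_iff_contDiffAt.2 fun t0 => ?_
  set h := coneHeight K B with hh
  obtain ⟨hqf, hq0⟩ := (mem_frontier_iff_exists hcl he hne _).2 ⟨1, one_pos, t0, rfl⟩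
  rw [one_smul] at hqf hq0
  obtain ⟨f, hf, hdf, hloc, -⟩ := hbd _ hqf hq0
  have hf1 := hf.of_le hk1
  have hzero := eventually_eq_zero_of_mem_frontier hcl hf1 hloc
  have hfq := hzero.self_of_nhds hqf
  have hqK : B ![cos t0, sin t0, h t0] ∈ K := by
    rw [hcl.frontier_eq] at hqf; exact hqf.1
  have hdfe := fderiv_neg_of_mem_interior hqK hf1 hfq hdf hloc he
  let P : ℝ × ℝ → Space3 := fun u => B ![cos u.1, sin u.1, u.2]
  have hPc : ContDiff ℝ k P := by
    refine B.contDiff.comp (contDiff_pi.2 fun i => ?_)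
    fin_cases i
    · exact contDiff_cos.comp contDiff_fst
    · exact contDiff_sin.comp contDiff_fst
    · exact contDiff_snd
  let F : ℝ × ℝ → ℝ := fun u => f (P u)
  have hF : ContDiffAt ℝ k F (t0, h t0) := ContDiffAt.comp (t0, h t0) hf hPc.contDiffAt
  have hFz : ∀ z : ℝ, fderiv ℝ F (t0, h t0) (0, z) = z * fderiv ℝ f (P (t0, h t0)) (B ![0, 0, 1]) := by
    intro z
    have h1 : HasDerivAt (fun s : ℝ => (t0, h t0 + s * z)) (0, z) 0 := by
      refine (hasDerivAt_const 0 t0).prodMk ?_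
      simpa using ((hasDerivAt_id (0 : ℝ)).mul_const z).const_add (h t0)
    have h2 : HasFDerivAt F (fderiv ℝ F (t0, h t0)) (t0, h t0 + 0 * z) := by
      simpa using (hF.differentiableAt hk0).hasFDerivAt
    have h3 := h2.comp_hasDerivAt 0 h1
    have h4 : HasDerivAt (fun s : ℝ => P (t0, h t0) + s • (z • B ![0, 0, 1]))
        (z • B ![0, 0, 1]) 0 := by
      simpa using ((hasDerivAt_id (0 : ℝ)).smul_const (z • B ![0, 0, 1])).const_add (P (t0, h t0))
    have h5 : HasFDerivAt f (fderiv ℝ f (P (t0, h t0)))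
        (P (t0, h t0) + (0 : ℝ) • (z • B ![0, 0, 1])) := by
      simpa using (hf.differentiableAt hk0).hasFDerivAt
    have h6 := h5.comp_hasDerivAt 0 h4
    rw [map_smul, smul_eq_mul] at h6
    refine h3.unique (h6.congr_of_eventuallyEq (.of_forall fun s => ?_))
    simp only [F, P, Function.comp_apply]
    rw [vec_add_height, smul_smul]
  have hinv : (fderiv ℝ F (t0, h t0) ∘L .inr ℝ ℝ ℝ).IsInvertible := by
    refine ⟨ContinuousLinearEquiv.unitsEquivAut ℝ (Units.mk0 _ hdfe.ne), ?_⟩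
    ext
    simp [hFz]
    rfl
  have huniq := hF.eventually_apply_eq_iff_implicitFunction hk0 hinv
  -- Continuity of `h` keeps its graph in the neighbourhood where the implicit function is the only
  -- solution.
  have hcont : Continuous h := continuous_coneHeight hcl he hne
  have hgraph : Tendsto (fun t => (t, h t)) (𝓝 t0) (𝓝 (t0, h t0)) :=
    (continuous_id.prodMk hcont).tendsto t0
  refine (hF.contDiffAt_implicitFunction hk0 hinv).congr_of_eventuallyEq ?_
  have hPt : Tendsto (fun t => P (t, h t)) (𝓝 t0) (𝓝 (P (t0, h t0))) :=
    (hPc.continuous.tendsto _).comp hgraph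
  filter_upwards [hgraph.eventually huniq, hPt.eventually hzero] with t h1 h2
  refine (h1.1 ?_).symm
  rw [show F (t0, h t0) = 0 from hfq]
  exact h2 ((mem_frontier_iff_coneHeight_eq hcl he hne t _).2 rfl)

/-- Differentiating `f(η) = 0` twice gives `D²f(η', η') + Df(η'') = 0`, and `Df(η) = 0` because `f`
vanishes along the ray. As `η + η''` is `h + h''` times the axis, on which `Df` is negative,
positivity of `D²f(η', η')` gives the sign. -/
theorem coneHeight_add_deriv_pos {k : ℕ} (hk : 2 ≤ k) (hcl : IsClosed (K : Set Space3))
    (he : B ![0, 0, 1] ∈ interior (K : Set Space3)) (hne : -B ![0, 0, 1] ∉ K)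
    (hbd : HasPositivelyCurvedBoundary k K) {h1 h2 : ℝ → ℝ}
    (hh1 : ∀ t, HasDerivAt (coneHeight K B) (h1 t) t) (hh2 : ∀ t, HasDerivAt h1 (h2 t) t)
    (t : ℝ) : 0 < coneHeight K B t + h2 t := by
  set h := coneHeight K B with hh
  have hk1 : (1 : WithTop ℕ∞) ≤ k := by exact_mod_cast (by omega : 1 ≤ k)
  have hk2 : (2 : WithTop ℕ∞) ≤ k := by exact_mod_cast hk
  let η : ℝ → Space3 := fun t => B ![cos t, sin t, h t]
  let η1 : ℝ → Space3 := fun t => B ![-sin t, cos t, h1 t]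
  let η2 : ℝ → Space3 := fun t => B ![-cos t, -sin t, h2 t]
  have hBd : ∀ {g : ℝ → Space3} {g' : Space3} {t : ℝ}, HasDerivAt g g' t →
      HasDerivAt (fun t => B (g t)) (B g') t := fun hg => B.hasFDerivAt.comp_hasDerivAt _ hg
  have hη : ∀ t, HasDerivAt η (η1 t) t := fun t => hBd (hasDerivAt_pi.2 fun i => by
    fin_cases i
    exacts [hasDerivAt_cos t, hasDerivAt_sin t, hh1 t])
  have hη1 : ∀ t, HasDerivAt η1 (η2 t) t := fun t => hBd (hasDerivAt_pi.2 fun i => by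
    fin_cases i
    exacts [(hasDerivAt_sin t).fun_neg, hasDerivAt_cos t, hh2 t])
  have hηf : ∀ t, η t ∈ frontier (K : Set Space3) := fun t =>
    (mem_frontier_iff_coneHeight_eq hcl he hne t _).2 rfl
  have hq0 : η t ≠ 0 := ((mem_frontier_iff_exists hcl he hne _).2
    ⟨1, one_pos, t, (one_smul _ _).symm⟩).2
  obtain ⟨f, hf, hdf, hloc, hcurv⟩ := hbd _ (hηf t) hq0
  have hf1 := hf.of_le hk1
  have hzero := eventually_eq_zero_of_mem_frontier hcl hf1 hloc
  have hfq := hzero.self_of_nhds (hηf t)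
  have hqK : η t ∈ K := by
    have := hηf t
    rw [hcl.frontier_eq] at this; exact this.1
  have hdfe := fderiv_neg_of_mem_interior hqK hf1 hfq hdf hloc he
  have hev0 : ∀ᶠ s in 𝓝 t, f (η s) = 0 :=
    ((hη t).continuousAt.tendsto.eventually hzero).mono fun s hs => hs (hηf s)
  have hevd : ∀ᶠ s in 𝓝 t, fderiv ℝ f (η s) (η1 s) = 0 := by
    filter_upwards [hev0.eventually_nhds,
      (hη t).continuousAt.tendsto.eventually (hf1.eventually (by simp))] with s hs hfs
    have hd := (hfs.differentiableAt (by simp)).hasFDerivAt.comp_hasDerivAt s (hη s)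
    exact hd.unique ((hasDerivAt_const s (0 : ℝ)).congr_of_eventuallyEq hs)
  have hq : fderiv ℝ f (η t) (η t) = 0 := by
    have hline : HasDerivAt (fun s : ℝ => s • η t) (η t) 1 := by
      simpa using (hasDerivAt_id (1 : ℝ)).smul_const (η t)
    have h1 : HasFDerivAt f (fderiv ℝ f (η t)) ((1 : ℝ) • η t) := by
      simpa using (hf1.differentiableAt (by simp)).hasFDerivAt
    have hd := h1.comp_hasDerivAt 1 hline
    refine hd.unique ((hasDerivAt_const (1 : ℝ) (0 : ℝ)).congr_of_eventuallyEq ?_)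
    filter_upwards [hline.continuousAt.tendsto.eventually (by simpa using hzero),
      lt_mem_nhds one_pos] with s hs hs0
    exact hs (ConvexCone.smul_mem_frontier hcl (hηf t) hs0)
  have hd2 : fderiv ℝ (fderiv ℝ f) (η t) (η1 t) (η1 t) + fderiv ℝ f (η t) (η2 t) = 0 := by
    have hf2 : DifferentiableAt ℝ (fderiv ℝ f) (η t) :=
      ((hf.of_le hk2).fderiv_right (m := 1) (by norm_num)).differentiableAt (by simp)
    have hd := (hf2.hasFDerivAt.comp_hasDerivAt t (hη t)).clm_apply (hη1 t)
    exact hd.unique ((hasDerivAt_const t (0 : ℝ)).congr_of_eventuallyEq hevd)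
  have hspan : η1 t ∉ Submodule.span ℝ {η t} := by
    rw [Submodule.mem_span_singleton]
    rintro ⟨c, hc⟩
    have hc' := B.injective ((map_smul B c _).trans hc)
    have e0 : c * cos t = -sin t := congrFun hc' 0
    have e1 : c * sin t = cos t := congrFun hc' 1
    have := sin_sq_add_cos_sq t
    have : (1 : ℝ) = 0 := by linear_combination sin t * e0 - cos t * e1 - this
    norm_num at this
  have hpos := hcurv _ hevd.self_of_nhds hspan
  have hsum : η t + η2 t = (h t + h2 t) • B ![0, 0, 1] := by
    simp only [η, η2]
    rw [← map_add, ← map_smul]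
    congr 1
    ext i
    fin_cases i <;> simp
  have hval : (h t + h2 t) * fderiv ℝ f (η t) (B ![0, 0, 1]) =
      -fderiv ℝ (fderiv ℝ f) (η t) (η1 t) (η1 t) := by
    rw [← smul_eq_mul, ← map_smul, ← hsum, map_add, hq]
    linear_combination hd2
  by_contra! hle
  have := mul_nonneg_of_nonpos_of_nonpos hle hdfe.le
  linarith

end ConeHeight

/-- `D` describes the boundary of `K` in the coordinates given by `B`. -/
def SupportData.Represents (D : SupportData) (B : Space3 ≃L[ℝ] Space3)
    (K : ConvexCone ℝ Space3) : Prop :=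
  ∀ v : Space3, (v ∈ frontier (K : Set Space3) ∧ v ≠ 0) ↔
    ∃ r > (0 : ℝ), ∃ t, v = r • B (D.point t)

theorem exists_supportData {k : ℕ} (hk : 5 ≤ k) {K : ConvexCone ℝ Space3} (hK : IsRegularCone K)
    (hbd : HasPositivelyCurvedBoundary k K) :
    ∃ (D : SupportData) (B : Space3 ≃L[ℝ] Space3), D.Represents B K ∧ ContDiff ℝ k D.h ∧
      ContDiff ℝ (k - 2 : ℕ) D.m := by
  have hcl := hK.isClosed
  -- Any nonzero interior vector serves as axis; salience keeps its opposite out of `K`.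
  obtain ⟨e, he, he0⟩ := (dense_compl_singleton (0 : Space3)).inter_open_nonempty _
    isOpen_interior hK.interior_nonempty
  obtain ⟨B, hB⟩ := SeparatingDual.exists_continuousLinearEquiv_apply_eq (R := ℝ)
    (x := (![0, 0, 1] : Space3)) (y := e) (fun h => by simpa using congrFun h 2) he0
  subst hB
  have hne := hK.salient _ (interior_subset he) he0
  set h := coneHeight K B with hh
  have hhk : ContDiff ℝ k h := contDiff_coneHeight (by omega) hcl he hne hbd
  obtain ⟨j, rfl⟩ : ∃ j, k = j + 5 := ⟨k - 5, by omega⟩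
  have hder : ∀ {f : ℝ → ℝ} {n : ℕ}, ContDiff ℝ (n + 1 : ℕ) f →
      ∀ t, HasDerivAt f (deriv f t) t := fun {f n} hf t =>
    (hf.differentiable (by exact_mod_cast n.succ_ne_zero) t).hasDerivAt
  have hh1 := hder hhk
  have hc1 : ContDiff ℝ (j + 4 : ℕ) (deriv h) := contDiff_of_hasDerivAt hh1 hhk
  have hh2 := hder hc1
  have hc2 : ContDiff ℝ (j + 3 : ℕ) (deriv (deriv h)) := contDiff_of_hasDerivAt hh2 hc1
  have hr : ∀ t, 0 < h t + deriv (deriv h) t := fun t =>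
    coneHeight_add_deriv_pos (by omega) hcl he hne hbd hh1 hh2 t
  -- The exponent `-1/3` realises `h + h'' = m⁻³`; positivity of the base keeps the power as smooth
  -- as `h''`.
  let m : ℝ → ℝ := fun t => (h t + deriv (deriv h) t) ^ (-(1 / 3) : ℝ)
  have hm : ContDiff ℝ (j + 3 : ℕ) m :=
    ((hhk.of_le (by exact_mod_cast (by omega))).add hc2).rpow_const_of_ne fun t => (hr t).ne'
  have hmr : ∀ t, (m t ^ 3)⁻¹ = h t + deriv (deriv h) t := fun t => by
    rw [← Real.rpow_natCast, ← Real.rpow_mul (hr t).le, ← Real.rpow_neg (hr t).le]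
    norm_num
  have hm1 := hder hm
  have hmc1 : ContDiff ℝ (j + 2 : ℕ) (deriv m) := contDiff_of_hasDerivAt hm1 hm
  have hm2 := hder hmc1
  have hmc2 : ContDiff ℝ (j + 1 : ℕ) (deriv (deriv m)) := contDiff_of_hasDerivAt hm2 hmc1
  have hm3 := hder hmc2
  have hmc3 : ContDiff ℝ j (deriv (deriv (deriv m))) := contDiff_of_hasDerivAt hm3 hmc2
  have hhp : Function.Periodic h (2 * π) := periodic_coneHeight
  let D : SupportData :=
    { h := h
      h1 := deriv h
      m := m
      m1 := deriv m
      m2 := deriv (deriv m)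
      m3 := deriv (deriv (deriv m))
      hasDerivAt_h := hh1
      hasDerivAt_h1 := fun t => by rw [hmr, add_sub_cancel_left]; exact hh2 t
      hasDerivAt_m := hm1
      hasDerivAt_m1 := hm2
      hasDerivAt_m2 := hm3
      continuous_m3 := hmc3.continuous
      m_pos := fun t => Real.rpow_pos_of_pos (hr t) _
      periodic_h := hhp
      periodic_m := fun t => by
        simp only [m]
        rw [hhp t, (hhp.of_hasDerivAt hh1).of_hasDerivAt hh2 t] }
  exact ⟨D, B, mem_frontier_iff_exists hcl he hne, hhk, hm⟩

/-! ### Arbitrary parametrizations: change of the coefficients and of the monodromy. -/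

/-- Polar coordinates along a curve in the punctured plane. -/
theorem exists_polar_lift {n : ℕ} {a b : ℝ → ℝ} (ha : ContDiff ℝ (n + 1 : ℕ) a)
    (hb : ContDiff ℝ (n + 1 : ℕ) b) (hab : ∀ t, a t ≠ 0 ∨ b t ≠ 0) :
    ∃ r ψ : ℝ → ℝ, ContDiff ℝ (n + 1 : ℕ) r ∧ ContDiff ℝ (n + 1 : ℕ) ψ ∧ (∀ t, 0 < r t) ∧
      ∀ t, a t = r t * cos (ψ t) ∧ b t = r t * sin (ψ t) := by
  have hn : ((n + 1 : ℕ) : WithTop ℕ∞) ≠ 0 := by exact_mod_cast n.succ_ne_zero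
  have ha1 : ∀ t, HasDerivAt a (deriv a t) t := fun t => (ha.differentiable hn t).hasDerivAt
  have hb1 : ∀ t, HasDerivAt b (deriv b t) t := fun t => (hb.differentiable hn t).hasDerivAt
  have hac : ContDiff ℝ n (deriv a) := contDiff_of_hasDerivAt ha1 ha
  have hbc : ContDiff ℝ n (deriv b) := contDiff_of_hasDerivAt hb1 hb
  have hpos : ∀ t, 0 < a t ^ 2 + b t ^ 2 := fun t => by
    rcases hab t with h | h <;> positivity
  set r : ℝ → ℝ := fun t => √(a t ^ 2 + b t ^ 2) with hr
  have hrc : ContDiff ℝ (n + 1 : ℕ) r :=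
    ((ha.pow 2).add (hb.pow 2)).sqrt fun t => (hpos t).ne'
  have hrpos : ∀ t, 0 < r t := fun t => Real.sqrt_pos.2 (hpos t)
  have hr2 : ∀ t, r t ^ 2 = a t ^ 2 + b t ^ 2 := fun t => Real.sq_sqrt (hpos t).le
  have hle : (n : WithTop ℕ∞) ≤ (n + 1 : ℕ) := by exact_mod_cast n.le_succ
  -- The angular velocity, whose integral is the angle. Below, `hA` and `hB` say that `(a + ib)
  -- e^(-iψ) / r` keeps its initial value `1`.
  set p : ℝ → ℝ := fun t => (a t * deriv b t - b t * deriv a t) / r t ^ 2 with hp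
  have hpc : ContDiff ℝ n p :=
    (((ha.of_le hle).mul hbc).sub ((hb.of_le hle).mul hac)).div ((hrc.of_le hle).pow 2)
      fun t => (pow_pos (hrpos t) 2).ne'
  obtain ⟨r0, hr0, θ, h0, h1⟩ := exists_polar (a 0) (b 0) (hab 0)
  have hr0' : r 0 = r0 := by
    simp only [hr, h0, h1]
    rw [show (r0 * cos θ) ^ 2 + (r0 * sin θ) ^ 2 = r0 ^ 2 by
      linear_combination r0 ^ 2 * sin_sq_add_cos_sq θ, Real.sqrt_sq hr0.le]
  set ψ : ℝ → ℝ := fun t => θ + ∫ s in (0 : ℝ)..t, p s with hψ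
  have hψd : ∀ t, HasDerivAt ψ (p t) t := fun t =>
    (hpc.continuous.integral_hasStrictDerivAt 0 t).hasDerivAt.const_add θ
  have hψ0 : ψ 0 = θ := by simp [hψ]
  refine ⟨r, ψ, hrc, contDiff_succ_of_hasDerivAt hψd hpc, hrpos, ?_⟩
  have hrd : ∀ t, HasDerivAt r ((a t * deriv a t + b t * deriv b t) / r t) t := fun t => by
    refine ((((ha1 t).fun_pow 2).fun_add ((hb1 t).fun_pow 2)).sqrt (hpos t).ne').congr_deriv ?_
    have := (hrpos t).ne'
    change _ / (2 * r t) = _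
    field_simp
    norm_num
    try ring
  have hu : ∀ t, HasDerivAt (fun t => a t / r t) (-(p t) * (b t / r t)) t := fun t => by
    have := (hrpos t).ne'
    refine ((ha1 t).fun_div (hrd t) this).congr_deriv ?_
    simp only [hp]
    field_simp
    linear_combination deriv a t * hr2 t
  have hv : ∀ t, HasDerivAt (fun t => b t / r t) (p t * (a t / r t)) t := fun t => by
    have := (hrpos t).ne'
    refine ((hb1 t).fun_div (hrd t) this).congr_deriv ?_
    simp only [hp]
    field_simp
    linear_combination deriv b t * hr2 t
  have hA : ∀ t, a t / r t * cos (ψ t) + b t / r t * sin (ψ t) = 1 := fun t => by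
    have hd : ∀ t, HasDerivAt (fun t => a t / r t * cos (ψ t) + b t / r t * sin (ψ t)) 0 t :=
      fun t => (((hu t).fun_mul (hψd t).cos).fun_add ((hv t).fun_mul (hψd t).sin)).congr_deriv
        (by ring)
    rw [is_const_of_deriv_eq_zero (fun t => (hd t).differentiableAt) (fun t => (hd t).deriv) t 0,
      h0, h1, hr0', hψ0, mul_div_cancel_left₀ _ hr0.ne', mul_div_cancel_left₀ _ hr0.ne']
    linear_combination sin_sq_add_cos_sq θ
  have hB : ∀ t, b t / r t * cos (ψ t) - a t / r t * sin (ψ t) = 0 := fun t => by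
    have hd : ∀ t, HasDerivAt (fun t => b t / r t * cos (ψ t) - a t / r t * sin (ψ t)) 0 t :=
      fun t => (((hv t).fun_mul (hψd t).cos).fun_sub ((hu t).fun_mul (hψd t).sin)).congr_deriv
        (by ring)
    rw [is_const_of_deriv_eq_zero (fun t => (hd t).differentiableAt) (fun t => (hd t).deriv) t 0,
      h0, h1, hr0', hψ0, mul_div_cancel_left₀ _ hr0.ne', mul_div_cancel_left₀ _ hr0.ne']
    ring
  intro t
  have hrne := (hrpos t).ne'
  have e0 := hA t
  have e1 := hB t
  have e2 := sin_sq_add_cos_sq (ψ t)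
  have ea : a t / r t = cos (ψ t) := by
    linear_combination cos (ψ t) * e0 - sin (ψ t) * e1 - a t / r t * e2
  have eb : b t / r t = sin (ψ t) := by
    linear_combination sin (ψ t) * e0 + cos (ψ t) * e1 - b t / r t * e2
  rw [← ea, ← eb, mul_div_cancel₀ _ hrne, mul_div_cancel₀ _ hrne]
  exact ⟨rfl, rfl⟩

theorem exists_int_of_cos_sin_eq {s t : ℝ} (hc : cos s = cos t) (hs : sin s = sin t) :
    ∃ n : ℤ, s = t + n * (2 * π) := by
  obtain ⟨n, hn⟩ := Real.Angle.angle_eq_iff_two_pi_dvd_sub.1 (Real.Angle.cos_sin_inj hc hs)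
  exact ⟨n, by linarith⟩

namespace SupportData

variable {D : SupportData} {B : Space3 ≃L[ℝ] Space3} {K : ConvexCone ℝ Space3}

theorem point_add_int (D : SupportData) (t : ℝ) (n : ℤ) :
    D.point (t + n * (2 * π)) = D.point t := D.periodic_point.int_mul n t

namespace Represents

theorem point_mem (hD : D.Represents B K) (t : ℝ) : B (D.point t) ∈ frontier (K : Set Space3) ∧ B (D.point t) ≠ 0 :=
  (hD _).2 ⟨1, one_pos, t, (one_smul _ _).symm⟩

/-- The horizontal parts are unit vectors, so `c = ±1`; the sign `-1` would put a nonzero vector and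
its opposite into `K`. -/
theorem eq_of_smul (hD : D.Represents B K) (hK : IsRegularCone K) {s t c : ℝ}
    (h : B (D.point s) = c • B (D.point t)) : ∃ n : ℤ, s = t + n * (2 * π) := by
  have hmem : ∀ t, B (D.point t) ∈ K := fun t => by
    have := (hD.point_mem t).1
    rw [hK.isClosed.frontier_eq] at this
    exact this.1
  have h' := B.injective (h.trans (map_smul B c _).symm)
  have e0 : cos s = c * cos t := congrFun h' 0
  have e1 : sin s = c * sin t := congrFun h' 1
  have hc2 : c ^ 2 = 1 := by
    have h1 := sin_sq_add_cos_sq s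
    have h2 := sin_sq_add_cos_sq t
    rw [e0, e1] at h1
    linear_combination h1 - c ^ 2 * h2
  rcases mul_self_eq_one_iff.1 ((sq c).symm.trans hc2) with rfl | rfl
  · exact exists_int_of_cos_sin_eq (by simpa using e0) (by simpa using e1)
  · exfalso
    rw [neg_one_smul] at h
    exact hK.salient _ (hmem t) (hD.point_mem t).2 (h ▸ hmem s)

end Represents

end SupportData

/-- A lift of the boundary curve lies, up to a global sign, on the boundary of the cone. -/
theorem IsODELift.exists_sign {k : ℕ} {K : ConvexCone ℝ Space3} (hK : IsRegularCone K)
    {c : ℝ → ProjPlane} {y : ℝ → Space3} {α β : ℝ → ℝ} {n : ℕ} (hc : IsPeriodicParam K n c)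
    (hy : IsODELift k c y α β) :
    ∃ ε : ℝ, (ε = 1 ∨ ε = -1) ∧ ∀ t, ε • y t ∈ frontier (K : Set Space3) := by
  have hcl := hK.isClosed
  have hmem : ∀ v ∈ frontier (K : Set Space3), v ∈ K := fun v hv => by
    rw [hcl.frontier_eq] at hv
    exact hv.1
  have hyc : Continuous y := hy.contDiff.continuous
  have hcase : ∀ t, y t ∈ frontier (K : Set Space3) ∨ -y t ∈ frontier (K : Set Space3) := by
    intro t
    obtain ⟨h0, hct⟩ := hy.lift t
    have : c t ∈ projBoundary K := hc.range_eq ▸ mem_range_self t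
    obtain ⟨v, hv, hvf, hcv⟩ := this
    rw [hct, Projectivization.mk_eq_mk_iff'] at hcv
    obtain ⟨a, ha⟩ := hcv
    rcases lt_trichotomy a 0 with h | h | h
    · right
      rw [← ha, ← neg_smul]
      exact ConvexCone.smul_mem_frontier hcl hvf (neg_pos.2 h)
    · rw [h, zero_smul] at ha
      exact absurd ha.symm h0
    · left
      rw [← ha]
      exact ConvexCone.smul_mem_frontier hcl hvf h
  have hexcl : ∀ t, y t ∈ K → -y t ∉ K := fun t h => hK.salient _ h (hy.lift t).1
  -- The line is the disjoint union of the closed sets where `y` lies in `K` and where `-y` does;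
  -- connectedness leaves only one.
  have hclopen : IsClopen {t | y t ∈ K} := by
    refine ⟨hcl.preimage hyc, ?_⟩
    rw [← isClosed_compl_iff]
    have : {t | y t ∈ K}ᶜ = {t | -y t ∈ K} := by
      ext t
      refine ⟨fun h => ?_, fun h h' => hexcl t h' h⟩
      exact ((hcase t).resolve_left fun h' => h (hmem _ h')) |> hmem _
    rw [this]
    exact hcl.preimage hyc.neg
  rcases isClopen_iff.1 hclopen with h | h
  · refine ⟨-1, .inr rfl, fun t => ?_⟩
    rw [neg_one_smul]
    exact (hcase t).resolve_left fun h' => (h ▸ hmem _ h' : t ∈ (∅ : Set ℝ))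
  · refine ⟨1, .inl rfl, fun t => ?_⟩
    rw [one_smul]
    refine (hcase t).resolve_right fun h' => ?_
    have : t ∈ {t | y t ∈ K} := h ▸ mem_univ t
    exact hexcl t this (hmem _ h')

/-- The derivative of a lift of a regular projective curve is not proportional to the lift. -/
theorem IsPeriodicParam.deriv_ne_smul {K : ConvexCone ℝ Space3} {n : ℕ} (hn : 1 ≤ n)
    {c : ℝ → ProjPlane} (hc : IsPeriodicParam K n c) {y y1 : ℝ → Space3}
    (hy : ∀ t, ∃ h : y t ≠ 0, c t = Projectivization.mk ℝ (y t) h)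
    (hy1 : ∀ t, HasDerivAt y (y1 t) t) (t r : ℝ) : y1 t ≠ r • y t := by
  intro hr
  obtain ⟨η, hη, hli, hev⟩ := hc.regular t
  have hηd : HasDerivAt η (deriv η t) t :=
    (hη.differentiableAt (by exact_mod_cast (by omega : n ≠ 0))).hasDerivAt
  obtain ⟨i, hi⟩ : ∃ i, y t i ≠ 0 := by
    by_contra! h
    exact (hy t).1 (funext h)
  have hyi : HasDerivAt (fun s => y s i) (y1 t i) t := hasDerivAt_pi.1 (hy1 t) i
  have hηi : HasDerivAt (fun s => η s i) (deriv η t i) t := hasDerivAt_pi.1 hηd i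
  have hq := hηi.fun_div hyi hi
  -- Two lifts differ by a factor, and as a quotient of coordinates this factor is differentiable.
  -- So if `y'` were parallel to `y` at `t`, then `η'` would be parallel to `η`.
  have hEq : η =ᶠ[𝓝 t] fun s => (η s i / y s i) • y s := by
    filter_upwards [hev, hyi.continuousAt.eventually_ne hi] with s hs hsi
    obtain ⟨h0, hcs⟩ := hs
    obtain ⟨h1, hcs'⟩ := hy s
    rw [hcs', Eq.comm, Projectivization.mk_eq_mk_iff'] at hcs
    obtain ⟨a, ha⟩ := hcs
    rw [← ha]
    simp only [Pi.smul_apply, smul_eq_mul]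
    rw [mul_div_cancel_right₀ _ hsi]
  have hd := (hηd.congr_of_eventuallyEq hEq.symm).unique (hq.fun_smul (hy1 t))
  rw [LinearIndependent.pair_iff] at hli
  obtain ⟨l, hl⟩ : ∃ l : ℝ, η t = l • y t := ⟨_, hEq.self_of_nhds⟩
  obtain ⟨d, hd⟩ : ∃ d : ℝ, deriv η t = d • y t :=
    ⟨_, hd.trans (by rw [hr, smul_smul, ← add_smul])⟩
  have hl0 : l ≠ 0 := fun h => one_ne_zero (hli 1 0 (by rw [hl, h]; simp)).1
  have := hli (-d) l (by rw [hl, hd]; module)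
  exact hl0 this.2

/-- Consequences of the third order equations for a curve `m • Y(ψ)`. -/
theorem SupportData.transport_relations {D : SupportData} {m m1 m2 m3 ψ p p1 p2 : ℝ → ℝ}
    {α γ : ℝ → ℝ} {Y1 Y2 Y3 : ℝ → Space3}
    (hm : ∀ t, HasDerivAt m (m1 t) t) (hm1 : ∀ t, HasDerivAt m1 (m2 t) t)
    (hm2 : ∀ t, HasDerivAt m2 (m3 t) t) (hψ : ∀ t, HasDerivAt ψ (p t) t)
    (hp : ∀ t, HasDerivAt p (p1 t) t) (hp1 : ∀ t, HasDerivAt p1 (p2 t) t)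
    (hY : ∀ t, HasDerivAt (fun t => m t • D.curve (ψ t)) (Y1 t) t)
    (hY1 : ∀ t, HasDerivAt Y1 (Y2 t) t) (hY2 : ∀ t, HasDerivAt Y2 (Y3 t) t)
    (hode : ∀ t, Y3 t + (2 * α t) • Y1 t + γ t • (m t • D.curve (ψ t)) = 0)
    (hp0 : ∀ t, p t ≠ 0) (hm0 : ∀ t, m t ≠ 0) :
    (∀ t, m1 t * p t + m t * p1 t = 0) ∧
    ∀ t, α t = D.alpha (ψ t) * p t ^ 2 - m2 t / m t + m1 t ^ 2 / (2 * m t ^ 2) := by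
  have c0 : ∀ t, HasDerivAt (fun t => D.curve (ψ t)) (p t • D.curve1 (ψ t)) t := fun t =>
    (D.hasDerivAt_curve (ψ t)).scomp t (hψ t)
  have c1 : ∀ t, HasDerivAt (fun t => D.curve1 (ψ t)) (p t • D.curve2 (ψ t)) t := fun t =>
    (D.hasDerivAt_curve1 (ψ t)).scomp t (hψ t)
  have c2 : ∀ t, HasDerivAt (fun t => D.curve2 (ψ t))
      (p t • ((-(2 * D.alpha (ψ t))) • D.curve1 (ψ t) +
        (-(D.alpha1 (ψ t) + D.beta (ψ t))) • D.curve (ψ t))) t := fun t =>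
    (D.hasDerivAt_curve2 (ψ t)).scomp t (hψ t)
  have e1 : ∀ t, Y1 t = m1 t • D.curve (ψ t) + (m t * p t) • D.curve1 (ψ t) := fun t =>
    (hY t).unique (((hm t).fun_smul (c0 t)).congr_deriv (by module))
  have e2 : ∀ t, Y2 t = m2 t • D.curve (ψ t) +
      (2 * m1 t * p t + m t * p1 t) • D.curve1 (ψ t) + (m t * p t ^ 2) • D.curve2 (ψ t) :=
    fun t => (hY1 t).unique (by
      rw [funext e1]
      exact (((hm1 t).fun_smul (c0 t)).fun_add (((hm t).fun_mul (hp t)).fun_smul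
        (c1 t))).congr_deriv (by module))
  have e3 := fun t => (hY2 t).unique (by
      rw [funext e2]
      exact (((hm2 t).fun_smul (c0 t)).fun_add (((((hm1 t).const_mul 2).fun_mul (hp t)).fun_add
        ((hm t).fun_mul (hp1 t))).fun_smul (c1 t))).fun_add
        (((hm t).fun_mul ((hp t).fun_pow 2)).fun_smul (c2 t)))
  -- Comparison of coefficients in the frame `Y`, `Y'`, `Y''` at `ψ`. The `Y''` coefficient gives
  -- `(mp)' = 0`, the `Y'` coefficient gives the transformation law of `α`; the zeroth order
  -- coefficient `γ` stays arbitrary.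
  have hcoef := fun t => D.curve_comb_eq_zero (t := ψ t)
    (a := m3 t + m t * p t ^ 3 * (-(D.alpha1 (ψ t) + D.beta (ψ t))) + 2 * α t * m1 t + γ t * m t)
    (b := 3 * m2 t * p t + 3 * m1 t * p1 t + m t * p2 t - 2 * D.alpha (ψ t) * m t * p t ^ 3 +
      2 * α t * (m t * p t))
    (c := 3 * p t * (m1 t * p t + m t * p1 t)) (by
      rw [← hode t, e3 t, e1 t]
      match_scalars <;> norm_num <;> ring)
  have hE1 : ∀ t, m1 t * p t + m t * p1 t = 0 := fun t => by
    have := (hcoef t).2.2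
    simpa [hp0 t] using this
  have hE2 : ∀ t, m2 t * p t + m1 t * p1 t + (m1 t * p1 t + m t * p2 t) = 0 := fun t => by
    have hd := ((hm1 t).fun_mul (hp t)).fun_add ((hm t).fun_mul (hp1 t))
    rw [funext hE1] at hd
    exact hd.unique (hasDerivAt_const t 0)
  refine ⟨hE1, fun t => ?_⟩
  have hb := (hcoef t).2.1
  have h1 := hE1 t
  have h2 := hE2 t
  have hm0' := hm0 t
  have hp0' := hp0 t
  have hp1v : p1 t = -(m1 t * p t) / m t := by
    field_simp
    linear_combination h1
  have : p t * (2 * m2 t - m1 t ^ 2 / m t - 2 * D.alpha (ψ t) * m t * p t ^ 2 + 2 * α t * m t) = 0 := by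
    have : m1 t * p1 t = -(m1 t ^ 2 * p t) / m t := by rw [hp1v]; ring
    linear_combination hb - h2 - this
  have := (mul_eq_zero.1 this).resolve_left hp0'
  field_simp at this ⊢
  linear_combination this

/-- The transport of solutions of the second order equation. -/
theorem IsHillBasis.transport {A α : ℝ → ℝ} {x x' : ℝ → Fin 2 → ℝ} (hx : IsHillBasis A x x')
    {m m1 m2 ψ p p1 : ℝ → ℝ} (hm : ∀ t, HasDerivAt m (m1 t) t)
    (hm1 : ∀ t, HasDerivAt m1 (m2 t) t) (hψ : ∀ t, HasDerivAt ψ (p t) t)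
    (hp : ∀ t, HasDerivAt p (p1 t) t) (hE1 : ∀ t, m1 t * p t + m t * p1 t = 0)
    (hα : ∀ t, α t = A (ψ t) * p t ^ 2 - m2 t / m t + m1 t ^ 2 / (2 * m t ^ 2))
    (hp0 : ∀ t, p t ≠ 0) (hm0 : ∀ t, 0 < m t) :
    ∃ w', IsHillBasis α (fun t => √(m t) • x (ψ t)) w' := by
  have hs : ∀ t, 0 < √(m t) := fun t => Real.sqrt_pos.2 (hm0 t)
  have hs2 : ∀ t, √(m t) ^ 2 = m t := fun t => Real.sq_sqrt (hm0 t).le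
  have hσ : ∀ t, HasDerivAt (fun t => √(m t)) (m1 t / (2 * √(m t))) t := fun t =>
    (hm t).sqrt (hm0 t).ne'
  have hX : ∀ i t, HasDerivAt (fun t => x (ψ t) i) (x' (ψ t) i * p t) t := fun i t =>
    (hx.hasDerivAt i (ψ t)).comp t (hψ t)
  have hX' : ∀ i t, HasDerivAt (fun t => x' (ψ t) i) (-(A (ψ t) / 2 * x (ψ t) i) * p t) t :=
    fun i t => (hx.hasDerivAt' i (ψ t)).comp t (hψ t)
  refine ⟨fun t i => m1 t / (2 * √(m t)) * x (ψ t) i + √(m t) * (x' (ψ t) i * p t),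
    fun i t => ?_, fun i t => ?_, fun t => ?_⟩
  · exact (hσ t).fun_mul (hX i t)
  · refine ((((hm1 t).fun_div ((hσ t).const_mul 2) (mul_pos two_pos (hs t)).ne').fun_mul
      (hX i t)).fun_add ((hσ t).fun_mul ((hX' i t).fun_mul (hp t)))).congr_deriv ?_
    have h1 := (hs t).ne'
    have h2 := hs2 t
    have h3 := hE1 t
    have h4 := (hm0 t).ne'
    simp only [Pi.smul_apply, smul_eq_mul]
    rw [hα t]
    rw [← h2] at h3 ⊢
    rw [Real.sqrt_sq (hs t).le]
    generalize √(m t) = σ at h1 h3 ⊢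
    field_simp
    linear_combination 4 * σ ^ 2 * x' (ψ t) i * h3
  · have h := hx.wronskian_ne (ψ t)
    have h1 := hs2 t
    simp only [Pi.smul_apply, smul_eq_mul]
    have : √(m t) * x (ψ t) 0 * (m1 t / (2 * √(m t)) * x (ψ t) 1 + √(m t) * (x' (ψ t) 1 * p t)) -
        √(m t) * x (ψ t) 1 * (m1 t / (2 * √(m t)) * x (ψ t) 0 + √(m t) * (x' (ψ t) 0 * p t)) =
        √(m t) ^ 2 * p t * (x (ψ t) 0 * x' (ψ t) 1 - x (ψ t) 1 * x' (ψ t) 0) := by ring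
    rw [this]
    exact mul_ne_zero (mul_ne_zero (pow_ne_zero 2 (hs t).ne') (hp0 t)) h

/-- The difference always has sine `0` and cosine `1`; differentiating the sine shows that it is
constant, so a single integer serves all `t`. -/
theorem eq_of_forall_eq_add_int {ψ p : ℝ → ℝ} (hψ : ∀ t, HasDerivAt ψ (p t) t)
    (h : ∀ t, cos (ψ (t + 2 * π)) = cos (ψ t) ∧ sin (ψ (t + 2 * π)) = sin (ψ t)) :
    ∃ n : ℤ, ∀ t, ψ (t + 2 * π) = ψ t + n * (2 * π) := by
  have hd : ∀ t, HasDerivAt (fun t => ψ (t + 2 * π) - ψ t) (p (t + 2 * π) - p t) t := fun t =>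
    ((hψ (t + 2 * π)).comp_add_const t (2 * π)).fun_sub (hψ t)
  have hsin : ∀ t, sin (ψ (t + 2 * π) - ψ t) = 0 := fun t => by
    rw [sin_sub, (h t).1, (h t).2]; ring
  have hcos : ∀ t, cos (ψ (t + 2 * π) - ψ t) = 1 := fun t => by
    rw [cos_sub, (h t).1, (h t).2, ← sq, ← sq, cos_sq_add_sin_sq]
  have hp : ∀ t, p (t + 2 * π) - p t = 0 := fun t => by
    have h1 := (hd t).sin
    rw [funext hsin, hcos, one_mul] at h1
    exact h1.unique (hasDerivAt_const t 0)
  obtain ⟨n, hn⟩ := exists_int_of_cos_sin_eq (h 0).1 (h 0).2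
  refine ⟨n, fun t => ?_⟩
  have := is_const_of_deriv_eq_zero (fun t => (hd t).differentiableAt)
    (fun t => (hd t).deriv.trans (hp t)) t 0
  linarith

theorem injective_of_hasDerivAt_ne_zero {ψ p : ℝ → ℝ} (hψ : ∀ t, HasDerivAt ψ (p t) t)
    (hp : ∀ t, p t ≠ 0) : Function.Injective ψ := by
  have key : ∀ s t, s < t → ψ s ≠ ψ t := fun s t hst h => by
    obtain ⟨r, -, hr⟩ := exists_hasDerivAt_eq_zero hst
      (continuous_of_hasDerivAt hψ).continuousOn h (fun x _ => hψ x)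
    exact hp r hr
  intro s t h
  by_contra hne
  rcases lt_or_gt_of_ne hne with hst | hst
  · exact key s t hst h
  · exact key t s hst h.symm

theorem Matrix.inv_eq_neg_one_iff {T : Matrix (Fin 2) (Fin 2) ℝ} (hT : T.det = 1) :
    T⁻¹ = -1 ↔ T = -1 := by
  have hu : IsUnit T.det := by rw [hT]; exact isUnit_one
  constructor
  · intro h
    have := Matrix.mul_nonsing_inv T hu
    rw [h, mul_neg, mul_one] at this
    exact neg_eq_iff_eq_neg.1 this
  · rintro rfl
    exact Matrix.inv_eq_left_inv (by simp)

theorem Matrix.trace_inv_of_det_eq_one {T : Matrix (Fin 2) (Fin 2) ℝ} (hT : T.det = 1) :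
    T⁻¹.trace = T.trace := by
  rw [Matrix.inv_def, hT, Ring.inverse_one, one_smul, Matrix.adjugate_fin_two, Matrix.trace_fin_two,
    Matrix.trace_fin_two]
  simp [add_comm]

/-- The monodromy of any parametrization of the boundary curve is the one of the reference
parametrization, up to conjugation and inversion, and its solutions have zeros at least one period
apart. -/
theorem IsODELift.exists_hillBasis {k : ℕ} (hk : 5 ≤ k) {K : ConvexCone ℝ Space3}
    (hK : IsRegularCone K) {D : SupportData} {B : Space3 ≃L[ℝ] Space3} (hD : D.Represents B K)
    {x x' : ℝ → Fin 2 → ℝ} {T : Matrix (Fin 2) (Fin 2) ℝ} (hx : IsHillBasis D.alpha x x')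
    (hT : ∀ t, x (t + 2 * π) = T.mulVec (x t)) {c : ℝ → ProjPlane} {y : ℝ → Space3}
    {α β : ℝ → ℝ} (hc : IsPeriodicParam K (k - 1) c) (hy : IsODELift k c y α β) :
    ∃ (w w' : ℝ → Fin 2 → ℝ) (S : Matrix (Fin 2) (Fin 2) ℝ), IsHillBasis α w w' ∧
      (∀ t, w (t + 2 * π) = S.mulVec (w t)) ∧ S.trace = T.trace ∧ (S = -1 ↔ T = -1) ∧
      ∀ a b s e : ℝ, (a ≠ 0 ∨ b ≠ 0) → s < e → a * w s 0 + b * w s 1 = 0 →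
        a * w e 0 + b * w e 1 = 0 → s + 2 * π ≤ e := by
  have hpi := two_pi_pos
  obtain ⟨ε, hε, hεy⟩ := hy.exists_sign hK hc
  have hε0 : ε ≠ 0 := by rcases hε with rfl | rfl <;> norm_num
  let Y : ℝ → Space3 := fun t => B.symm (ε • y t)
  have hBY : ∀ t, B (Y t) = ε • y t := fun t => B.apply_symm_apply _
  -- Three derivatives are available because `k - 2 ≥ 3`.
  have hy3 : ContDiff ℝ (2 + 1 : ℕ) y := hy.contDiff.of_le (by exact_mod_cast (by omega))
  have hY3 : ContDiff ℝ (2 + 1 : ℕ) Y := B.symm.contDiff.comp (hy3.const_smul ε)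
  have hYi : ∀ i, ContDiff ℝ (2 + 1 : ℕ) fun t => Y t i := contDiff_pi.1 hY3
  have hYp : Function.Periodic Y (2 * π) := fun t => by simp only [Y, hy.periodic t]
  have hrep : ∀ t, ∃ r > (0 : ℝ), ∃ θ, Y t = r • D.point θ := fun t => by
    obtain ⟨r, hr, θ, h⟩ := (hD (ε • y t)).1 ⟨hεy t, smul_ne_zero hε0 (hy.lift t).1⟩
    exact ⟨r, hr, θ, B.injective (by rw [hBY, h, map_smul])⟩
  obtain ⟨r, ψ, hr3, hψ3, hrpos, hpolar⟩ := exists_polar_lift (hYi 0) (hYi 1) fun t => by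
    obtain ⟨r, hr, θ, h⟩ := hrep t
    by_contra! h0
    have e0 : r * cos θ = 0 := (congrFun h 0).symm.trans h0.1
    have e1 : r * sin θ = 0 := (congrFun h 1).symm.trans h0.2
    have := sin_sq_add_cos_sq θ
    have : r ^ 2 = 0 := by
      linear_combination r * cos θ * e0 + r * sin θ * e1 - r ^ 2 * this
    exact hr.ne' (by simpa using this)
  have hYψ : ∀ t, Y t = r t • D.point (ψ t) := fun t => by
    obtain ⟨r', hr', θ, h⟩ := hrep t
    have e0 : r' * cos θ = r t * cos (ψ t) := (congrFun h 0).symm.trans (hpolar t).1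
    have e1 : r' * sin θ = r t * sin (ψ t) := (congrFun h 1).symm.trans (hpolar t).2
    have h1 := sin_sq_add_cos_sq θ
    have h2 := sin_sq_add_cos_sq (ψ t)
    have hsq : r' ^ 2 = r t ^ 2 := by
      linear_combination (r' * cos θ + r t * cos (ψ t)) * e0 + (r' * sin θ + r t * sin (ψ t)) * e1 -
        r' ^ 2 * h1 + r t ^ 2 * h2
    have hrr : r' = r t := (pow_left_inj₀ hr'.le (hrpos t).le two_ne_zero).1 hsq
    rw [hrr] at e0 e1 h
    obtain ⟨n, rfl⟩ := exists_int_of_cos_sin_eq (mul_left_cancel₀ (hrpos t).ne' e0)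
      (mul_left_cancel₀ (hrpos t).ne' e1)
    rw [h, D.point_add_int]
  have hder : ∀ {f : ℝ → ℝ} {n : ℕ}, ContDiff ℝ (n + 1 : ℕ) f →
      ∀ t, HasDerivAt f (deriv f t) t := fun {f n} hf t =>
    (hf.differentiable (by exact_mod_cast n.succ_ne_zero) t).hasDerivAt
  have hψ1 := hder hψ3
  have hψ2 : ContDiff ℝ (1 + 1 : ℕ) (deriv ψ) := contDiff_of_hasDerivAt hψ1 hψ3
  have hp1 := hder hψ2
  have hψ4 : ContDiff ℝ (0 + 1 : ℕ) (deriv (deriv ψ)) := contDiff_of_hasDerivAt hp1 hψ2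
  have hp2 := hder hψ4
  have hDm3 : ContDiff ℝ (2 + 1 : ℕ) D.m :=
    contDiff_succ_of_hasDerivAt D.hasDerivAt_m (contDiff_succ_of_hasDerivAt D.hasDerivAt_m1
      (contDiff_succ_of_hasDerivAt (n := 0) D.hasDerivAt_m2 (contDiff_zero.2 D.continuous_m3)))
  -- The factor relative to the unimodular lift `curve`, rather than to `point`.
  let m : ℝ → ℝ := fun t => r t / D.m (ψ t)
  have hm3 : ContDiff ℝ (2 + 1 : ℕ) m := hr3.div (hDm3.comp hψ3) fun t => D.m_ne _
  have hmpos : ∀ t, 0 < m t := fun t => div_pos (hrpos t) (D.m_pos _)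
  have hm1 := hder hm3
  have hmc2 : ContDiff ℝ (1 + 1 : ℕ) (deriv m) := contDiff_of_hasDerivAt hm1 hm3
  have hm2 := hder hmc2
  have hmc1 : ContDiff ℝ (0 + 1 : ℕ) (deriv (deriv m)) := contDiff_of_hasDerivAt hm2 hmc2
  have hm4 := hder hmc1
  have hYm : Y = fun t => m t • D.curve (ψ t) := funext fun t => by
    simp only [m, SupportData.curve]
    rw [smul_smul, div_mul_cancel₀ _ (D.m_ne _), hYψ]
  have hder' : ∀ {f : ℝ → Space3} {n : ℕ}, ContDiff ℝ (n + 1 : ℕ) f →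
      ∀ t, HasDerivAt f (deriv f t) t := fun {f n} hf t =>
    (hf.differentiable (by exact_mod_cast n.succ_ne_zero) t).hasDerivAt
  have hy1 := hder' hy3
  have hyc2 : ContDiff ℝ (1 + 1 : ℕ) (deriv y) := contDiff_of_hasDerivAt hy1 hy3
  have hy2 := hder' hyc2
  have hyc1 : ContDiff ℝ (0 + 1 : ℕ) (deriv (deriv y)) := contDiff_of_hasDerivAt hy2 hyc2
  have hy4 := hder' hyc1
  let L : Space3 →L[ℝ] Space3 := ε • (B.symm : Space3 →L[ℝ] Space3)
  have hL : ∀ v, L v = ε • B.symm v := fun v => rfl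
  have hYL : ∀ t, Y t = L (y t) := fun t => by
    rw [hL, ← map_smul]
  have hLd : ∀ {f : ℝ → Space3} {f' : Space3} {t : ℝ}, HasDerivAt f f' t →
      HasDerivAt (fun t => L (f t)) (L f') t := fun hf => L.hasFDerivAt.comp_hasDerivAt _ hf
  have hp0 : ∀ t, deriv ψ t ≠ 0 := fun t h0 => by
    have hd : HasDerivAt (fun t => r t • D.point (ψ t))
        (r t • (deriv ψ t • D.point1 (ψ t)) + deriv r t • D.point (ψ t)) t :=
      (hder hr3 t).fun_smul ((D.hasDerivAt_point (ψ t)).scomp t (hψ1 t))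
    rw [h0, zero_smul, smul_zero, zero_add, ← funext hYψ] at hd
    have hd2 := (hLd (hy1 t)).unique ((funext hYL) ▸ hd)
    refine hc.deriv_ne_smul (by omega) hy.lift hy1 t (deriv r t / r t) ?_
    have hy0 : L (y t) = r t • D.point (ψ t) := by rw [← hYL, hYψ]
    have hLinj : Function.Injective L := fun u v huv => by
      rw [hL, hL] at huv
      exact B.symm.injective (smul_right_injective _ hε0 huv)
    apply hLinj
    rw [hd2, map_smul, hy0, smul_smul, div_mul_cancel₀ _ (hrpos t).ne']
  obtain ⟨hE1, hα⟩ := SupportData.transport_relations (D := D) (m := m) (ψ := ψ) (α := α)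
    (γ := fun t => deriv α t + β t) (Y1 := fun t => L (deriv y t))
    (Y2 := fun t => L (deriv (deriv y) t)) (Y3 := fun t => L (deriv (deriv (deriv y)) t))
    hm1 hm2 hm4 hψ1 hp1 hp2 (fun t => by
      rw [← hYm, funext hYL]; exact hLd (hy1 t)) (fun t => hLd (hy2 t)) (fun t => hLd (hy4 t))
    (fun t => by
      have h := hy.ode t
      rw [iteratedDeriv_succ, iteratedDeriv_succ, iteratedDeriv_one] at h
      have h2 := congrArg L h
      rw [← congrFun hYm t, hYL]
      simp only [map_add, map_smul, map_zero] at h2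
      rw [← h2]
      module) hp0 (fun t => (hmpos t).ne')
  obtain ⟨w', hw⟩ := hx.transport hm1 hm2 hψ1 hp1 hE1 hα hp0 hmpos
  have hrp : ∀ t, r (t + 2 * π) = r t := fun t => by
    have h0 := hYp t
    have e0 : r (t + 2 * π) * cos (ψ (t + 2 * π)) = r t * cos (ψ t) := by
      rw [← (hpolar t).1, ← (hpolar (t + 2 * π)).1, h0]
    have e1 : r (t + 2 * π) * sin (ψ (t + 2 * π)) = r t * sin (ψ t) := by
      rw [← (hpolar t).2, ← (hpolar (t + 2 * π)).2, h0]
    have h1 := sin_sq_add_cos_sq (ψ (t + 2 * π))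
    have h2 := sin_sq_add_cos_sq (ψ t)
    refine (pow_left_inj₀ (hrpos _).le (hrpos t).le two_ne_zero).1 ?_
    linear_combination (r (t + 2 * π) * cos (ψ (t + 2 * π)) + r t * cos (ψ t)) * e0 +
      (r (t + 2 * π) * sin (ψ (t + 2 * π)) + r t * sin (ψ t)) * e1 -
      r (t + 2 * π) ^ 2 * h1 + r t ^ 2 * h2
  obtain ⟨n, hn⟩ := eq_of_forall_eq_add_int hψ1 fun t => by
    have h0 := hYp t
    have e0 := (hpolar (t + 2 * π)).1
    have e1 := (hpolar (t + 2 * π)).2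
    rw [h0, hrp, (hpolar t).1] at e0
    rw [h0, hrp, (hpolar t).2] at e1
    exact ⟨(mul_left_cancel₀ (hrpos t).ne' e0).symm, (mul_left_cancel₀ (hrpos t).ne' e1).symm⟩
  have hinj := injective_of_hasDerivAt_ne_zero hψ1 hp0
  have hψc := continuous_of_hasDerivAt hψ1
  have hcψ : ∀ s t, (∃ j : ℤ, ψ s = ψ t + j * (2 * π)) → c s = c t := by
    rintro s t ⟨j, hj⟩
    obtain ⟨h0, hs⟩ := hy.lift s
    obtain ⟨h1, ht⟩ := hy.lift t
    rw [hs, ht, Projectivization.mk_eq_mk_iff']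
    have hYst : (r s / r t) • Y t = Y s := by
      rw [hYψ, hYψ, hj, D.point_add_int, smul_smul, div_mul_cancel₀ _ (hrpos t).ne']
    refine ⟨r s / r t, smul_right_injective _ hε0 ?_⟩
    simp only
    rw [smul_comm, ← hBY, ← hBY, ← map_smul, hYst]
  -- Winding number zero contradicts injectivity of `ψ`. If `|n| ≥ 2`, then `ψ` passes through `ψ 0
  -- ± 2π` before the period ends, and the curve would return too early.
  have hn1 : n = 1 ∨ n = -1 := by
    have h0 := hn 0
    rw [zero_add] at h0
    have hn0 : n ≠ 0 := by
      rintro rfl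
      have := hinj (a₁ := 2 * π) (a₂ := 0) (h0.trans (by simp))
      linarith
    by_contra! hcon
    obtain ⟨j, hj, hlt⟩ : ∃ j : ℤ, (j = 1 ∨ j = -1) ∧ ((0 < j ∧ j < n) ∨ (n < j ∧ j < 0)) := by
      rcases lt_or_gt_of_ne hn0 with h | h
      · exact ⟨-1, .inr rfl, .inr ⟨by omega, by omega⟩⟩
      · exact ⟨1, .inl rfl, .inl ⟨by omega, by omega⟩⟩
    have hmem : ψ 0 + j * (2 * π) ∈ uIcc (ψ 0) (ψ (2 * π)) := by
      rw [h0, mem_uIcc]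
      rcases hlt with ⟨h1, h2⟩ | ⟨h1, h2⟩
      · left
        have h1' : (0 : ℝ) < j := by exact_mod_cast h1
        have h2' : (j : ℝ) < n := by exact_mod_cast h2
        constructor <;> nlinarith
      · right
        have h1' : (n : ℝ) < j := by exact_mod_cast h1
        have h2' : (j : ℝ) < 0 := by exact_mod_cast h2
        constructor <;> nlinarith
    obtain ⟨s, hs, hsψ⟩ := intermediate_value_uIcc hψc.continuousOn hmem
    rw [uIcc_of_le hpi.le] at hs
    have hs2 : s ≠ 2 * π := by
      rintro rfl
      rw [h0] at hsψ
      have : (n : ℝ) = j := mul_right_cancel₀ hpi.ne' (add_left_cancel hsψ)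
      have : n = j := by exact_mod_cast this
      omega
    have := hc.injOn ⟨hs.1, lt_of_le_of_ne hs.2 hs2⟩ ⟨le_rfl, hpi⟩ (hcψ s 0 ⟨j, hsψ⟩)
    rw [this] at hsψ
    have h3 : (j : ℝ) * (2 * π) = 0 := by linarith
    have h4 : (j : ℝ) = 0 := (mul_eq_zero.1 h3).resolve_right hpi.ne'
    have : j = 0 := by exact_mod_cast h4
    omega
  have hmp : ∀ t, m (t + 2 * π) = m t := fun t => by
    simp only [m]
    rw [hrp, hn, D.periodic_m.int_mul n (ψ t)]
  have hdet := hx.det_eq_one hT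
  have hu : IsUnit T.det := by rw [hdet]; exact isUnit_one
  have hgap : ∀ a b s e : ℝ, (a ≠ 0 ∨ b ≠ 0) → s < e →
      a * (√(m s) • x (ψ s)) 0 + b * (√(m s) • x (ψ s)) 1 = 0 →
      a * (√(m e) • x (ψ e)) 0 + b * (√(m e) • x (ψ e)) 1 = 0 → s + 2 * π ≤ e := by
    intro a b s e hab hse h1 h2
    have hz : ∀ t, a * (√(m t) • x (ψ t)) 0 + b * (√(m t) • x (ψ t)) 1 = 0 →
        a * x (ψ t) 0 + b * x (ψ t) 1 = 0 := fun t h => by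
      have h3 := (Real.sqrt_pos.2 (hmpos t)).ne'
      simp only [Pi.smul_apply, smul_eq_mul] at h
      have : √(m t) * (a * x (ψ t) 0 + b * x (ψ t) 1) = 0 := by linear_combination h
      exact (mul_eq_zero.1 this).resolve_left h3
    by_contra! hlt
    have hns := hn s
    rcases hψc.strictMono_of_inj hinj with hmono | hanti
    · have h3 := (SupportData.comb_zero_gap hx hab (hmono hse) (hz s h1) (hz e h2)).1
      have h4 := hmono hlt
      rcases hn1 with rfl | rfl <;> push_cast at hns <;> linarith
    · have h3 := (SupportData.comb_zero_gap hx hab (hanti hse) (hz e h2) (hz s h1)).1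
      have h4 := hanti hlt
      rcases hn1 with rfl | rfl <;> push_cast at hns <;> linarith
  -- An orientation-reversing change of parameter replaces the monodromy by its inverse, which has
  -- the same trace because the determinant is one.
  rcases hn1 with rfl | rfl
  · refine ⟨_, w', T, hw, fun t => ?_, rfl, Iff.rfl, hgap⟩
    rw [hmp, hn, Int.cast_one, one_mul, hT, Matrix.mulVec_smul]
  · refine ⟨_, w', T⁻¹, hw, fun t => ?_, Matrix.trace_inv_of_det_eq_one hdet,
      Matrix.inv_eq_neg_one_iff hdet, hgap⟩
    have h1 := hT (ψ t - 2 * π)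
    rw [sub_add_cancel] at h1
    rw [hmp, hn, Matrix.mulVec_smul, h1, Matrix.mulVec_mulVec, Matrix.nonsing_inv_mul _ hu,
      Matrix.one_mulVec]
    congr 2
    push_cast
    ring

/-! ### The balanced lift on the boundary of the cone. -/

theorem iteratedDeriv_three_eq {y y1 y2 : ℝ → Space3} {y3 : ℝ → Space3}
    (h : ∀ t, HasDerivAt y (y1 t) t) (h1 : ∀ t, HasDerivAt y1 (y2 t) t)
    (h2 : ∀ t, HasDerivAt y2 (y3 t) t) : iteratedDeriv 3 y = y3 := by
  rw [iteratedDeriv_succ, iteratedDeriv_succ, iteratedDeriv_one, funext fun t => (h t).deriv,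
    funext fun t => (h1 t).deriv, funext fun t => (h2 t).deriv]

namespace SupportData

variable {D : SupportData} {B : Space3 ≃L[ℝ] Space3} {K : ConvexCone ℝ Space3}

theorem contDiff_alpha_beta {j : ℕ} (hm : ContDiff ℝ (j + 3 : ℕ) D.m) :
    ContDiff ℝ (j + 1 : ℕ) D.alpha ∧ ContDiff ℝ j D.beta := by
  have h1 : ContDiff ℝ (j + 2 : ℕ) D.m1 := contDiff_of_hasDerivAt D.hasDerivAt_m hm
  have h2 : ContDiff ℝ (j + 1 : ℕ) D.m2 := contDiff_of_hasDerivAt D.hasDerivAt_m1 h1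
  have h3 : ContDiff ℝ j D.m3 := contDiff_of_hasDerivAt D.hasDerivAt_m2 h2
  have hle : ∀ {a b : ℕ}, a ≤ b → (a : WithTop ℕ∞) ≤ b := fun h => by exact_mod_cast h
  have hm0 := hm.of_le (hle (by omega : j ≤ j + 3))
  have h10 := h1.of_le (hle (by omega : j ≤ j + 2))
  have h20 := h2.of_le (hle (by omega : j ≤ j + 1))
  have hne2 : ∀ t, D.m t ^ 2 ≠ 0 := fun t => pow_ne_zero 2 (D.m_ne t)
  exact ⟨contDiff_const.sub (contDiff_const.mul
    (h2.div (hm.of_le (hle (by omega))) D.m_ne)),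
    ((contDiff_const.mul (h3.div hm0 D.m_ne)).add (contDiff_const.mul (h10.div hm0 D.m_ne))).add
      (contDiff_const.mul ((h10.mul h20).div (hm0.pow 2) hne2))⟩

theorem contDiff_point (D : SupportData) {n : ℕ} (hh : ContDiff ℝ n D.h) :
    ContDiff ℝ n D.point := by
  refine contDiff_pi.2 fun i => ?_
  fin_cases i
  exacts [contDiff_cos, contDiff_sin, hh]

namespace Represents

theorem isPeriodicParam (hD : D.Represents B K) (hK : IsRegularCone K) {n : ℕ}
    (hh : ContDiff ℝ n D.h) {ψ p : ℝ → ℝ} (hψ : ∀ t, HasDerivAt ψ (p t) t) (hp : ∀ t, p t ≠ 0)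
    (hψn : ContDiff ℝ n ψ) (hmono : StrictMono ψ) (hsurj : Function.Surjective ψ)
    (hper : ∀ t, ψ (t + 2 * π) = ψ t + 2 * π) :
    IsPeriodicParam K n fun t => Projectivization.mk ℝ (B (D.point (ψ t)))
      (hD.point_mem (ψ t)).2 := by
  refine ⟨fun t => ?_, fun s hs t ht hst => ?_, ?_, fun t => ?_⟩
  · simp only [hper t, D.periodic_point (ψ t)]
  · rw [Projectivization.mk_eq_mk_iff'] at hst
    obtain ⟨a, ha⟩ := hst
    obtain ⟨j, hj⟩ := hD.eq_of_smul hK ha.symm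
    have h0 := hper 0
    rw [zero_add] at h0
    have hs1 := hmono.monotone hs.1
    have hs2 := hmono hs.2
    have ht1 := hmono.monotone ht.1
    have ht2 := hmono ht.2
    rw [h0] at hs2 ht2
    have hpi := two_pi_pos
    -- Both values of `ψ` lie in the half-open interval from `ψ 0` to `ψ 0 + 2π`, so they cannot
    -- differ by a nonzero multiple of `2π`.
    have hj1 : (j : ℝ) < 1 := by
      by_contra! h
      nlinarith
    have hj2 : (-1 : ℝ) < j := by
      by_contra! h
      nlinarith
    have hj0 : j = 0 := by
      have h1 : j < 1 := by exact_mod_cast hj1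
      have h2 : -1 < j := by exact_mod_cast hj2
      omega
    rw [hj0, Int.cast_zero, zero_mul, add_zero] at hj
    exact hmono.injective hj
  · ext q
    constructor
    · rintro ⟨t, rfl⟩
      exact ⟨_, (hD.point_mem (ψ t)).2, (hD.point_mem (ψ t)).1, rfl⟩
    · rintro ⟨v, hv, hvf, rfl⟩
      obtain ⟨r, hr, θ, h⟩ := (hD v).1 ⟨hvf, hv⟩
      obtain ⟨t, rfl⟩ := hsurj θ
      refine ⟨t, ?_⟩
      rw [Projectivization.mk_eq_mk_iff']
      exact ⟨r⁻¹, by rw [h, inv_smul_smul₀ hr.ne']⟩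
  · have hd : HasDerivAt (fun t => B (D.point (ψ t))) (B (p t • D.point1 (ψ t))) t :=
      B.hasFDerivAt.comp_hasDerivAt t ((D.hasDerivAt_point (ψ t)).scomp t (hψ t))
    refine ⟨fun t => B (D.point (ψ t)),
      (B.contDiff.comp ((D.contDiff_point hh).comp hψn)).contDiffAt, ?_,
      .of_forall fun s => ⟨(hD.point_mem (ψ s)).2, rfl⟩⟩
    rw [hd.deriv, LinearIndependent.pair_iff]
    intro a b hab
    rw [← map_smul, ← map_smul, ← map_add, map_eq_zero_iff _ B.injective] at hab
    have e0 : a * cos (ψ t) + b * (p t * -sin (ψ t)) = 0 := congrFun hab 0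
    have e1 : a * sin (ψ t) + b * (p t * cos (ψ t)) = 0 := congrFun hab 1
    have h2 := sin_sq_add_cos_sq (ψ t)
    have ha : a = 0 := by
      linear_combination cos (ψ t) * e0 + sin (ψ t) * e1 - a * h2
    have hb : b * p t = 0 := by
      linear_combination cos (ψ t) * e1 - sin (ψ t) * e0 - b * p t * h2
    exact ⟨ha, (mul_eq_zero.1 hb).resolve_right (hp t)⟩

/-- A parametrization along the field `g` is balanced. -/
theorem exists_balanced_lift (hD : D.Represents B K) (hK : IsRegularCone K) {k : ℕ} (hk : 5 ≤ k)
    (hh : ContDiff ℝ k D.h) (hm : ContDiff ℝ (k - 2 : ℕ) D.m) {a : ℝ} {g g1 g2 ψ : ℝ → ℝ}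
    (hgC : ContDiff ℝ (k - 2 : ℕ) g) (hpos : ∀ t, 0 < g t) (hgper : Function.Periodic g (2 * π))
    (hg : ∀ t, HasDerivAt g (g1 t) t) (hg1 : ∀ t, HasDerivAt g1 (g2 t) t)
    (hg2 : ∀ t, HasDerivAt g2 (-(D.alpha1 t * g t) - 2 * D.alpha t * g1 t) t)
    (ha : ∀ t, 2 * g t * g2 t - g1 t ^ 2 + 2 * D.alpha t * g t ^ 2 = 2 * a)
    (hψ : ∀ t, HasDerivAt ψ (g (ψ t)) t) (hψC : ContDiff ℝ (k - 1 : ℕ) ψ) (hmono : StrictMono ψ)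
    (hsurj : Function.Surjective ψ) (hper : ∀ t, ψ (t + 2 * π) = ψ t + 2 * π) :
    ∃ (c : ℝ → ProjPlane) (y : ℝ → Space3) (β : ℝ → ℝ), IsPeriodicParam K (k - 1) c ∧
      (∀ t, y t ∈ frontier (K : Set Space3)) ∧ IsODELift k c y (fun _ => a) β := by
  obtain ⟨j, rfl⟩ : ∃ j, k = j + 5 := ⟨k - 5, by omega⟩
  have hle : ∀ {a b : ℕ}, a ≤ b → (a : WithTop ℕ∞) ≤ b := fun h => by exact_mod_cast h
  obtain ⟨y1, y2, hy, hy1, hy2⟩ := hasDerivAt_balanced hpos hg hg1 hg2 ha hψ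
  have hBd : ∀ {f : ℝ → Space3} {f' : Space3} {t : ℝ}, HasDerivAt f f' t →
      HasDerivAt (fun t => B (f t)) (B f') t := fun hf => B.hasFDerivAt.comp_hasDerivAt _ hf
  have hycurve : ∀ t, B ((g (ψ t))⁻¹ • D.curve (ψ t)) =
      ((g (ψ t))⁻¹ * D.m (ψ t)) • B (D.point (ψ t)) := fun t => by
    rw [curve, smul_smul, map_smul]
  have hcoef : ∀ t, 0 < (g (ψ t))⁻¹ * D.m (ψ t) := fun t =>
    mul_pos (inv_pos.2 (hpos _)) (D.m_pos _)
  have hfr : ∀ t, B ((g (ψ t))⁻¹ • D.curve (ψ t)) ∈ frontier (K : Set Space3) ∧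
      B ((g (ψ t))⁻¹ • D.curve (ψ t)) ≠ 0 := fun t =>
    (hD _).2 ⟨_, hcoef t, ψ t, hycurve t⟩
  refine ⟨_, fun t => B ((g (ψ t))⁻¹ • D.curve (ψ t)), fun t => D.beta (ψ t) * g (ψ t) ^ 3,
    hD.isPeriodicParam hK (hh.of_le (hle (by omega))) hψ (fun t => (hpos _).ne') hψC hmono hsurj
      hper, fun t => (hfr t).1, ?_⟩
  refine ⟨fun t => ⟨(hfr t).2, ?_⟩, fun t => ?_, fun t => rfl, fun t => ?_, ?_, contDiff_const, ?_,
    fun t => ?_⟩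
  · rw [Projectivization.mk_eq_mk_iff']
    exact ⟨((g (ψ t))⁻¹ * D.m (ψ t))⁻¹, by rw [hycurve, inv_smul_smul₀ (hcoef t).ne']⟩
  · simp only [hper t, hgper (ψ t), D.periodic_curve (ψ t)]
  · simp only [hper t, hgper (ψ t), D.periodic_beta (ψ t)]
  · have hψ3 : ContDiff ℝ (j + 5 - 2 : ℕ) ψ := hψC.of_le (hle (by omega))
    have hc : ContDiff ℝ (j + 5 - 2 : ℕ) D.curve :=
      hm.smul (D.contDiff_point (hh.of_le (hle (by omega))))
    exact B.contDiff.comp (((hgC.comp hψ3).inv fun t => (hpos _).ne').smul (hc.comp hψ3))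
  · have hψ0 : ContDiff ℝ (j + 5 - 5 : ℕ) ψ := hψC.of_le (hle (by omega))
    exact ((contDiff_alpha_beta hm).2.comp hψ0).mul
      (((hgC.of_le (hle (by omega))).comp hψ0).pow 3)
  · rw [iteratedDeriv_three_eq (fun t => hBd (hy t)) (fun t => hBd (hy1 t))
      (fun t => hBd (hy2 t)), (hBd (hy t)).deriv, deriv_const, zero_smul, add_zero]
    simp only [map_sub, map_neg, map_smul]
    module

end Represents

/-- The support data of the unit circle. -/
noncomputable def circle : SupportData where
  h := fun _ => 1
  h1 := fun _ => 0
  m := fun _ => 1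
  m1 := fun _ => 0
  m2 := fun _ => 0
  m3 := fun _ => 0
  hasDerivAt_h := fun t => hasDerivAt_const t 1
  hasDerivAt_h1 := fun t => by simpa using hasDerivAt_const t (0 : ℝ)
  hasDerivAt_m := fun t => hasDerivAt_const t 1
  hasDerivAt_m1 := fun t => hasDerivAt_const t 0
  hasDerivAt_m2 := fun t => hasDerivAt_const t 0
  continuous_m3 := continuous_const
  m_pos := fun _ => one_pos
  periodic_h := fun _ => rfl
  periodic_m := fun _ => rfl

end SupportData

/-! ### The circular cone and ellipsoidal cones. -/

theorem mem_interior_lorentzCone {x : Space3} :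
    x ∈ interior lorentzCone ↔ 0 < x 0 ∧ x 1 ^ 2 + x 2 ^ 2 < x 0 ^ 2 := by
  constructor
  · intro h
    have hc : Continuous fun s : ℝ => x - s • (![1, 0, 0] : Space3) := by fun_prop
    have hev := hc.continuousAt (x := 0) |>.eventually_mem
      (isOpen_interior.mem_nhds (show x - (0 : ℝ) • ![1, 0, 0] ∈ interior lorentzCone by simpa))
    obtain ⟨s, hs, hs0⟩ := ((hev.filter_mono (nhdsWithin_le_nhds (s := Ioi 0))).and
      self_mem_nhdsWithin).exists
    have hs0' : 0 < s := hs0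
    have hmem : x - s • ![1, 0, 0] ∈ lorentzCone := interior_subset hs
    have h1 : 0 ≤ x 0 - s * 1 := hmem.1
    have h2 : (x 1 - s * 0) ^ 2 + (x 2 - s * 0) ^ 2 ≤ (x 0 - s * 1) ^ 2 := hmem.2
    exact ⟨by linarith, by nlinarith⟩
  · rintro ⟨h0, h1⟩
    refine mem_interior.2 ⟨{x | 0 < x 0 ∧ x 1 ^ 2 + x 2 ^ 2 < x 0 ^ 2},
      fun y hy => ⟨hy.1.le, hy.2.le⟩, ?_, h0, h1⟩
    exact (isOpen_lt (α := ℝ) (f := fun _ => 0) (g := fun x : Space3 => x 0) (by fun_prop)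
      (by fun_prop)).inter (isOpen_lt (α := ℝ) (f := fun x : Space3 => x 1 ^ 2 + x 2 ^ 2)
        (g := fun x : Space3 => x 0 ^ 2) (by fun_prop) (by fun_prop))

theorem isClosed_lorentzCone : IsClosed lorentzCone :=
  (isClosed_le (α := ℝ) (f := fun _ => 0) (g := fun x : Space3 => x 0) (by fun_prop)
    (by fun_prop)).inter (isClosed_le (α := ℝ) (f := fun x : Space3 => x 1 ^ 2 + x 2 ^ 2)
      (g := fun x : Space3 => x 0 ^ 2) (by fun_prop) (by fun_prop))

theorem mem_frontier_lorentzCone {x : Space3} :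
    x ∈ frontier lorentzCone ↔ 0 ≤ x 0 ∧ x 1 ^ 2 + x 2 ^ 2 = x 0 ^ 2 := by
  rw [isClosed_lorentzCone.frontier_eq, Set.mem_sdiff, mem_interior_lorentzCone]
  constructor
  · rintro ⟨⟨h0, h1⟩, h2⟩
    refine ⟨h0, ?_⟩
    rcases h0.eq_or_lt with h | h
    · rw [← h] at h1 ⊢
      nlinarith [sq_nonneg (x 1), sq_nonneg (x 2)]
    · exact le_antisymm h1 (not_lt.1 fun h3 => h2 ⟨h, h3⟩)
  · rintro ⟨h0, h1⟩
    exact ⟨⟨h0, h1.le⟩, fun h => h.2.ne h1⟩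

theorem add_mem_lorentzCone {x y : Space3} (hx : x ∈ lorentzCone) (hy : y ∈ lorentzCone) :
    x + y ∈ lorentzCone := by
  obtain ⟨hx0, hx1⟩ := hx
  obtain ⟨hy0, hy1⟩ := hy
  have hcs : x 1 * y 1 + x 2 * y 2 ≤ x 0 * y 0 := by
    refine (abs_le_of_sq_le_sq' ?_ (mul_nonneg hx0 hy0)).2
    calc (x 1 * y 1 + x 2 * y 2) ^ 2
        ≤ (x 1 ^ 2 + x 2 ^ 2) * (y 1 ^ 2 + y 2 ^ 2) := by
          nlinarith [sq_nonneg (x 1 * y 2 - x 2 * y 1)]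
      _ ≤ x 0 ^ 2 * y 0 ^ 2 := mul_le_mul hx1 hy1 (by positivity) (by positivity)
      _ = (x 0 * y 0) ^ 2 := by ring
  refine ⟨add_nonneg hx0 hy0, ?_⟩
  simp only [Pi.add_apply]
  nlinarith

theorem smul_mem_lorentzCone {x : Space3} (hx : x ∈ lorentzCone) {c : ℝ} (hc : 0 ≤ c) :
    c • x ∈ lorentzCone := by
  refine ⟨mul_nonneg hc hx.1, ?_⟩
  simp only [Pi.smul_apply, smul_eq_mul]
  have := mul_le_mul_of_nonneg_left hx.2 (sq_nonneg c)
  nlinarith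

theorem convex_lorentzCone : Convex ℝ lorentzCone := fun _ hx _ hy _ _ ha hb _ =>
  add_mem_lorentzCone (smul_mem_lorentzCone hx ha) (smul_mem_lorentzCone hy hb)

/-- A connected set that meets a closed set but not its frontier lies in its interior. -/
theorem IsPreconnected.subset_interior_of_disjoint_frontier {X : Type*} [TopologicalSpace X]
    {S K : Set X} (hS : IsPreconnected S) (hK : IsClosed K) (hd : ∀ x ∈ S, x ∉ frontier K)
    (hne : (S ∩ K).Nonempty) : S ⊆ interior K := by
  have h : ∀ x ∈ S, x ∈ K → x ∈ interior K := fun x hx hxK => by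
    by_contra hi
    exact hd x hx (hK.frontier_eq ▸ ⟨hxK, hi⟩)
  obtain ⟨x, hx, hxK⟩ := hne
  refine hS.subset_left_of_subset_union isOpen_interior hK.isOpen_compl
    (disjoint_compl_right.mono_left interior_subset) (fun y hy => ?_) ⟨x, hx, h x hx hxK⟩
  by_cases hyK : y ∈ K
  exacts [.inl (h y hy hyK), .inr hyK]

/-- Every point of a regular cone is a sum of two boundary points, one of them along a given
direction of the cone. -/
theorem IsRegularCone.exists_frontier_add {K : ConvexCone ℝ Space3} (hK : IsRegularCone K)
    {v x : Space3} (hv : v ∈ K) (hv0 : v ≠ 0) (hx : x ∈ K) :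
    ∃ s ≥ (0 : ℝ), ∃ u ∈ frontier (K : Set Space3), x = u + s • v := by
  obtain ⟨z, hz⟩ := ConvexCone.exists_add_smul_not_mem hK.isClosed (hK.salient v hv hv0) x
  have hz0 : z ≤ 0 := by
    by_contra! h
    exact hz (ConvexCone.add_smul_mem hx hv h)
  have hc : Continuous fun s : ℝ => x + s • v := by fun_prop
  have hpre : IsPreconnected ((fun s : ℝ => x + s • v) '' Icc z 0) :=
    isPreconnected_Icc.image _ hc.continuousOn
  obtain ⟨_, ⟨s, hs, rfl⟩, hu⟩ : ∃ u ∈ (fun s : ℝ => x + s • v) '' Icc z 0,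
      u ∈ frontier (K : Set Space3) := by
    by_contra! h
    exact hz (interior_subset (hpre.subset_interior_of_disjoint_frontier hK.isClosed h
      ⟨x, ⟨0, right_mem_Icc.2 hz0, by simp⟩, hx⟩ ⟨z, left_mem_Icc.2 hz0, rfl⟩))
  exact ⟨-s, by linarith [hs.2], _, hu, by simp⟩

namespace SupportData.Represents

variable {D : SupportData} {B : Space3 ≃L[ℝ] Space3} {K : ConvexCone ℝ Space3}

theorem circle_of_eq_image {A : Space3 ≃ₗ[ℝ] Space3} (hA : (K : Set Space3) = A '' lorentzCone) :
    ∃ B : Space3 ≃L[ℝ] Space3, circle.Represents B K := by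
  -- The rotation of coordinates accounts for the axis being the last coordinate of `point` but the
  -- first one of `lorentzCone`.
  have hB : ∀ t, ((LinearEquiv.funCongrLeft ℝ ℝ (finRotate 3).symm).trans A) (circle.point t) =
      A ![1, cos t, sin t] := fun t => by
    rw [LinearEquiv.trans_apply]
    congr 1
    ext i
    fin_cases i <;> rfl
  refine ⟨((LinearEquiv.funCongrLeft ℝ ℝ (finRotate 3).symm).trans A).toContinuousLinearEquiv,
    fun v => ?_⟩
  have hfr : frontier (K : Set Space3) = A '' frontier lorentzCone := by
    rw [hA]
    exact (A.toContinuousLinearEquiv.toHomeomorph.image_frontier lorentzCone).symm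
  obtain ⟨u, rfl⟩ := A.surjective v
  rw [hfr, A.injective.mem_set_image, mem_frontier_lorentzCone, ne_eq, map_eq_zero_iff _ A.injective]
  change _ ↔ ∃ r > (0 : ℝ), ∃ t, A u =
    r • ((LinearEquiv.funCongrLeft ℝ ℝ (finRotate 3).symm).trans A) (circle.point t)
  simp only [hB, ← map_smul, A.injective.eq_iff]
  constructor
  · rintro ⟨⟨h0, h1⟩, hu⟩
    have hne : u 1 ≠ 0 ∨ u 2 ≠ 0 := by
      by_contra! h
      rw [h.1, h.2] at h1
      refine hu (funext fun i => ?_)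
      fin_cases i
      exacts [pow_eq_zero_iff two_ne_zero |>.1 (h1.symm.trans (by norm_num)), h.1, h.2]
    obtain ⟨r, hr, t, hc, hs⟩ := exists_polar _ _ hne
    have h : u 0 = r := by
      refine (sq_eq_sq₀ h0 hr.le).1 ?_
      rw [← h1, hc, hs]
      linear_combination r ^ 2 * sin_sq_add_cos_sq t
    refine ⟨r, hr, t, funext fun i => ?_⟩
    fin_cases i
    exacts [h.trans (mul_one r).symm, hc, hs]
  · rintro ⟨r, hr, t, rfl⟩
    refine ⟨⟨?_, ?_⟩, fun h => ?_⟩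
    · change 0 ≤ r * 1
      linarith
    · change (r * cos t) ^ 2 + (r * sin t) ^ 2 = (r * 1) ^ 2
      linear_combination r ^ 2 * sin_sq_add_cos_sq t
    · have : r * 1 = 0 := congrFun h 0
      linarith

/-- Every point of `K` is a sum of boundary vectors, which puts `K` inside the image cone. The
interior of the image cone is connected, meets `K` and misses its frontier, so it lies in `K`;
closures give equality. -/
theorem isEllipsoidal_of_frontier (hD : D.Represents B K) (hK : IsRegularCone K)
    (C : Space3 ≃ₗ[ℝ] Space3) (hC : frontier (K : Set Space3) ⊆ C '' frontier lorentzCone) :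
    IsEllipsoidal K := by
  have hC' : ∀ u ∈ frontier (K : Set Space3), ∃ w ∈ lorentzCone, C w = u := fun u hu => by
    obtain ⟨w, hw, rfl⟩ := hC hu
    exact ⟨w, isClosed_lorentzCone.frontier_subset hw, rfl⟩
  have hsub : (K : Set Space3) ⊆ C '' lorentzCone := fun x hx => by
    obtain ⟨hv, hv0⟩ := hD.point_mem 0
    obtain ⟨s, hs, u, hu, rfl⟩ :=
      hK.exists_frontier_add (hK.isClosed.frontier_subset hv) hv0 hx
    obtain ⟨w, hw, rfl⟩ := hC' u hu
    obtain ⟨w', hw', h'⟩ := hC' _ hv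
    exact ⟨w + s • w', add_mem_lorentzCone hw (smul_mem_lorentzCone hw' hs), by simp [h']⟩
  have hint : interior (C '' lorentzCone) = C '' interior lorentzCone :=
    (C.toContinuousLinearEquiv.toHomeomorph.image_interior lorentzCone).symm
  have hcont : Continuous C := C.toContinuousLinearEquiv.continuous
  have hpre : IsPreconnected (C '' interior lorentzCone) :=
    convex_lorentzCone.interior.isPreconnected.image _ hcont.continuousOn
  obtain ⟨p, hp⟩ := hK.interior_nonempty
  have hpC : p ∈ C '' interior lorentzCone := hint ▸ interior_mono hsub hp
  have hle : C '' interior lorentzCone ⊆ K :=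
    (hpre.subset_interior_of_disjoint_frontier hK.isClosed (fun x hx hxf => by
      obtain ⟨w, hw, rfl⟩ := hx
      obtain ⟨w', hw', h⟩ := hC hxf
      rw [C.injective h] at hw'
      exact hw'.2 hw) ⟨p, hpC, interior_subset hp⟩).trans interior_subset
  refine ⟨C, hsub.antisymm ?_⟩
  have hcl : closure (interior lorentzCone) = lorentzCone := by
    rw [convex_lorentzCone.closure_interior_eq_closure_of_nonempty_interior
      (Set.image_nonempty.1 ⟨p, hpC⟩), isClosed_lorentzCone.closure_eq]
  calc C '' lorentzCone = C '' closure (interior lorentzCone) := by rw [hcl]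
    _ ⊆ closure (C '' interior lorentzCone) := image_closure_subset_closure_image hcont
    _ ⊆ K := hK.isClosed.closure_subset_iff.2 hle

theorem isEllipsoidal_of_beta_eq_zero (hD : D.Represents B K) (hK : IsRegularCone K)
    {x x' : ℝ → Fin 2 → ℝ} (hx : IsHillBasis D.alpha x x') (hβ : ∀ t, D.beta t = 0) :
    IsEllipsoidal K := by
  obtain ⟨A, hA⟩ := D.exists_linearEquiv_of_beta_eq_zero hx hβ
  refine hD.isEllipsoidal_of_frontier hK (A.trans B.toLinearEquiv) fun v hv => ?_
  rcases eq_or_ne v 0 with rfl | hv0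
  · exact ⟨0, mem_frontier_lorentzCone.2 (by simp), map_zero _⟩
  obtain ⟨r, hr, t, rfl⟩ := (hD v).1 ⟨hv, hv0⟩
  have hm := D.m_pos t
  refine ⟨(r * (D.m t)⁻¹) •
    ![x t 0 ^ 2 + x t 1 ^ 2, x t 0 ^ 2 - x t 1 ^ 2, 2 * (x t 0 * x t 1)],
    mem_frontier_lorentzCone.2 ⟨?_, ?_⟩, ?_⟩
  · exact mul_nonneg (by positivity) (by positivity : 0 ≤ x t 0 ^ 2 + x t 1 ^ 2)
  · change (r * (D.m t)⁻¹ * (x t 0 ^ 2 - x t 1 ^ 2)) ^ 2 +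
      (r * (D.m t)⁻¹ * (2 * (x t 0 * x t 1))) ^ 2 = (r * (D.m t)⁻¹ * (x t 0 ^ 2 + x t 1 ^ 2)) ^ 2
    ring
  · rw [map_smul, LinearEquiv.trans_apply, ← hA]
    change (r * (D.m t)⁻¹) • B (D.m t • D.point t) = _
    rw [map_smul, smul_smul, mul_assoc, inv_mul_cancel₀ hm.ne', mul_one]

theorem circle_exists_balanced_lift (hD : circle.Represents B K) (hK : IsRegularCone K) {k : ℕ}
    (hk : 5 ≤ k) : ∃ (c : ℝ → ProjPlane) (y : ℝ → Space3) (β : ℝ → ℝ), IsPeriodicParam K (k - 1) c ∧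
      (∀ t, y t ∈ frontier (K : Set Space3)) ∧ IsODELift k c y (fun _ => 1 / 2) β := by
  have hα : ∀ t, circle.alpha t = 1 / 2 := fun t => by simp [alpha, circle]
  have hα1 : ∀ t, circle.alpha1 t = 0 := fun t => by simp [alpha1, circle]
  exact hD.exists_balanced_lift hK hk contDiff_const contDiff_const (g := fun _ => 1)
    (g1 := fun _ => 0) (g2 := fun _ => 0) (ψ := id) contDiff_const (fun _ => one_pos) (fun _ => rfl)
    (fun t => hasDerivAt_const t 1) (fun t => hasDerivAt_const t 0)
    (fun t => by simpa [hα1] using hasDerivAt_const t (0 : ℝ)) (fun t => by simp [hα])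
    (fun t => hasDerivAt_id t) contDiff_id strictMono_id Function.surjective_id fun _ => rfl

end SupportData.Represents

/-! ### Assembly of the theorem. -/

/-- Periodicity bounds the coefficient, which gives global solutions; it also makes the shifted
basis a basis again, so the two differ by a matrix. -/
theorem SupportData.exists_isHillBasis (D : SupportData) :
    ∃ (x x' : ℝ → Fin 2 → ℝ) (T : Matrix (Fin 2) (Fin 2) ℝ), IsHillBasis D.alpha x x' ∧
      ∀ t, x (t + 2 * π) = T.mulVec (x t) := by
  have hq : ContDiff ℝ 1 fun t => D.alpha t / 2 := D.contDiff_alpha.div_const 2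
  obtain ⟨C, hC⟩ : ∃ C, ∀ t, |D.alpha t / 2| ≤ C := by
    obtain ⟨C, hC⟩ := isCompact_Icc.exists_bound_of_continuousOn (s := Icc 0 (2 * π))
      hq.continuous.continuousOn
    refine ⟨C, fun t => ?_⟩
    obtain ⟨s, hs, hst⟩ := D.periodic_alpha.exists_mem_Ico₀ two_pi_pos t
    rw [hst]
    exact hC s (Ico_subset_Icc_self hs)
  obtain ⟨z, z1, hz, hz1, hz0, hz10⟩ := hill_exists hq hC 1 0
  obtain ⟨w, w1, hw, hw1, hw0, hw10⟩ := hill_exists hq hC 0 1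
  have hx : IsHillBasis D.alpha (fun t => ![z t, w t]) (fun t => ![z1 t, w1 t]) := by
    refine ⟨fun i t => ?_, fun i t => ?_, fun t => ?_⟩
    · fin_cases i
      exacts [hz t, hw t]
    · fin_cases i
      exacts [hz1 t, hw1 t]
    · change z t * w1 t - w t * z1 t ≠ 0
      rw [wronskian_const hz hz1 hw hw1 t 0, hz0, hz10, hw0, hw10]
      norm_num
  have hy : IsHillBasis D.alpha (fun t => ![z (t + 2 * π), w (t + 2 * π)])
      (fun t => ![z1 (t + 2 * π), w1 (t + 2 * π)]) := by
    refine ⟨fun i t => (hx.hasDerivAt i (t + 2 * π)).comp_add_const t _, fun i t => ?_,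
      fun t => hx.wronskian_ne (t + 2 * π)⟩
    rw [← D.periodic_alpha t]
    exact (hx.hasDerivAt' i (t + 2 * π)).comp_add_const t _
  obtain ⟨T, -, hT⟩ := hx.exists_mulVec D.continuous_alpha hy
  exact ⟨_, _, T, hx, hT⟩

theorem Matrix.trace_conj_of_isUnit_det {P T : Matrix (Fin 2) (Fin 2) ℝ} (hP : IsUnit P.det) :
    (P * T * P⁻¹).trace = T.trace := by
  rw [Matrix.trace_mul_comm, ← mul_assoc, Matrix.nonsing_inv_mul _ hP, one_mul]

theorem Matrix.conj_eq_neg_one_iff {P T : Matrix (Fin 2) (Fin 2) ℝ} (hP : IsUnit P.det) :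
    P * T * P⁻¹ = -1 ↔ T = -1 := by
  constructor
  · intro h
    calc T = P⁻¹ * (P * T * P⁻¹) * P := by
          rw [mul_assoc P, Matrix.nonsing_inv_mul_cancel_left _ _ hP, mul_assoc,
            Matrix.nonsing_inv_mul _ hP, mul_one]
      _ = -1 := by rw [h, mul_neg_one, neg_mul, Matrix.nonsing_inv_mul _ hP]
  · rintro rfl
    rw [mul_neg_one, neg_mul, Matrix.mul_nonsing_inv _ hP]

/-- If the zeros of solutions of `x'' + (a / 2) x = 0` are at least `2π` apart, then `a ≤ 1 / 2`. -/
theorem IsHillBasis.le_half_of_gap {a : ℝ} {w w' : ℝ → Fin 2 → ℝ}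
    (hw : IsHillBasis (fun _ => a) w w') (hgap : ∀ p q s e : ℝ, (p ≠ 0 ∨ q ≠ 0) → s < e →
      p * w s 0 + q * w s 1 = 0 → p * w e 0 + q * w e 1 = 0 → s + 2 * π ≤ e) : a ≤ 1 / 2 := by
  by_contra! ha
  have hν2 : √(a / 2) ^ 2 = a / 2 := Real.sq_sqrt (by linarith)
  have hν : 1 / 2 < √(a / 2) := Real.lt_sqrt_of_sq_lt (by linarith)
  set ν := √(a / 2)
  have hpi := pi_pos
  have hlin : ∀ t : ℝ, HasDerivAt (fun t => ν * t) ν t := fun t => by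
    simpa using (hasDerivAt_id t).const_mul ν
  -- The test solution `sin (νt)` has zeros at `0` and `π/ν`, and `π/ν < 2π` as soon as `a > 1/2`.
  obtain ⟨p, q, hpq⟩ := hw.exists_comb continuous_const (z := fun t => sin (ν * t))
    (z1 := fun t => cos (ν * t) * ν) (fun t => (hlin t).sin)
    (fun t => ((hlin t).cos.mul_const ν).congr_deriv (by
      linear_combination (-sin (ν * t)) * hν2))
  have hne : p ≠ 0 ∨ q ≠ 0 := by
    by_contra! h
    have := hpq (π / 2 / ν)
    rw [h.1, h.2, mul_div_cancel₀ _ (by positivity), sin_pi_div_two] at this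
    norm_num at this
  have h := hgap p q 0 (π / ν) hne (by positivity) (by rw [← hpq]; simp)
    (by rw [← hpq, mul_div_cancel₀ _ (by positivity), sin_pi])
  rw [zero_add, le_div_iff₀ (by positivity)] at h
  nlinarith

theorem mainTheorem1 (k : ℕ) (hk : 5 ≤ k) (K : ConvexCone ℝ Space3) (hK : IsRegularCone K)
    (hbd : HasPositivelyCurvedBoundary k K) :
    ∃ a : ℝ,
      -- existence of a balanced parametrization, with coefficient `a`
      (∃ (c : ℝ → ProjPlane) (y : ℝ → Space3) (β : ℝ → ℝ),
        IsPeriodicParam K (k - 1) c ∧ (∀ t, y t ∈ frontier (K : Set Space3)) ∧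
          IsODELift k c y (fun _ => a) β) ∧
      -- the constant depends on `K` only
      (∀ (a' : ℝ) (c : ℝ → ProjPlane) (y : ℝ → Space3) (β : ℝ → ℝ),
        IsPeriodicParam K (k - 1) c → IsODELift k c y (fun _ => a') β → a' = a) ∧
      a ≤ 1 / 2 ∧
      (a = 1 / 2 ↔ IsEllipsoidal K) ∧
      -- in any parametrization, balanced or not, `a` is read off from the monodromy spectrum
      (∀ (c : ℝ → ProjPlane) (y : ℝ → Space3) (α β : ℝ → ℝ),
        IsPeriodicParam K (k - 1) c → IsODELift k c y α β →
          (∃ T, IsMonodromy α T) ∧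
          ∀ T, IsMonodromy α T →
            (∀ l : ℝ, 1 < l →
              (complexSpectrum T = {(l : ℂ), (l : ℂ)⁻¹} ↔
                a = -(Real.log l) ^ 2 / (2 * π ^ 2))) ∧
            (complexSpectrum T = {1} ↔ a = 0) ∧
            (∀ φ : ℝ, 0 < φ → φ < π →
              (complexSpectrum T = {Complex.exp (φ * Complex.I), Complex.exp (-(φ * Complex.I))} ↔
                a = φ ^ 2 / (2 * π ^ 2))) ∧
            (T = -1 ↔ a = 1 / 2)) := by
  obtain ⟨D, B, hD, hh, hm⟩ := exists_supportData hk hK hbd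
  obtain ⟨x, x', T, hx, hT⟩ := D.exists_isHillBasis
  -- The explicit basis for constant coefficients has a monodromy conjugate to the transported one,
  -- which fixes the trace; the transported spacing of zeros gives the bound.
  have hconst : ∀ (a : ℝ) (c : ℝ → ProjPlane) (y : ℝ → Space3) (β : ℝ → ℝ),
      IsPeriodicParam K (k - 1) c → IsODELift k c y (fun _ => a) β →
      a ≤ 1 / 2 ∧ T.trace = constTrace a := fun a c y β hc hy => by
    obtain ⟨w, w', S, hw, hS, hST, -, hgap⟩ := hy.exists_hillBasis hk hK hD hx hT hc
    obtain ⟨u, u', R, hu, hR, hRa⟩ := exists_isHillBasis_const a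
    obtain ⟨P, hP, rfl⟩ := hw.monodromy_conj continuous_const hu hS hR
    rw [Matrix.trace_conj_of_isUnit_det hP, hST] at hRa
    exact ⟨hw.le_half_of_gap hgap, hRa⟩
  have hunique : ∀ {a a' : ℝ}, a ≤ 1 / 2 ∧ T.trace = constTrace a →
      a' ≤ 1 / 2 ∧ T.trace = constTrace a' → a' = a := fun h h' =>
    constTrace_injOn h'.1 h.1 (h'.2.symm.trans h.2)
  obtain ⟨a, hbal⟩ : ∃ (a : ℝ) (c : ℝ → ProjPlane) (y : ℝ → Space3) (β : ℝ → ℝ),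
      IsPeriodicParam K (k - 1) c ∧ (∀ t, y t ∈ frontier (K : Set Space3)) ∧
        IsODELift k c y (fun _ => a) β := by
    obtain ⟨j, rfl⟩ : ∃ j, k = j + 5 := ⟨k - 5, by omega⟩
    obtain ⟨a, g, g1, g2, hgC, hpos, hgper, hint, hg, hg1, hg2, ha⟩ :=
      D.exists_balanced_field hx hT (D.contDiff_alpha_beta hm).1
    obtain ⟨ψ, hψ, hψC, hmono, hsurj, hper⟩ := exists_periodic_flow hgC hpos hgper hint
    exact ⟨a, hD.exists_balanced_lift hK hk hh hm hgC hpos hgper hg hg1 hg2 ha hψ hψC hmono hsurj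
      hper⟩
  have ha : a ≤ 1 / 2 ∧ T.trace = constTrace a := by
    obtain ⟨c, y, β, hc, -, hy⟩ := hbal
    exact hconst a c y β hc hy
  have hβ : a = 1 / 2 → ∀ t, D.beta t = 0 := fun h =>
    D.beta_eq_zero_of_trace hx hT (by rw [ha.2, h, constTrace_half])
  have hT1 : T = -1 ↔ a = 1 / 2 := by
    refine ⟨fun h => ?_, fun h => D.monodromy_of_beta_eq_zero hx hT (hβ h)⟩
    refine hunique ⟨le_rfl, ?_⟩ ha
    rw [h, constTrace_half, Matrix.trace_neg, Matrix.trace_one]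
    simp
  refine ⟨a, hbal, fun a' c y β hc hy => hunique ha (hconst a' c y β hc hy), ha.1,
    ⟨fun h => hD.isEllipsoidal_of_beta_eq_zero hK hx (hβ h), ?_⟩, fun c y α β hc hy => ?_⟩
  -- The same cone, now represented by the circle, has a balanced lift with constant `1/2`;
  -- uniqueness identifies this constant with `a`.
  · rintro ⟨A, hA⟩
    obtain ⟨B', hB'⟩ := SupportData.Represents.circle_of_eq_image hA
    obtain ⟨c, y, β, hc, -, hy⟩ := hB'.circle_exists_balanced_lift hK hk
    exact hunique (hconst _ c y β hc hy) ha
  · have hα : Continuous α := hy.contDiff_alpha.continuous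
    obtain ⟨w, w', S, hw, hS, hST, hS1, -⟩ := hy.exists_hillBasis hk hK hD hx hT hc
    refine ⟨⟨S, (isMonodromy_iff hα).2 ⟨w, w', hw, hS⟩⟩, fun R hR => ?_⟩
    obtain ⟨u, u', hu, hR⟩ := (isMonodromy_iff hα).1 hR
    have hdet := hu.det_eq_one hR
    obtain ⟨P, hP, rfl⟩ := hw.monodromy_conj hα hu hS hR
    obtain ⟨h1, h2, h3⟩ := complexSpectrum_cases hdet ha.1
      (by rw [Matrix.trace_conj_of_isUnit_det hP, hST, ha.2])
    exact ⟨h1, h2, h3, by rw [Matrix.conj_eq_neg_one_iff hP, hS1, hT1]⟩
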